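/- **Setting.** Let $A$ be the operator on $\mathbb R^d$ $$Au(x)=\tfrac12\mathrm{Tr}(\mathbf Q(x)\nabla^2u(x))+b(x)\cdot\nabla u(x)+\int_{\mathbb R^d}\Big(u(x+y)-u(x)-\frac{y\cdot\nabla u(x)}{1+|y|^2}\Big)N(x,dy),$$ where $\mathbf Q=[q_{i,j}]$ and $b$ are bounded and Borel measurable, $\mathbf Q(x)$ is non-negative definite for every $x$, and $N$ is a Lévy kernel (a kernel with $N(x,\{0\})=0$) such that $\sup_x\int\min\{1,|y|^2\}\,N(x,dy)<\infty$. Let $(P_x)_{x\in\mathbb R^d}$ be a strong Markovian solution of the martingale problem for $A$ on the space of càdlàg paths $[0,\infty)\to\mathbb R^d$ with canonical process $(X_t)$: $x\mapsto P_x[C]$ is measurable for each measurable $C$; for every $x$ and every $f\in C^2_b(\mathbb R^d)$ the process $f(X_t)-f(X_0)-\int_0^tAf(X_r)\,dr$ is a $P_x$-martingale for the natural filtration, and $P_x[X_0=x]=1$; the same holds for the mixtures $P_\mu=\int P_x\,\mu(dx)$ with initial law $\mu$, for all Borel probability measures $\mu$; and $(X_t)$ is strongly Markovian with respect to its natural filtration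 and $(P_x)$. Let $D\subset\mathbb R^d$ be a non-empty open connected set, $\tau_D=\inf\{t>0:X_t\notin D\}$, and assume $P_x[\tau_D<\infty]=1$ for all $x\in D$. Put $P^D_tf(x)=\mathbb E_x[f(X_t),\,t<\tau_D]$ and $R^D_\alpha f(x)=\int_0^\infty e^{-\alpha t}P^D_tf(x)\,dt$ for $x\in D$. Let $\mathcal S(D)=\bigcup_{x\in D}(x+\mathrm{supp}\,N(x,\cdot))$, $\partial_SD=\partial D\cup(\mathcal S(D)\setminus D)$, $D_S=D\cup\partial_SD$ and $\bar u_{D_S}=\sup_{D_S}u$. Let $m$ be a $\sigma$-finite Borel measure on $D$ that is non-trivial and not concentrated at a single point, i.e. $m(D\setminus\{x_0\})>0$ for every $x_0\in D$. Assume: * (IR$_m$) $R^D_1f(x)>0$ for all $x\in D$, whenever $f\ge0$ is bounded and Borel on $D$ with $\int_Df\,dm>0$; * (Eig) $\varphi_D:D\to[0,\infty)$ is Borel, $\lambda_D\ge0$, $P^D_t\varphi_D=e^{-\lambda_Dt}\varphi_D$ on $D$ for all $t\ge0$, and $\int_D\varphi_D\,dm>0$; * $\varphi_D$ is bounded. Then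 $\varphi_D>0$ on $D$, so that one can define the semigroup and resolvent of the $\varphi_D$-process, for bounded Borel $f$ on $D$, by $$P^{D,\varphi_D}_tf=e^{\lambda_Dt}\frac{P^D_t(f\varphi_D)}{\varphi_D},\qquad R^{D,\varphi_D}_\alpha f=\int_0^\infty e^{-\alpha t}P^{D,\varphi_D}_tf\,dt,\quad\alpha>0.$$ For a Borel, bounded $c:D\to[0,\infty)$ a *weak subsolution* of $(-A+c)v=0$ in $D$ is a bounded Borel function $u:\mathbb R^d\to\mathbb R$ with $$u(x)\le\mathbb E_x\Big[e^{-\int_0^{\tau_D\wedge t}c(X_r)dr}\,u(X_{\tau_D\wedge t})\Big],\qquad x\in D,\ t\ge0.$$ **Theorem.** The following are equivalent. 1. (The $\varphi_D$-Hopf lemma for $g=0$ and every admissible $c$.) For every Borel, bounded $c:D\to[0,\infty)$ and every weak subsolution $u$ of $(-A+c)v=0$ in $D$ that is not $m$-a.e. constant in $D$ and satisfies $\bar u_{D_S}\ge0$, there is $a>0$ such that $\bar u_{D_S}-u(x)\ge a\,\varphi_D(x)$ for all $x\in D$. 2. (The resolvent family $(R^{D,\varphi_D}_\alpha)_{\alpha>0}$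 is uniformly ergodic.) For every $\alpha>0$ the Markov chain on $D$ with transition kernel $K_\alpha(x,B)=\alpha R^{D,\varphi_D}_\alpha\mathbf 1_B(x)$ is uniformly ergodic: there are an invariant Borel probability measure $\Pi$ on $D$, $C>0$ and $\rho\in(0,1)$ with $$\sup_{x\in D}\|K_\alpha^n(x,\cdot)-\Pi\|_{\mathrm{TV}}\le C\rho^n,\quad n=0,1,2,\dots,$$ where $\|\nu\|_{\mathrm{TV}}=\sup_{\|f\|_\infty\le1}|\int f\,d\nu|$. -/

import Mathlib

open MeasureTheory ProbabilityTheory Filter Topology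
open scoped NNReal ENNReal Matrix

noncomputable section

namespace Hopf

/-! ### The integro-differential operator -/

/-- Euclidean space `ℝ^d`. -/
abbrev E (d : ℕ) := EuclideanSpace ℝ (Fin d)

/-- Coefficients of the integro-differential operator: `Q` and `b` are bounded and Borel, `Q x` is
non-negative definite (only the quadratic form matters), and `N` is a Lévy kernel with
`sup_x ∫ min(1, |y|²) N(x, dy) < ∞` which does not charge the origin. -/
structure Coefficients (d : ℕ) where
  Q : E d → Matrix (Fin d) (Fin d) ℝ
  b : E d → E d
  N : Kernel (E d) (E d)
  measurable_Q : ∀ i j, Measurable fun x => Q x i j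
  bounded_Q : ∃ C : ℝ, ∀ x i j, |Q x i j| ≤ C
  nonneg_Q : ∀ x (ξ : Fin d → ℝ), 0 ≤ ∑ i, ∑ j, Q x i j * ξ i * ξ j
  measurable_b : Measurable b
  bounded_b : ∃ C : ℝ, ∀ x, ‖b x‖ ≤ C
  N_zero : ∀ x, N x {0} = 0
  bounded_N : ∃ C : ℝ≥0, ∀ x, ∫⁻ y, ENNReal.ofReal (min 1 (‖y‖ ^ 2)) ∂(N x) ≤ C

variable {d : ℕ}

/-- `A f(x) = ½ Tr(Q(x)∇²f(x)) + b(x)·∇f(x)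
  + ∫ (f(x+y) - f(x) - y·∇f(x)/(1+|y|²)) N(x,dy)`. -/
def Coefficients.op (A : Coefficients d) (f : E d → ℝ) (x : E d) : ℝ :=
  (1 / 2) * ∑ i, ∑ j, A.Q x i j *
      fderiv ℝ (fderiv ℝ f) x (EuclideanSpace.single i 1) (EuclideanSpace.single j 1)
    + fderiv ℝ f x (A.b x)
    + ∫ y, (f (x + y) - f x - fderiv ℝ f x y / (1 + ‖y‖ ^ 2)) ∂(A.N x)

/-- `C_b^2`: `C^2` functions that are bounded together with their first two derivatives. -/
def IsCb2 (f : E d → ℝ) : Prop :=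
  ContDiff ℝ 2 f ∧
    ∃ C : ℝ, ∀ x, |f x| ≤ C ∧ ‖fderiv ℝ f x‖ ≤ C ∧ ‖fderiv ℝ (fderiv ℝ f) x‖ ≤ C

/-- The range of non-locality of `A` over `D`: the union over `x ∈ D` of `x + supp N(x, ·)`. -/
def Coefficients.nonlocalRange (A : Coefficients d) (D : Set (E d)) : Set (E d) :=
  {z | ∃ x ∈ D, ∃ y ∈ (A.N x).support, z = x + y}

/-- The extended boundary `∂_S D = ∂D ∪ (S(D) ∖ D)`. -/
def Coefficients.extBoundary (A : Coefficients d) (D : Set (E d)) : Set (E d) :=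
  frontier D ∪ (A.nonlocalRange D \ D)

/-- `D_S = D ∪ ∂_S D`. -/
def Coefficients.extDomain (A : Coefficients d) (D : Set (E d)) : Set (E d) :=
  D ∪ A.extBoundary D

/-! ### Path space and the martingale problem -/

/-- Càdlàg paths `[0,∞) → ℝ^d`. -/
structure Path (d : ℕ) where
  toFun : ℝ≥0 → E d
  right_cont : ∀ t, ContinuousWithinAt toFun (Set.Ici t) t
  left_lim : ∀ t, ∃ l, Tendsto toFun (𝓝[<] t) (𝓝 l)

instance : CoeFun (Path d) (fun _ => ℝ≥0 → E d) := ⟨Path.toFun⟩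

/-- The σ-algebra generated by the coordinates (it is the Borel σ-algebra of the Skorokhod
topology). -/
instance : MeasurableSpace (Path d) :=
  ⨆ t : ℝ≥0, MeasurableSpace.comap (fun ω : Path d => ω t) inferInstance

theorem Path.measurable_eval (t : ℝ≥0) : Measurable (fun ω : Path d => ω t) :=
  Measurable.of_comap_le
    (le_iSup (fun t : ℝ≥0 => MeasurableSpace.comap (fun ω : Path d => ω t) inferInstance) t)

/-- The natural filtration of the canonical process. -/
def Path.filtration (d : ℕ) : Filtration ℝ≥0 (inferInstance : MeasurableSpace (Path d)) :=
  Filtration.natural (fun (t : ℝ≥0) (ω : Path d) => ω t)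
    (fun t => (Path.measurable_eval t).stronglyMeasurable)

/-- The shift `θ_t ω (s) = ω (t + s)`. -/
def Path.shift (t : ℝ≥0) (ω : Path d) : Path d where
  toFun s := ω (t + s)
  right_cont s := by
    have h1 : ContinuousWithinAt (fun s : ℝ≥0 => t + s) (Set.Ici s) s :=
      (continuous_const.add continuous_id).continuousWithinAt
    have h2 : Set.MapsTo (fun s : ℝ≥0 => t + s) (Set.Ici s) (Set.Ici (t + s)) :=
      fun r hr => add_le_add_right (Set.mem_Ici.1 hr) t
    exact ContinuousWithinAt.comp (g := ω.toFun) (ω.right_cont (t + s)) h1 h2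
  left_lim s := by
    obtain ⟨l, hl⟩ := ω.left_lim (t + s)
    refine ⟨l, hl.comp ?_⟩
    refine tendsto_nhdsWithin_of_tendsto_nhds_of_eventually_within _ ?_ ?_
    · exact ((continuous_const.add continuous_id).tendsto s).mono_left nhdsWithin_le_nhds
    · filter_upwards [self_mem_nhdsWithin] with r hr
      exact add_lt_add_right (Set.mem_Iio.1 hr) t

/-- `M_t[f] = f(X_t) - f(X_0) - ∫_0^t A f(X_r) dr`. -/
def Coefficients.martingaleTerm (A : Coefficients d) (f : E d → ℝ) (t : ℝ≥0) (ω : Path d) : ℝ :=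
  f (ω t) - f (ω 0) - ∫ r in (0 : ℝ)..t, A.op f (ω r.toNNReal)

/-- `Pμ` solves the martingale problem for `A` with initial distribution `μ`. -/
structure IsMartingaleSolution (A : Coefficients d) (μ : Measure (E d))
    (Pμ : Measure (Path d)) : Prop where
  isProb : IsProbabilityMeasure Pμ
  initial : ∀ Z : Set (E d), MeasurableSet Z → Pμ {ω | ω 0 ∈ Z} = μ Z
  martingale : ∀ f : E d → ℝ, IsCb2 f →
    Martingale (fun t ω => A.martingaleTerm f t ω) (Path.filtration d) Pμ

/-- The strong Markov property of the canonical process with respect to its natural filtration and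
the family `(P_x)`: `P_x(θ_τ ∈ C | F_τ) = P_{X_τ}(C)` on `{τ < ∞}` for every stopping time `τ`. -/
def IsStronglyMarkov (P : Kernel (E d) (Path d)) : Prop :=
  ∀ (x : E d) (τ : Path d → WithTop ℝ≥0) (hτ : IsStoppingTime (Path.filtration d) τ)
    (B : Set (Path d)), MeasurableSet[hτ.measurableSpace] B →
    ∀ C : Set (Path d), MeasurableSet C →
      P x (B ∩ {ω | τ ω ≠ ⊤ ∧ Path.shift ((τ ω).untopD 0) ω ∈ C}) =
        ∫⁻ ω in B ∩ {ω | τ ω ≠ ⊤}, P (ω ((τ ω).untopD 0)) C ∂(P x)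

/-- A strong Markovian solution `(P_x)` of the martingale problem for `A`; measurability of
`x ↦ P_x(C)` is part of `P` being a kernel. -/
structure IsStrongMarkovSolution (A : Coefficients d) (P : Kernel (E d) (Path d)) : Prop where
  solution : ∀ x, IsMartingaleSolution A (Measure.dirac x) (P x)
  strongMarkov : IsStronglyMarkov P
  mixture : ∀ μ : Measure (E d), IsProbabilityMeasure μ → IsMartingaleSolution A μ (μ.bind P)

/-! ### Exit time, semigroup and resolvent on `D` -/

/-- `τ_D = inf {t > 0 : X_t ∉ D}`. -/
def exitTime (D : Set (E d)) (ω : Path d) : ℝ≥0∞ :=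
  ⨅ (t : ℝ≥0) (_ : 0 < t ∧ ω t ∉ D), (t : ℝ≥0∞)

/-- The exit time from `D` is almost surely finite from every starting point in `D`. -/
def ExitFinite (P : Kernel (E d) (Path d)) (D : Set (E d)) : Prop :=
  ∀ x ∈ D, ∀ᵐ ω ∂(P x), exitTime D ω < ⊤

/-- Extension by zero of a function on `D`. -/
def ext {D : Set (E d)} (f : D → ℝ) : E d → ℝ := Function.extend Subtype.val f 0

/-- `P^D_t f(x) = E_x[f(X_t), t < τ_D]`. -/
def semigroup (P : Kernel (E d) (Path d)) (D : Set (E d)) (t : ℝ≥0) (f : D → ℝ) (x : D) : ℝ :=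
  ∫ ω in {ω | (t : ℝ≥0∞) < exitTime D ω}, ext f (ω t) ∂(P x)

/-- `R^D_α f(x) = ∫_0^∞ e^{-αt} P^D_t f(x) dt`, for bounded `f` and `α > 0`. -/
def resolvent (P : Kernel (E d) (Path d)) (D : Set (E d)) (α : ℝ) (f : D → ℝ) (x : D) : ℝ :=
  ∫ t in Set.Ioi (0 : ℝ), Real.exp (-α * t) * semigroup P D t.toNNReal f x

/-- The resolvent is `m`-irreducible. -/
def Irreducible (P : Kernel (E d) (Path d)) (D : Set (E d)) (m : Measure D) : Prop :=
  ∀ f : D → ℝ, Measurable f → (∀ x, 0 ≤ f x) → (∃ C, ∀ x, f x ≤ C) →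
    0 < ∫⁻ x, ENNReal.ofReal (f x) ∂m → ∀ x, 0 < resolvent P D 1 f x

/-- `(φ, lam)` is a bounded non-negative eigenfunction with its eigenvalue `lam ≥ 0`:
`e^{-lam t} φ = P^D_t φ`, `∫_D φ dm > 0`. -/
structure IsBoundedEigenpair (P : Kernel (E d) (Path d)) (D : Set (E d)) (m : Measure D)
    (φ : D → ℝ) (lam : ℝ) : Prop where
  measurable : Measurable φ
  nonneg : ∀ x, 0 ≤ φ x
  bounded : ∃ C, ∀ x, φ x ≤ C
  eigenvalue_nonneg : 0 ≤ lam
  eigen : ∀ (t : ℝ≥0) (x : D), Real.exp (-lam * t) * φ x = semigroup P D t φ x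
  nontrivial : 0 < ∫⁻ x, ENNReal.ofReal (φ x) ∂m

/-! ### Weak subsolutions and the Hopf lemma -/

/-- `c` is non-negative, bounded and Borel measurable on `D`. -/
structure IsAdmissible {D : Set (E d)} (c : D → ℝ) : Prop where
  measurable : Measurable c
  nonneg : ∀ x, 0 ≤ c x
  bounded : ∃ C, ∀ x, c x ≤ C

/-- `τ_D ∧ t`, a finite time. -/
def exitMin (D : Set (E d)) (t : ℝ≥0) (ω : Path d) : ℝ≥0 :=
  (min (exitTime D ω) t).toNNReal

/-- `e_c(t) = exp(-∫_0^t c(X_r) dr)`. -/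
def discount {D : Set (E d)} (c : D → ℝ) (t : ℝ≥0) (ω : Path d) : ℝ :=
  Real.exp (-∫ r in (0 : ℝ)..t, ext c (ω r.toNNReal))

/-- `u ∈ B_b(ℝ^d)` is a weak subsolution of `(-A + c)v = 0` in `D`:
`u(x) ≤ E_x[e_c(τ_D ∧ t) u(X_{τ_D ∧ t})]` for all `x ∈ D`, `t ≥ 0`. -/
structure IsWeakSubsolution (P : Kernel (E d) (Path d)) (D : Set (E d)) (c : D → ℝ)
    (u : E d → ℝ) : Prop where
  measurable : Measurable u
  bounded : ∃ C, ∀ x, |u x| ≤ C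
  le : ∀ x ∈ D, ∀ t : ℝ≥0,
    u x ≤ ∫ ω, discount c (exitMin D t ω) ω * u (ω (exitMin D t ω)) ∂(P x)

/-- The `φ`-Hopf lemma for subsolutions of `(-A + c)v = 0`: each weak subsolution `u` which is not
`m`-a.e. constant in `D` and has `sup_{D_S} u ≥ 0` satisfies `sup_{D_S} u - u ≥ a φ` in `D`
for some `a > 0`. -/
def HopfLemma (A : Coefficients d) (P : Kernel (E d) (Path d)) (D : Set (E d)) (m : Measure D)
    (φ : D → ℝ) (c : D → ℝ) : Prop :=
  ∀ u : E d → ℝ, IsWeakSubsolution P D c u →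
    0 ≤ sSup (u '' A.extDomain D) →
    (¬ ∃ k : ℝ, ∀ᵐ x : D ∂m, u x = k) →
    ∃ a : ℝ, 0 < a ∧ ∀ x : D, a * φ x ≤ sSup (u '' A.extDomain D) - u x

/-! ### The Doob transform and uniform ergodicity -/

/-- `P^{D,φ}_t f(x) = e^{lam t} P^D_t(f φ)(x) / φ(x)`. -/
def doobSemigroup (P : Kernel (E d) (Path d)) (D : Set (E d)) (φ : D → ℝ) (lam : ℝ)
    (t : ℝ≥0) (f : D → ℝ) (x : D) : ℝ :=
  Real.exp (lam * t) * semigroup P D t (fun y => f y * φ y) x / φ x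

/-- The resolvent `R^{D,φ}_α f(x) = ∫_0^∞ e^{-αt} P^{D,φ}_t f(x) dt`. -/
def doobResolvent (P : Kernel (E d) (Path d)) (D : Set (E d)) (φ : D → ℝ) (lam : ℝ)
    (α : ℝ) (f : D → ℝ) (x : D) : ℝ :=
  ∫ t in Set.Ioi (0 : ℝ), Real.exp (-α * t) * doobSemigroup P D φ lam t.toNNReal f x

/-- Uniform ergodicity of a Markov chain on `S` with transition operator `K` acting on bounded
measurable functions, `K^n f(x) = ∫ f(y) K^n(x, dy)`: there is an invariant probability measure `Π`
with `sup_x ‖K^n(x, ·) - Π‖_TV ≤ C ρ^n`, where the total variation norm of a signed measure is the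
supremum of `|∫ f dν|` over measurable `f` with `|f| ≤ 1`. -/
def UniformlyErgodicChain {S : Type*} [MeasurableSpace S] (K : (S → ℝ) → (S → ℝ)) : Prop :=
  ∃ Pinv : Measure S, IsProbabilityMeasure Pinv ∧
    (∀ B : Set S, MeasurableSet B →
      Integrable (K (B.indicator 1)) Pinv ∧ ∫ x, K (B.indicator 1) x ∂Pinv = Pinv.real B) ∧
    ∃ C > 0, ∃ ρ : ℝ, 0 < ρ ∧ ρ < 1 ∧ ∀ (n : ℕ) (x : S) (f : S → ℝ), Measurable f →
      (∀ y, |f y| ≤ 1) → |(K^[n] f) x - ∫ y, f y ∂Pinv| ≤ C * ρ ^ n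

/-- A resolvent family `(R_α)_{α > 0}` is uniformly ergodic if for every `α > 0` the chain with
transition operator `α R_α` is uniformly ergodic. -/
def UniformlyErgodicResolvent {S : Type*} [MeasurableSpace S]
    (R : ℝ → (S → ℝ) → (S → ℝ)) : Prop :=
  ∀ α : ℝ, 0 < α → UniformlyErgodicChain (fun f x => α * R α f x)

end Hopf

end

/-!
Throughout, `κ` denotes the transition function of the process killed upon leaving `D` (`killed`),
and `K_γ` the normalized resolvent kernel `γ R^{D,φ}_γ` of the Doob transform (`doobKernel`).

*Path regularity.* Everything rests on three almost sure properties of the canonical process, which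
are collected in `RegularExit`. The martingale problem gives Dynkin's formula for bounded optional
times, hence quasi-left-continuity. Applied to the first times `nearTime` at which the path comes
within distance `1 / (n + 1)` of the complement of `D`, this shows that the exit time agrees almost
surely with the Borel function `exitLimit`, so that the killed process has a measurable transition
function satisfying the Chapman–Kolmogorov equation, and that a path whose left limit at the exit is
a boundary point leaves `D` continuously. Finally, a one-sided Lévy system estimate
(`IsMartingaleSolution.lintegral_jumpSum_le`) shows that a jump from `l` almost surely lies in the
support of `N(l, ·)`. Together these facts put the exit position into `D_S`. Consequently, for a
weak subsolution `u` bounded by `M ≥ 0` on `D_S` and a potential bounded by `C`, the function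
`v = M - u` satisfies `e^{-Ct} κ_t v ≤ v` on `D` (`IsWeakSubsolution.exp_mul_le`); conversely, a non-negative
bounded `v` with `e^{-nt} κ_t v ≤ v` gives the weak subsolution `-v` for the constant potential `n`
(`isWeakSubsolution_neg_ext`).

*Ergodicity implies the Hopf lemma.* Let `γ = 1 + C + lam`. Integrating `e^{-Ct} κ_t v ≤ v` in time
shows that `w φ ≤ v` implies `γ⁻¹ (K_γ w) φ ≤ v`. As `u` is not constant, `ε 1_B φ ≤ v` for some
`ε > 0` and some set `B` of positive measure. Hence `ε γ⁻ⁿ (K_γⁿ 1_B) φ ≤ v` for every `n`. The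
invariant measure charges `B` by irreducibility, and `K_γⁿ 1_B` converges uniformly to its mass, so
one large `n` bounds `v` from below by a multiple of `φ`.

*The Hopf lemma implies a minorization.* Let `B` have positive measure and let `g` be the
`α`-potential of `1_B φ`. For a ball `W` and `n ≥ α`, the minimum of `g` and of `n` times the
`n`-potential of `1_W` is a supersolution for the potential `n`. As `n → ∞` these minima converge to
`min g 1_W` off the sphere, which is positive on `W` and zero outside of the closed ball. Since `m`
is not concentrated at a point, `W` can be chosen so that `m` charges both regions, so that one of
the minima is not almost everywhere constant. The Hopf lemma then yields `a φ ≤ g`, and thus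
`K_α(x, B) ≥ α a` for all `x` (`exists_le_doobKernel`).

*From the minorization to ergodicity.* This part concerns an arbitrary Markov kernel `K` on a
countably generated space that hits every set of positive `m`-measure with a probability bounded
away from zero. The bound is uniform over all sets of full measure, so the density of the absolutely
continuous part of `K(x, ·)` has integral at least some `ε > 0`. As `L¹(m)` is separable, these
densities differ by at most `ε / 2` in `L¹` for starting points in some set `G` of positive measure; two
copies of the chain both enter `G` with a probability bounded below, so two steps contract the
oscillation of functions by a fixed factor (`exists_contraction`). The invariant measure is the
uniform limit of the iterates.
-/

namespace Hopf
variable {d : ℕ}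

/-! ### Càdlàg paths along grids of times -/

/-- The first point of the grid `{k / (n + 1)}` strictly to the right of `t`. -/
noncomputable def grid (n : ℕ) (t : ℝ≥0) : ℝ≥0 := (⌊((n : ℝ≥0) + 1) * t⌋₊ + 1 : ℕ) / ((n : ℝ≥0) + 1)

lemma lt_grid (n : ℕ) (t : ℝ≥0) : t < grid n t := by
  rw [grid, lt_div_iff₀ (by positivity), mul_comm]
  exact_mod_cast Nat.lt_floor_add_one (((n : ℝ≥0) + 1) * t)

lemma grid_le (n : ℕ) (t : ℝ≥0) : grid n t ≤ t + 1 / ((n : ℝ≥0) + 1) := by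
  have hn : (0 : ℝ≥0) < (n : ℝ≥0) + 1 := by positivity
  rw [grid, div_le_iff₀ hn, add_mul _ _ ((n : ℝ≥0) + 1), one_div, inv_mul_cancel₀ hn.ne',
    mul_comm t]
  push_cast
  gcongr
  exact Nat.floor_le zero_le

lemma tendsto_one_div_nnreal : Tendsto (fun n : ℕ => 1 / ((n : ℝ≥0) + 1)) atTop (𝓝 0) := by
  have := tendsto_one_div_add_atTop_nhds_zero_nat (𝕜 := ℝ)
  rw [← NNReal.tendsto_coe]
  simpa using this

lemma tendsto_grid (t : ℝ≥0) : Tendsto (fun n => grid n t) atTop (𝓝[>] t) := by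
  refine tendsto_nhdsWithin_iff.2 ⟨?_, Eventually.of_forall fun n => lt_grid n t⟩
  refine tendsto_of_tendsto_of_tendsto_of_le_of_le tendsto_const_nhds ?_
    (fun n => (lt_grid n t).le) (fun n => grid_le n t)
  simpa using tendsto_const_nhds (x := t).add tendsto_one_div_nnreal

lemma Path.tendsto_right (ω : Path d) {t : ℝ≥0} {u : ℕ → ℝ≥0} (hu : Tendsto u atTop (𝓝 t))
    (ht : ∀ᶠ n in atTop, t ≤ u n) : Tendsto (fun n => ω (u n)) atTop (𝓝 (ω t)) :=
  (ω.right_cont t).tendsto.comp (tendsto_nhdsWithin_iff.2 ⟨hu, ht⟩)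

lemma Path.tendsto_grid (ω : Path d) (t : ℝ≥0) :
    Tendsto (fun n => ω (grid n t)) atTop (𝓝 (ω t)) :=
  ω.tendsto_right (tendsto_nhds_of_tendsto_nhdsWithin (Hopf.tendsto_grid t))
    (Eventually.of_forall fun n => (lt_grid n t).le)

/-- Right-continuity makes the evaluation `(t, ω) ↦ X_t(ω)` jointly measurable. -/
lemma Path.measurable_uncurry : Measurable fun p : ℝ≥0 × Path d => p.2 p.1 := by
  refine measurable_of_tendsto_metrizable (f := fun n (p : ℝ≥0 × Path d) => p.2 (grid n p.1)) ?_
    (tendsto_pi_nhds.2 fun p => p.2.tendsto_grid p.1)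
  intro n
  have h1 : Measurable fun q : ℕ × Path d => q.2 ((q.1 + 1 : ℕ) / ((n : ℝ≥0) + 1) : ℝ≥0) :=
    measurable_from_prod_countable_right fun k =>
      Path.measurable_eval ((k + 1 : ℕ) / ((n : ℝ≥0) + 1))
  have h2 : Measurable fun p : ℝ≥0 × Path d => (⌊((n : ℝ≥0) + 1) * p.1⌋₊, p.2) :=
    (Nat.measurable_floor.comp (measurable_fst.const_mul _)).prodMk measurable_snd
  exact h1.comp h2

lemma Path.measurable_eval_comp {α : Type*} [MeasurableSpace α] {t : α → ℝ≥0} {ω : α → Path d}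
    (ht : Measurable t) (hω : Measurable ω) : Measurable fun a => ω a (t a) :=
  Path.measurable_uncurry.comp (ht.prodMk hω)

/-! ### Test functions and the operator -/

/-- The jump kernel may have infinite total mass, but its restrictions to the shells on which
`⌊‖y‖⁻¹⌋ = n` are finite, and these exhaust the complement of the origin. -/
lemma Coefficients.isSFiniteKernel_N (A : Coefficients d) : IsSFiniteKernel A.N := by
  let B : ℕ → Set (E d) := fun n => {y | y ≠ 0 ∧ ⌊‖y‖⁻¹⌋₊ = n}
  have hB : ∀ n, MeasurableSet (B n) := fun n =>
    ((measurableSet_singleton (0 : E d)).compl).inter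
      ((Nat.measurable_floor.comp measurable_norm.inv) (measurableSet_singleton n))
  have hdisj : Pairwise (Function.onFun Disjoint B) := by
    intro i j hij
    refine Set.disjoint_left.2 fun y hi hj => hij ?_
    exact hi.2.symm.trans hj.2
  have hU : ⋃ n, B n = {0}ᶜ := by
    ext y
    simp [B]
  obtain ⟨C, hC⟩ := A.bounded_N
  have hfin : ∀ n, IsFiniteKernel (A.N.restrict (hB n)) := by
    intro n
    refine ⟨⟨(C : ℝ≥0∞) * ENNReal.ofReal ((n + 1) ^ 2), ENNReal.mul_lt_top (by simp) (by simp),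
      fun x => ?_⟩⟩
    rw [Kernel.restrict_apply' _ _ _ MeasurableSet.univ, Set.univ_inter]
    have h1 : ∀ y ∈ B n, (1 : ℝ≥0∞) ≤
        ENNReal.ofReal (min 1 (‖y‖ ^ 2)) * ENNReal.ofReal ((n + 1) ^ 2) := by
      rintro y ⟨hy0, hy⟩
      have hpos : 0 < ‖y‖ := norm_pos_iff.2 hy0
      have h2 : ‖y‖⁻¹ < n + 1 := by rw [← hy]; exact Nat.lt_floor_add_one _
      have h3 : 1 ≤ ‖y‖ * (n + 1) := by
        rw [inv_lt_iff_one_lt_mul₀ hpos] at h2; linarith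
      rw [← ENNReal.ofReal_mul (by positivity), ← ENNReal.ofReal_one]
      refine ENNReal.ofReal_le_ofReal ?_
      rw [min_mul_of_nonneg _ _ (by positivity)]
      refine le_min ?_ ?_
      · have : (0 : ℝ) ≤ n := Nat.cast_nonneg n
        nlinarith
      · rw [← mul_pow]; exact one_le_pow₀ h3
    calc A.N x (B n) = ∫⁻ y in B n, 1 ∂(A.N x) := by simp
      _ ≤ ∫⁻ y in B n, ENNReal.ofReal (min 1 (‖y‖ ^ 2)) * ENNReal.ofReal ((n + 1) ^ 2) ∂(A.N x) :=
          setLIntegral_mono' (hB n) h1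
      _ ≤ ∫⁻ y, ENNReal.ofReal (min 1 (‖y‖ ^ 2)) * ENNReal.ofReal ((n + 1) ^ 2) ∂(A.N x) :=
          setLIntegral_le_lintegral _ _
      _ = (∫⁻ y, ENNReal.ofReal (min 1 (‖y‖ ^ 2)) ∂(A.N x)) * ENNReal.ofReal ((n + 1) ^ 2) :=
          lintegral_mul_const _ (by fun_prop)
      _ ≤ _ := by gcongr; exact hC x
  have hsum : A.N = Kernel.sum fun n => A.N.restrict (hB n) := by
    refine Kernel.ext fun x => ?_
    rw [Kernel.sum_apply]
    simp_rw [Kernel.restrict_apply]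
    rw [← Measure.restrict_iUnion hdisj hB, hU, Measure.restrict_eq_self_of_ae_mem]
    exact measure_eq_zero_iff_ae_notMem.1 (A.N_zero x)
  rw [hsum]
  exact Kernel.isSFiniteKernel_sum

/-- The compensated increment of a `C²_b` function is of order `min 1 ‖y‖²`. -/
lemma IsCb2.taylor {f : E d → ℝ} (hf : ContDiff ℝ 2 f) {C : ℝ}
    (hC : ∀ x, |f x| ≤ C ∧ ‖fderiv ℝ f x‖ ≤ C ∧ ‖fderiv ℝ (fderiv ℝ f) x‖ ≤ C) (x y : E d) :
    |f (x + y) - f x - fderiv ℝ f x y / (1 + ‖y‖ ^ 2)| ≤ 3 * C * min 1 (‖y‖ ^ 2) := by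
  have hC0 : 0 ≤ C := (abs_nonneg _).trans (hC 0).1
  have hy := norm_nonneg y
  have hq : 0 < 1 + ‖y‖ ^ 2 := by positivity
  have hlin : |fderiv ℝ f x y| ≤ C * ‖y‖ :=
    ((fderiv ℝ f x).le_opNorm y).trans (by gcongr; exact (hC x).2.1)
  rcases le_total 1 ‖y‖ with h | h
  · rw [min_eq_left (by nlinarith), mul_one]
    have h1 : |fderiv ℝ f x y / (1 + ‖y‖ ^ 2)| ≤ C := by
      rw [abs_div, abs_of_pos hq, div_le_iff₀ hq]
      refine hlin.trans ?_
      gcongr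
      nlinarith
    have h2 := (hC (x + y)).1
    have h3 := (hC x).1
    rw [abs_le] at *
    constructor <;> linarith [h1.1, h1.2, h2.1, h2.2, h3.1, h3.2]
  · rw [min_eq_right (by nlinarith)]
    have hd : Differentiable ℝ f := hf.differentiable (by norm_num)
    have hd2 : Differentiable ℝ (fderiv ℝ f) :=
      (hf.fderiv_right (m := 1) (by norm_num)).differentiable (by norm_num)
    have h1 : ∀ z ∈ Metric.closedBall x ‖y‖, ‖fderiv ℝ f z - fderiv ℝ f x‖ ≤ C * ‖y‖ := by
      intro z hz
      refine (convex_univ.norm_image_sub_le_of_norm_fderiv_le (𝕜 := ℝ) (f := fderiv ℝ f) (C := C)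
        (fun z _ => hd2 z) (fun z _ => (hC z).2.2) (Set.mem_univ x) (Set.mem_univ z)).trans ?_
      gcongr
      simpa [dist_eq_norm] using hz
    have h2 : |f (x + y) - f x - fderiv ℝ f x y| ≤ C * ‖y‖ * ‖y‖ := by
      have := (convex_closedBall x ‖y‖).norm_image_sub_le_of_norm_hasFDerivWithin_le' (𝕜 := ℝ)
        (f := f) (f' := fderiv ℝ f) (φ := fderiv ℝ f x) (C := C * ‖y‖)
        (fun z _ => (hd z).hasFDerivAt.hasFDerivWithinAt) h1 (x := x) (y := x + y)
        (Metric.mem_closedBall_self hy) (by simp)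
      simpa using this
    have h3 : |fderiv ℝ f x y - fderiv ℝ f x y / (1 + ‖y‖ ^ 2)| ≤ C * ‖y‖ * ‖y‖ := by
      have : fderiv ℝ f x y - fderiv ℝ f x y / (1 + ‖y‖ ^ 2)
          = fderiv ℝ f x y * (‖y‖ ^ 2 / (1 + ‖y‖ ^ 2)) := by field_simp; ring
      rw [this, abs_mul, abs_of_nonneg (a := ‖y‖ ^ 2 / (1 + ‖y‖ ^ 2)) (by positivity)]
      have h4 : ‖y‖ ^ 2 / (1 + ‖y‖ ^ 2) ≤ ‖y‖ := by
        rw [div_le_iff₀ hq]; nlinarith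
      gcongr
    have h5 : f (x + y) - f x - fderiv ℝ f x y / (1 + ‖y‖ ^ 2) =
        (f (x + y) - f x - fderiv ℝ f x y)
          + (fderiv ℝ f x y - fderiv ℝ f x y / (1 + ‖y‖ ^ 2)) := by ring
    rw [h5]
    refine (abs_add_le _ _).trans ?_
    nlinarith [mul_nonneg hC0 (sq_nonneg ‖y‖)]

lemma Coefficients.op_bounded (A : Coefficients d) {f : E d → ℝ} (hf : IsCb2 f) :
    ∃ C : ℝ, 0 ≤ C ∧ ∀ x, |A.op f x| ≤ C := by
  obtain ⟨hf2, C, hC⟩ := hf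
  obtain ⟨CQ, hQ⟩ := A.bounded_Q
  obtain ⟨Cb, hb⟩ := A.bounded_b
  obtain ⟨CN, hN⟩ := A.bounded_N
  have hC0 : 0 ≤ C := (abs_nonneg _).trans (hC 0).1
  have key : ∀ x, |A.op f x| ≤
      (1 / 2) * ∑ _i : Fin d, ∑ _j : Fin d, CQ * C + C * Cb + 3 * C * CN := by
    intro x
    have h1 : |∑ i, ∑ j, A.Q x i j * fderiv ℝ (fderiv ℝ f) x (EuclideanSpace.single i 1)
        (EuclideanSpace.single j 1)| ≤ ∑ _i : Fin d, ∑ _j : Fin d, CQ * C := by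
      refine (Finset.abs_sum_le_sum_abs _ _).trans (Finset.sum_le_sum fun i _ => ?_)
      refine (Finset.abs_sum_le_sum_abs _ _).trans (Finset.sum_le_sum fun j _ => ?_)
      rw [abs_mul]
      have h2 : |fderiv ℝ (fderiv ℝ f) x (EuclideanSpace.single i 1)
          (EuclideanSpace.single j 1)| ≤ C := by
        refine ((fderiv ℝ (fderiv ℝ f) x).le_opNorm₂ _ _).trans ?_
        simpa using (hC x).2.2
      exact mul_le_mul (hQ x i j) h2 (abs_nonneg _) ((abs_nonneg _).trans (hQ x i j))
    have h2 : |fderiv ℝ f x (A.b x)| ≤ C * Cb := by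
      refine ((fderiv ℝ f x).le_opNorm _).trans ?_
      exact mul_le_mul (hC x).2.1 (hb x) (norm_nonneg _) hC0
    have h3 : |∫ y, (f (x + y) - f x - fderiv ℝ f x y / (1 + ‖y‖ ^ 2)) ∂(A.N x)| ≤ 3 * C * CN := by
      have h4 : ‖∫ y, (f (x + y) - f x - fderiv ℝ f x y / (1 + ‖y‖ ^ 2)) ∂(A.N x)‖ₑ
          ≤ ENNReal.ofReal (3 * C) * CN := by
        refine (enorm_integral_le_lintegral_enorm _).trans ?_
        calc _ ≤ ∫⁻ y, ENNReal.ofReal (3 * C) * ENNReal.ofReal (min 1 (‖y‖ ^ 2)) ∂(A.N x) := by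
              refine lintegral_mono fun y => ?_
              rw [← ENNReal.ofReal_mul (by positivity), Real.enorm_eq_ofReal_abs]
              exact ENNReal.ofReal_le_ofReal (IsCb2.taylor hf2 hC x y)
          _ = ENNReal.ofReal (3 * C) * ∫⁻ y, ENNReal.ofReal (min 1 (‖y‖ ^ 2)) ∂(A.N x) :=
              lintegral_const_mul _ (by fun_prop)
          _ ≤ _ := by gcongr; exact hN x
      rw [Real.enorm_eq_ofReal_abs, ← ENNReal.ofReal_coe_nnreal,
        ← ENNReal.ofReal_mul (by positivity)] at h4
      exact (ENNReal.ofReal_le_ofReal_iff (by positivity)).1 h4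
    rw [Coefficients.op]
    refine (abs_add_le _ _).trans (add_le_add ((abs_add_le _ _).trans (add_le_add ?_ h2)) h3)
    rw [abs_mul, abs_of_pos (by norm_num : (0 : ℝ) < 1 / 2)]
    gcongr
  exact ⟨_, (abs_nonneg _).trans (key 0), key⟩

lemma Coefficients.measurable_op (A : Coefficients d) {f : E d → ℝ} (hf : ContDiff ℝ 2 f) :
    Measurable (A.op f) := by
  have := A.isSFiniteKernel_N
  have c1 : Continuous (fderiv ℝ f) := hf.continuous_fderiv (by norm_num)
  have c2 : Continuous (fderiv ℝ (fderiv ℝ f)) :=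
    (hf.fderiv_right (m := 1) (by norm_num)).continuous_fderiv (by norm_num)
  have m1 : Measurable fun x => ∑ i, ∑ j, A.Q x i j * fderiv ℝ (fderiv ℝ f) x
      (EuclideanSpace.single i 1) (EuclideanSpace.single j 1) := by
    refine Finset.measurable_sum _ fun i _ => Finset.measurable_sum _ fun j _ =>
      (A.measurable_Q i j).mul (Continuous.measurable ?_)
    exact (c2.clm_apply continuous_const).clm_apply continuous_const
  have m2 : Measurable fun x => fderiv ℝ f x (A.b x) := by
    have h : Continuous fun p : E d × E d => fderiv ℝ f p.1 p.2 :=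
      (c1.comp continuous_fst).clm_apply continuous_snd
    exact h.measurable.comp (measurable_id.prodMk A.measurable_b)
  have m3 : Measurable fun x =>
      ∫ y, (f (x + y) - f x - fderiv ℝ f x y / (1 + ‖y‖ ^ 2)) ∂(A.N x) := by
    have h : Continuous fun p : E d × E d =>
        f (p.1 + p.2) - f p.1 - fderiv ℝ f p.1 p.2 / (1 + ‖p.2‖ ^ 2) := by
      have hc := hf.continuous
      have h1 : Continuous fun p : E d × E d => fderiv ℝ f p.1 p.2 :=
        (c1.comp continuous_fst).clm_apply continuous_snd
      refine Continuous.sub (by fun_prop) (h1.div (by fun_prop) fun p => by positivity)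
    exact (StronglyMeasurable.integral_kernel_prod_right' h.stronglyMeasurable).measurable
  exact ((m1.const_mul _).add m2).add m3

lemma fderiv_eventuallyEq_zero {f : E d → ℝ} {x : E d} (hx : x ∉ tsupport f) :
    fderiv ℝ f =ᶠ[𝓝 x] fun _ => 0 := by
  filter_upwards [(notMem_tsupport_iff_eventuallyEq.1 hx).eventuallyEq_nhds] with y hy
  rw [hy.fderiv_eq]; simp

lemma fderiv_fderiv_eq_zero {f : E d → ℝ} {x : E d} (hx : x ∉ tsupport f) :
    fderiv ℝ (fderiv ℝ f) x = 0 := by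
  rw [(fderiv_eventuallyEq_zero hx).fderiv_eq]; simp

lemma norm_fderiv_fderiv_eq_zero {f : E d → ℝ} {x : E d} (hx : x ∉ tsupport f) :
    ‖fderiv ℝ (fderiv ℝ f) x‖ = 0 := by
  rw [fderiv_fderiv_eq_zero hx]
  exact ContinuousLinearMap.opNorm_zero

lemma isCb2_of_hasCompactSupport {f : E d → ℝ} (hf : ContDiff ℝ 2 f) (h : HasCompactSupport f) :
    IsCb2 f := by
  have c1 : Continuous fun x => ‖fderiv ℝ f x‖ := (hf.continuous_fderiv (by norm_num)).norm
  have c2 : Continuous fun x => ‖fderiv ℝ (fderiv ℝ f) x‖ :=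
    ((hf.fderiv_right (m := 1) (by norm_num)).continuous_fderiv (by norm_num)).norm
  have h1 : HasCompactSupport fun x => ‖fderiv ℝ f x‖ := HasCompactSupport.intro h fun x hx => by
    rw [(fderiv_eventuallyEq_zero hx).eq_of_nhds, norm_zero]
  have h2 : HasCompactSupport fun x => ‖fderiv ℝ (fderiv ℝ f) x‖ :=
    HasCompactSupport.intro h fun x hx => norm_fderiv_fderiv_eq_zero hx
  obtain ⟨a, ha⟩ := hf.continuous.norm.bddAbove_range_of_hasCompactSupport h.norm
  obtain ⟨b, hb⟩ := c1.bddAbove_range_of_hasCompactSupport h1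
  obtain ⟨c, hc⟩ := c2.bddAbove_range_of_hasCompactSupport h2
  refine ⟨hf, max a (max b c), fun x => ⟨?_, ?_, ?_⟩⟩
  · exact (ha ⟨x, rfl⟩).trans (le_max_left _ _)
  · exact (hb ⟨x, rfl⟩).trans ((le_max_left _ _).trans (le_max_right _ _))
  · exact (hc ⟨x, rfl⟩).trans ((le_max_right _ _).trans (le_max_right _ _))

/-- Off the support of `f` only the jump part of the operator remains. -/
lemma Coefficients.op_of_notMem_tsupport (A : Coefficients d) {f : E d → ℝ} {x : E d}
    (hx : x ∉ tsupport f) : A.op f x = ∫ y, f (x + y) ∂(A.N x) := by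
  simp [Coefficients.op, fderiv_fderiv_eq_zero hx, (fderiv_eventuallyEq_zero hx).eq_of_nhds,
    (notMem_tsupport_iff_eventuallyEq.1 hx).eq_of_nhds]

/-! ### Optional stopping for the martingale problem -/

/-- A finite optional time of the canonical process: `{S < t}` is `F_t`-measurable for all `t`
(equivalently, a stopping time of the right-continuous filtration). -/
def IsOptionalTime (S : Path d → ℝ≥0) : Prop :=
  ∀ t : ℝ≥0, MeasurableSet[Path.filtration d t] {ω | S ω < t}

lemma measurable_eval_filtration {s t : ℝ≥0} (h : s ≤ t) :
    Measurable[Path.filtration d t] fun ω : Path d => ω s :=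
  Measurable.of_comap_le (le_iSup₂_of_le s h le_rfl)

lemma IsOptionalTime.measurable {S : Path d → ℝ≥0} (hS : IsOptionalTime S) : Measurable S :=
  measurable_of_Iio fun t => (Path.filtration d).le t _ (hS t)

lemma isOptionalTime_const (s : ℝ≥0) : IsOptionalTime fun _ : Path d => s := fun t => by
  by_cases h : s < t <;> simp [h]

/-- The index on the `n`-th grid of the first grid point after `S`. -/
noncomputable def gridIndex (n : ℕ) (S : Path d → ℝ≥0) (ω : Path d) : ℕ :=
  ⌊((n : ℝ≥0) + 1) * S ω⌋₊ + 1

lemma grid_eq_gridIndex (n : ℕ) (S : Path d → ℝ≥0) (ω : Path d) :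
    grid n (S ω) = (gridIndex n S ω : ℝ≥0) / ((n : ℝ≥0) + 1) := rfl

lemma gridIndex_le_iff (n : ℕ) (S : Path d → ℝ≥0) (ω : Path d) (k : ℕ) :
    gridIndex n S ω ≤ k ↔ S ω < (k : ℝ≥0) / ((n : ℝ≥0) + 1) := by
  rw [gridIndex, Nat.succ_le_iff, Nat.floor_lt zero_le, lt_div_iff₀ (by positivity), mul_comm]

lemma IsOptionalTime.measurableSet_gridIndex {S : Path d → ℝ≥0} (hS : IsOptionalTime S) (n k : ℕ) :
    MeasurableSet[Path.filtration d ((k : ℝ≥0) / ((n : ℝ≥0) + 1))] {ω | gridIndex n S ω = k} := by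
  have key : ∀ j ≤ k, MeasurableSet[Path.filtration d ((k : ℝ≥0) / ((n : ℝ≥0) + 1))]
      {ω | gridIndex n S ω ≤ j} := by
    intro j hj
    simp_rw [gridIndex_le_iff]
    refine (Path.filtration d).mono ?_ _ (hS _)
    gcongr
  rcases k with _ | k
  · convert MeasurableSet.empty
    ext ω; simp [gridIndex]
  · convert (key (k + 1) le_rfl).diff (key k (Nat.le_succ k)) using 1
    ext ω
    simp only [Set.mem_ofPred_eq, Set.mem_sdiff]
    omega

/-- Tested against a bounded `F_s`-measurable weight, a martingale has constant expectation after
time `s`. -/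
lemma integral_mul_martingale_eq {M : ℝ≥0 → Path d → ℝ} {μ : Measure (Path d)}
    [IsProbabilityMeasure μ] (hM : Martingale M (Path.filtration d) μ) {s t : ℝ≥0} (hst : s ≤ t)
    {G : Path d → ℝ} {c : ℝ} (hG : StronglyMeasurable[Path.filtration d s] G)
    (hc : ∀ ω, |G ω| ≤ c) : ∫ ω, G ω * M s ω ∂μ = ∫ ω, G ω * M t ω ∂μ := by
  have h1 := condExp_stronglyMeasurable_mul_of_bound ((Path.filtration d).le s) hG
    (hM.integrable t) c (ae_of_all μ hc)
  rw [← integral_condExp ((Path.filtration d).le s) (f := fun ω => G ω * M t ω)]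
  refine integral_congr_ae ?_
  filter_upwards [h1, hM.condExp_ae_eq hst] with ω h2 h3
  rw [← h3]
  exact h2.symm

/-- Optional stopping at a time with finitely many values `u 0, …, u N`. -/
lemma integral_mul_stopped {M : ℝ≥0 → Path d → ℝ} {μ : Measure (Path d)}
    [IsProbabilityMeasure μ] (hM : Martingale M (Path.filtration d) μ) {u : ℕ → ℝ≥0}
    (hu : Monotone u) {κ : Path d → ℕ} {N : ℕ} (hκ : ∀ ω, κ ω ≤ N) {G : Path d → ℝ} {c : ℝ}
    (hc : ∀ ω, |G ω| ≤ c)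
    (hG : ∀ k, StronglyMeasurable[Path.filtration d (u k)] fun ω => if κ ω = k then G ω else 0) :
    Integrable (fun ω => G ω * M (u (κ ω)) ω) μ ∧
      ∫ ω, G ω * M (u (κ ω)) ω ∂μ = ∫ ω, G ω * M (u N) ω ∂μ := by
  have hb : ∀ k ω, |if κ ω = k then G ω else 0| ≤ c := fun k ω => by
    split_ifs
    · exact hc ω
    · simpa using (abs_nonneg _).trans (hc ω)
  have hint : ∀ k t, Integrable (fun ω => (if κ ω = k then G ω else 0) * M t ω) μ := fun k t =>
    (hM.integrable t).bdd_mul (((hG k).mono ((Path.filtration d).le _)).aestronglyMeasurable)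
      (ae_of_all _ (hb k))
  have hsum : ∀ v : ℕ → ℝ≥0, (fun ω => G ω * M (v (κ ω)) ω)
      = fun ω => ∑ k ∈ Finset.range (N + 1), (if κ ω = k then G ω else 0) * M (v k) ω := by
    intro v; ext ω
    rw [Finset.sum_eq_single (κ ω)]
    · simp
    · intro k _ hk; simp [hk.symm]
    · intro h; exact absurd (Finset.mem_range.2 (Nat.lt_succ_of_le (hκ ω))) h
  constructor
  · rw [hsum u]; exact integrable_finsetSum _ fun k _ => hint k _
  · rw [hsum u, hsum fun _ => N |> u, integral_finsetSum _ fun k _ => hint k _,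
      integral_finsetSum _ fun k _ => hint k _]
    exact Finset.sum_congr rfl fun k hk =>
      integral_mul_martingale_eq hM (hu (Nat.le_of_lt_succ (Finset.mem_range.1 hk))) (hG k) (hb k)

/-- Joint measurability of the additive functional `(t, ω) ↦ ∫_0^t h(X_r) dr`. -/
lemma measurable_additive {h : E d → ℝ} (hh : Measurable h) :
    Measurable fun p : ℝ≥0 × Path d => ∫ r in (0 : ℝ)..p.1, h (p.2 r.toNNReal) := by
  have h1 : ∀ p : ℝ≥0 × Path d, ∫ r in (0 : ℝ)..p.1, h (p.2 r.toNNReal)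
      = ∫ r : ℝ, if 0 < r ∧ r ≤ p.1 then h (p.2 r.toNNReal) else 0 := by
    intro p
    rw [intervalIntegral.integral_of_le (NNReal.coe_nonneg p.1),
      ← integral_indicator measurableSet_Ioc]
    congr 1
    ext r
    simp only [Set.indicator_apply, Set.mem_Ioc]
  simp_rw [h1]
  refine (StronglyMeasurable.integral_prod_right (f := fun (p : ℝ≥0 × Path d) (r : ℝ) =>
    if 0 < r ∧ r ≤ p.1 then h (p.2 r.toNNReal) else 0) ?_).measurable
  refine (Measurable.ite ?_ ?_ measurable_const).stronglyMeasurable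
  · exact (measurableSet_lt measurable_const measurable_snd).inter
      (measurableSet_le measurable_snd (measurable_fst.fst.coe_nnreal_real))
  · exact hh.comp (Path.measurable_eval_comp measurable_snd.real_toNNReal measurable_fst.snd)

lemma intervalIntegrable_path {h : E d → ℝ} (hh : Measurable h) {C : ℝ} (hC : ∀ x, |h x| ≤ C)
    (ω : Path d) (a b : ℝ) : IntervalIntegrable (fun r : ℝ => h (ω r.toNNReal)) volume a b := by
  have hm : Measurable fun r : ℝ => h (ω r.toNNReal) :=
    hh.comp (Path.measurable_eval_comp measurable_real_toNNReal measurable_const)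
  exact (intervalIntegrable_const (c := C)).mono_fun hm.aestronglyMeasurable
    (ae_of_all _ fun r => by simpa using (hC _).trans (le_abs_self C))

lemma Coefficients.measurable_martingaleTerm (A : Coefficients d) {f : E d → ℝ} (hf : IsCb2 f) :
    Measurable fun p : ℝ≥0 × Path d => A.martingaleTerm f p.1 p.2 := by
  have hm := hf.1.continuous.measurable
  exact ((hm.comp Path.measurable_uncurry).sub
    (hm.comp ((Path.measurable_eval 0).comp measurable_snd))).sub
      (measurable_additive (A.measurable_op hf.1))

lemma Coefficients.martingaleTerm_sub (A : Coefficients d) {f : E d → ℝ} (hf : IsCb2 f)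
    (s t : ℝ≥0) (ω : Path d) : A.martingaleTerm f t ω - A.martingaleTerm f s ω =
      f (ω t) - f (ω s) - ∫ r in (s : ℝ)..t, A.op f (ω r.toNNReal) := by
  obtain ⟨C, -, hC⟩ := A.op_bounded hf
  have hI := intervalIntegrable_path (A.measurable_op hf.1) hC ω
  rw [Coefficients.martingaleTerm, Coefficients.martingaleTerm,
    ← intervalIntegral.integral_add_adjacent_intervals (hI 0 s) (hI s t)]
  ring

lemma abs_integral_path_le {h : E d → ℝ} {C : ℝ} (hC : ∀ x, |h x| ≤ C)
    (ω : Path d) {a b : ℝ} (hab : a ≤ b) : |∫ r in a..b, h (ω r.toNNReal)| ≤ C * (b - a) := by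
  have := intervalIntegral.norm_integral_le_of_norm_le_const (a := a) (b := b) (C := C)
    (f := fun r => h (ω r.toNNReal)) fun r _ => hC _
  rwa [abs_of_nonneg (sub_nonneg.2 hab)] at this

lemma integrable_of_bounded {Ω : Type*} [MeasurableSpace Ω] {μ : Measure Ω} [IsFiniteMeasure μ]
    {G : Ω → ℝ} (hG : Measurable G) {c : ℝ} (hc : ∀ ω, |G ω| ≤ c) : Integrable G μ :=
  (integrable_const c).mono' hG.aestronglyMeasurable (ae_of_all _ hc)

/-- Dynkin's formula between two bounded optional times `S ≤ S'`, weighted by a function of the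
position at time `S`. -/
lemma IsMartingaleSolution.dynkin {A : Coefficients d} {ν : Measure (E d)} {μ : Measure (Path d)}
    (hμ : IsMartingaleSolution A ν μ) {f g : E d → ℝ} (hf : IsCb2 f) (hg : Continuous g) {c : ℝ}
    (hc : ∀ x, |g x| ≤ c) {S S' : Path d → ℝ≥0} (hS : IsOptionalTime S) (hS' : IsOptionalTime S')
    (hle : ∀ ω, S ω ≤ S' ω) {T : ℝ≥0} (hT : ∀ ω, S' ω ≤ T) :
    ∫ ω, g (ω (S ω)) * (f (ω (S' ω)) - f (ω (S ω))
      - ∫ r in (S ω : ℝ)..S' ω, A.op f (ω r.toNNReal)) ∂μ = 0 := by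
  have := hμ.isProb
  obtain ⟨C, hC0, hC⟩ := A.op_bounded hf
  obtain ⟨Cf, hCf⟩ := hf.2
  have hc0 : 0 ≤ c := (abs_nonneg _).trans (hc 0)
  set M := fun (t : ℝ≥0) ω => A.martingaleTerm f t ω with hMdef
  have hM := hμ.martingale f hf
  have hSm := hS.measurable
  have hSm' := hS'.measurable
  have hgm := hg.measurable
  -- the statement for the discretized times
  have key : ∀ n : ℕ,
      ∫ ω, g (ω (grid n (S ω))) * (M (grid n (S' ω)) ω - M (grid n (S ω)) ω) ∂μ = 0 := by
    intro n
    let u : ℕ → ℝ≥0 := fun k => (k : ℝ≥0) / ((n : ℝ≥0) + 1)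
    have hu : Monotone u := fun i j hij => by simp only [u]; gcongr
    have hK : ∀ ω, gridIndex n S ω ≤ gridIndex n S' ω := fun ω => by
      simp only [gridIndex]
      gcongr
      exact hle ω
    have hN : ∀ ω, gridIndex n S' ω ≤ ⌊((n : ℝ≥0) + 1) * T⌋₊ + 1 := fun ω => by
      simp only [gridIndex]
      gcongr
      exact hT ω
    have hG : ∀ k, StronglyMeasurable[Path.filtration d (u k)] fun ω =>
        if gridIndex n S ω = k then g (ω (u (gridIndex n S ω))) else 0 := by
      intro k
      have : (fun ω => if gridIndex n S ω = k then g (ω (u (gridIndex n S ω))) else 0)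
          = fun ω : Path d => if gridIndex n S ω = k then g (ω (u k)) else 0 := by
        ext ω; split_ifs with h
        · rw [h]
        · rfl
      rw [this]
      exact (Measurable.ite (hS.measurableSet_gridIndex n k)
        (hgm.comp (measurable_eval_filtration le_rfl)) measurable_const).stronglyMeasurable
    have hG' : ∀ k, StronglyMeasurable[Path.filtration d (u k)] fun ω =>
        if gridIndex n S' ω = k then g (ω (u (gridIndex n S ω))) else 0 := by
      intro k
      have : (fun ω => if gridIndex n S' ω = k then g (ω (u (gridIndex n S ω))) else 0)
          = fun ω : Path d => if gridIndex n S' ω = k then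
            ∑ i ∈ Finset.range (k + 1),
              if gridIndex n S ω = i then g (ω (u (gridIndex n S ω))) else 0
            else 0 := by
        ext ω; split_ifs with h
        · rw [Finset.sum_ite_eq, if_pos]
          rw [Finset.mem_range, ← h]
          exact Nat.lt_succ_of_le (hK ω)
        · rfl
      rw [this]
      refine StronglyMeasurable.ite (hS'.measurableSet_gridIndex n k) ?_ stronglyMeasurable_const
      refine Finset.stronglyMeasurable_fun_sum _ fun i hi => (hG i).mono ?_
      exact (Path.filtration d).mono (hu (Nat.le_of_lt_succ (Finset.mem_range.1 hi)))
    have e1 := integral_mul_stopped hM hu (fun ω => (hK ω).trans (hN ω))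
      (fun ω => hc (ω (u (gridIndex n S ω)))) hG
    have e2 := integral_mul_stopped hM hu hN
      (fun ω => hc (ω (u (gridIndex n S ω)))) hG'
    calc _ = ∫ ω, g (ω (u (gridIndex n S ω))) * M (u (gridIndex n S' ω)) ω
          - g (ω (u (gridIndex n S ω))) * M (u (gridIndex n S ω)) ω ∂μ := by
          refine integral_congr_ae (ae_of_all _ fun ω => ?_)
          simp only [grid_eq_gridIndex, u]; ring
      _ = 0 := by rw [integral_sub e2.1 e1.1, e1.2, e2.2, sub_self]
  have hlim : Tendsto (fun n => ∫ ω, g (ω (grid n (S ω))) * (M (grid n (S' ω)) ω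
      - M (grid n (S ω)) ω) ∂μ) atTop (𝓝 (∫ ω, g (ω (S ω)) * (M (S' ω) ω - M (S ω) ω) ∂μ)) := by
    have hgrid : ∀ n, Measurable (grid n) := fun n => by
      unfold grid
      exact (measurable_from_nat (f := fun k : ℕ => (k : ℝ≥0) / ((n : ℝ≥0) + 1))).comp
        ((Nat.measurable_floor.comp (measurable_id.const_mul _)).add_const 1)
    have hMm := A.measurable_martingaleTerm hf
    refine tendsto_integral_of_dominated_convergence (fun _ => c * (Cf + Cf + C * (T + 1)))
      (fun n => ?_) (integrable_const _) (fun n => ae_of_all _ fun ω => ?_)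
      (ae_of_all _ fun ω => ?_)
    · refine Measurable.aestronglyMeasurable ?_
      refine (hgm.comp (Path.measurable_eval_comp ((hgrid n).comp hSm) measurable_id)).mul ?_
      exact (hMm.comp (((hgrid n).comp hSm').prodMk measurable_id)).sub
        (hMm.comp (((hgrid n).comp hSm).prodMk measurable_id))
    · rw [norm_mul]
      refine mul_le_mul (hc _) ?_ (norm_nonneg _) hc0
      have hle' : grid n (S ω) ≤ grid n (S' ω) := by
        simp only [grid]; gcongr; exact hle ω
      simp only [M]
      rw [A.martingaleTerm_sub hf, Real.norm_eq_abs]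
      have h1 := abs_integral_path_le hC ω (NNReal.coe_le_coe.2 hle')
      have h2 : C * ((grid n (S' ω) : ℝ) - grid n (S ω)) ≤ C * (T + 1) := by
        have h3 : (grid n (S' ω) : ℝ) ≤ T + 1 := by
          have h4 := grid_le n (S' ω)
          have h5 : 1 / ((n : ℝ≥0) + 1) ≤ 1 := by
            rw [div_le_one (by positivity)]; simp
          exact_mod_cast h4.trans (add_le_add (hT ω) h5)
        have h6 : (0 : ℝ) ≤ grid n (S ω) := NNReal.coe_nonneg _
        gcongr; linarith
      have h7 := (hCf (ω (grid n (S' ω)))).1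
      have h8 := (hCf (ω (grid n (S ω)))).1
      refine (abs_sub _ _).trans (add_le_add ((abs_sub _ _).trans (add_le_add h7 h8)) (h1.trans h2))
    · have hMcont : ∀ t : ℝ≥0, Tendsto (fun n => M (grid n t) ω) atTop (𝓝 (M t ω)) := by
        intro t
        refine Tendsto.sub (Tendsto.sub ?_ tendsto_const_nhds) ?_
        · exact (hf.1.continuous.tendsto _).comp (ω.tendsto_grid t)
        · have hcont := intervalIntegral.continuous_primitive
            (intervalIntegrable_path (A.measurable_op hf.1) hC ω) 0
          refine (hcont.tendsto t).comp ?_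
          exact (NNReal.continuous_coe.tendsto t).comp
            (tendsto_nhds_of_tendsto_nhdsWithin (tendsto_grid t))
      exact ((hg.tendsto _).comp (ω.tendsto_grid _)).mul ((hMcont _).sub (hMcont _))
  simp_rw [key] at hlim
  rw [tendsto_nhds_unique tendsto_const_nhds hlim]
  refine integral_congr_ae (ae_of_all _ fun ω => ?_)
  simp only [M]
  rw [A.martingaleTerm_sub hf]

/-- Dynkin's formula for `f` and `g` with `f g = 0`: only the jumps contribute. -/
lemma IsMartingaleSolution.integral_mul_eq {A : Coefficients d} {ν : Measure (E d)}
    {μ : Measure (Path d)} (hμ : IsMartingaleSolution A ν μ) {f g : E d → ℝ} (hf : IsCb2 f)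
    (hg : Continuous g) {c : ℝ} (hc : ∀ x, |g x| ≤ c) (hfg : ∀ x, g x * f x = 0)
    {S S' : Path d → ℝ≥0} (hS : IsOptionalTime S) (hS' : IsOptionalTime S')
    (hle : ∀ ω, S ω ≤ S' ω) {T : ℝ≥0} (hT : ∀ ω, S' ω ≤ T) :
    ∫ ω, g (ω (S ω)) * f (ω (S' ω)) ∂μ =
      ∫ ω, g (ω (S ω)) * (∫ r in (S ω : ℝ)..S' ω, A.op f (ω r.toNNReal)) ∂μ := by
  have := hμ.isProb
  obtain ⟨C, hC0, hC⟩ := A.op_bounded hf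
  obtain ⟨Cf, hCf⟩ := hf.2
  have hc0 : 0 ≤ c := (abs_nonneg _).trans (hc 0)
  have hSm := hS.measurable
  have hSm' := hS'.measurable
  have hX : ∀ {h : E d → ℝ} {S : Path d → ℝ≥0}, Continuous h → Measurable S →
      Measurable fun ω : Path d => h (ω (S ω)) := fun hh hS =>
    hh.measurable.comp (Path.measurable_eval_comp hS measurable_id)
  have h0 := hμ.dynkin hf hg hc hS hS' hle hT
  have hIm : Measurable fun ω : Path d => ∫ r in (S ω : ℝ)..S' ω, A.op f (ω r.toNNReal) := by
    have hI := intervalIntegrable_path (A.measurable_op hf.1) hC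
    have : ∀ ω : Path d, ∫ r in (S ω : ℝ)..S' ω, A.op f (ω r.toNNReal)
        = (∫ r in (0 : ℝ)..S' ω, A.op f (ω r.toNNReal))
          - ∫ r in (0 : ℝ)..S ω, A.op f (ω r.toNNReal) := fun ω =>
      (intervalIntegral.integral_interval_sub_left (hI ω _ _) (hI ω _ _)).symm
    simp_rw [this]
    have hm := measurable_additive (A.measurable_op hf.1)
    exact (hm.comp (hSm'.prodMk measurable_id)).sub (hm.comp (hSm.prodMk measurable_id))
  rw [← sub_eq_zero, ← integral_sub, ← h0]
  · refine integral_congr_ae (ae_of_all _ fun ω => ?_)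
    have := hfg (ω (S ω))
    simp only
    linear_combination this
  · refine integrable_of_bounded (c := c * Cf) ((hX hg hSm).mul (hX hf.1.continuous hSm'))
      fun ω => ?_
    rw [abs_mul]
    exact mul_le_mul (hc _) (hCf _).1 (abs_nonneg _) hc0
  · refine integrable_of_bounded (c := c * (C * T)) ((hX hg hSm).mul hIm) fun ω => ?_
    rw [abs_mul]
    refine mul_le_mul (hc _) ?_ (abs_nonneg _) hc0
    refine (abs_integral_path_le hC ω (NNReal.coe_le_coe.2 (hle ω))).trans ?_
    have h1 : (S' ω : ℝ) ≤ T := NNReal.coe_le_coe.2 (hT ω)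
    have h2 : (0 : ℝ) ≤ S ω := NNReal.coe_nonneg _
    gcongr; linarith

/-! ### Quasi-left-continuity -/

/-- A countable family of smooth bumps: a bump supported in the closed ball of radius `1 / (k + 1)`
around the `i`-th point of a dense sequence. -/
noncomputable def testFun (i k : ℕ) : E d → ℝ :=
  (⟨1 / (2 * ((k : ℝ) + 1)), 1 / ((k : ℝ) + 1), by positivity, by
    rw [div_lt_div_iff_of_pos_left] <;>
      first | positivity | linarith [(Nat.cast_nonneg k : (0 : ℝ) ≤ k)]⟩ :
    ContDiffBump (TopologicalSpace.denseSeq (E d) i))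

lemma testFun_isCb2 (i k : ℕ) : IsCb2 (testFun i k : E d → ℝ) :=
  isCb2_of_hasCompactSupport (ContDiffBump.contDiff _) (ContDiffBump.hasCompactSupport _)

lemma testFun_continuous (i k : ℕ) : Continuous (testFun i k : E d → ℝ) :=
  (testFun_isCb2 i k).1.continuous

lemma testFun_nonneg (i k : ℕ) (x : E d) : 0 ≤ testFun i k x := ContDiffBump.nonneg _

lemma testFun_le_one (i k : ℕ) (x : E d) : testFun i k x ≤ 1 := ContDiffBump.le_one _

lemma abs_testFun_le_one (i k : ℕ) (x : E d) : |testFun i k x| ≤ 1 := by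
  rw [abs_of_nonneg (testFun_nonneg i k x)]; exact testFun_le_one i k x

lemma testFun_pos_iff (i k : ℕ) (x : E d) : 0 < testFun i k x ↔
    dist x (TopologicalSpace.denseSeq (E d) i) < 1 / ((k : ℝ) + 1) := by
  rw [(testFun_nonneg i k x).lt_iff_ne, ne_comm, ← Function.mem_support]
  rw [testFun, ContDiffBump.support_eq, Metric.mem_ball]

lemma tsupport_testFun (i k : ℕ) : tsupport (testFun i k : E d → ℝ) =
    Metric.closedBall (TopologicalSpace.denseSeq (E d) i) (1 / ((k : ℝ) + 1)) :=
  ContDiffBump.tsupport_eq _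

/-- Bumps separate points, with arbitrarily small supports around a given point. -/
lemma exists_testFun_pos (x : E d) {ε : ℝ} (hε : 0 < ε) : ∃ i k, 0 < testFun i k x ∧
    ∀ y, dist y (TopologicalSpace.denseSeq (E d) i) ≤ 1 / ((k : ℝ) + 1) → dist y x < ε := by
  obtain ⟨k, hk⟩ := exists_nat_one_div_lt (half_pos hε)
  obtain ⟨i, hi⟩ := (TopologicalSpace.denseRange_denseSeq (E d)).exists_dist_lt x
    (ε := 1 / ((k : ℝ) + 1)) (by positivity)
  refine ⟨i, k, (testFun_pos_iff i k x).2 hi, fun y hy => ?_⟩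
  have := dist_triangle_right y x (TopologicalSpace.denseSeq (E d) i)
  linarith

/-- Quasi-left-continuity: along an increasing sequence of optional times, the only possible limit
of the positions is the position at the limiting time. -/
lemma IsMartingaleSolution.quasiLeftContinuous {A : Coefficients d} {ν : Measure (E d)}
    {μ : Measure (Path d)} (hμ : IsMartingaleSolution A ν μ) {S : ℕ → Path d → ℝ≥0}
    {S' : Path d → ℝ≥0} (hS : ∀ n, IsOptionalTime (S n)) (hS' : IsOptionalTime S')
    (hle : ∀ n ω, S n ω ≤ S' ω) {T : ℝ≥0} (hT : ∀ ω, S' ω ≤ T)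
    (hlim : ∀ ω, Tendsto (fun n => S n ω) atTop (𝓝 (S' ω))) :
    ∀ᵐ ω ∂μ, ∀ l, Tendsto (fun n => ω (S n ω)) atTop (𝓝 l) → l = ω (S' ω) := by
  have := hμ.isProb
  have hX : ∀ {S : Path d → ℝ≥0}, IsOptionalTime S → ∀ i k,
      Measurable fun ω : Path d => testFun i k (ω (S ω)) := fun hS i k =>
    (testFun_continuous i k).measurable.comp (Path.measurable_eval_comp hS.measurable measurable_id)
  have key : ∀ i j k, (∀ x : E d, testFun i k x * testFun j k x = 0) → ∀ᵐ ω ∂μ,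
      liminf (fun n => ENNReal.ofReal (testFun i k (ω (S n ω)) * testFun j k (ω (S' ω)))) atTop
        = 0 := by
    intro i j k hij
    obtain ⟨C, hC0, hC⟩ := A.op_bounded (testFun_isCb2 (d := d) j k)
    have hm : ∀ n, Measurable fun ω : Path d => ENNReal.ofReal
        (testFun i k (ω (S n ω)) * testFun j k (ω (S' ω))) := fun n =>
      ((hX (hS n) i k).mul (hX hS' j k)).ennreal_ofReal
    have hb : ∀ n, ∫⁻ ω, ENNReal.ofReal (testFun i k (ω (S n ω)) * testFun j k (ω (S' ω))) ∂μ
        ≤ ENNReal.ofReal (∫ ω, C * ((S' ω : ℝ) - S n ω) ∂μ) := by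
      intro n
      rw [← ofReal_integral_eq_lintegral_ofReal]
      · refine ENNReal.ofReal_le_ofReal ?_
        rw [hμ.integral_mul_eq (testFun_isCb2 j k) (testFun_continuous i k)
          (abs_testFun_le_one i k) hij (hS n) hS' (hle n) hT]
        refine (Real.le_norm_self _).trans
          (norm_integral_le_of_norm_le ?_ (ae_of_all _ fun ω => ?_))
        · refine integrable_of_bounded (c := C * T) ?_ fun ω => ?_
          · exact (hS'.measurable.coe_nnreal_real.sub (hS n).measurable.coe_nnreal_real).const_mul C
          · have h1 : (S n ω : ℝ) ≤ S' ω := NNReal.coe_le_coe.2 (hle n ω)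
            have h2 : (S' ω : ℝ) ≤ T := NNReal.coe_le_coe.2 (hT ω)
            have h3 : (0 : ℝ) ≤ S n ω := NNReal.coe_nonneg _
            rw [abs_of_nonneg (mul_nonneg hC0 (by linarith))]
            gcongr; linarith
        · have h1 := abs_integral_path_le hC ω (NNReal.coe_le_coe.2 (hle n ω))
          rw [norm_mul, Real.norm_eq_abs, Real.norm_eq_abs]
          calc _ ≤ 1 * (C * ((S' ω : ℝ) - S n ω)) :=
                mul_le_mul (abs_testFun_le_one _ _ _) h1 (abs_nonneg _) zero_le_one
            _ = _ := one_mul _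
      · refine integrable_of_bounded (c := 1) ((hX (hS n) i k).mul (hX hS' j k)) fun ω => ?_
        rw [abs_mul]
        exact mul_le_one₀ (abs_testFun_le_one _ _ _) (abs_nonneg _) (abs_testFun_le_one _ _ _)
      · exact ae_of_all _ fun ω => mul_nonneg (testFun_nonneg _ _ _) (testFun_nonneg _ _ _)
    have hz : Tendsto (fun n => ENNReal.ofReal (∫ ω, C * ((S' ω : ℝ) - S n ω) ∂μ)) atTop (𝓝 0) := by
      have h : Tendsto (fun n => ∫ ω, C * ((S' ω : ℝ) - S n ω) ∂μ) atTop
          (𝓝 (∫ _ω, (0 : ℝ) ∂μ)) := by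
        refine tendsto_integral_of_dominated_convergence (fun _ => C * T) (fun n => ?_)
          (integrable_const _) (fun n => ae_of_all _ fun ω => ?_) (ae_of_all _ fun ω => ?_)
        · exact ((hS'.measurable.coe_nnreal_real.sub
            (hS n).measurable.coe_nnreal_real).const_mul C).aestronglyMeasurable
        · have h1 : (S n ω : ℝ) ≤ S' ω := NNReal.coe_le_coe.2 (hle n ω)
          have h2 : (S' ω : ℝ) ≤ T := NNReal.coe_le_coe.2 (hT ω)
          have h3 : (0 : ℝ) ≤ S n ω := NNReal.coe_nonneg _
          rw [Real.norm_eq_abs, abs_of_nonneg (mul_nonneg hC0 (by linarith))]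
          gcongr; linarith
        · have h1 : Tendsto (fun n => (S n ω : ℝ)) atTop (𝓝 (S' ω : ℝ)) :=
            (NNReal.continuous_coe.tendsto _).comp (hlim ω)
          simpa using ((tendsto_const_nhds (x := (S' ω : ℝ))).sub h1).const_mul C
      simpa using ENNReal.tendsto_ofReal h
    have h0 : ∫⁻ ω, liminf (fun n => ENNReal.ofReal
        (testFun i k (ω (S n ω)) * testFun j k (ω (S' ω)))) atTop ∂μ = 0 := by
      refine le_antisymm ((lintegral_liminf_le hm).trans ?_) zero_le
      rw [← hz.liminf_eq]
      exact liminf_le_liminf (Eventually.of_forall hb)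
    exact (lintegral_eq_zero_iff (Measurable.liminf hm)).1 h0
  have key' : ∀ᵐ ω ∂μ, ∀ i j k, (∀ x : E d, testFun i k x * testFun j k x = 0) →
      liminf (fun n => ENNReal.ofReal (testFun i k (ω (S n ω)) * testFun j k (ω (S' ω)))) atTop
        = 0 := by
    refine ae_all_iff.2 fun i => ae_all_iff.2 fun j => ae_all_iff.2 fun k => ?_
    by_cases h : ∀ x : E d, testFun i k x * testFun j k x = 0
    · exact (key i j k h).mono fun ω hω _ => hω
    · exact ae_of_all μ fun ω h' => absurd h' h
  -- if the limit differed, two bumps with disjoint supports would separate it from `X_{S'}`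
  filter_upwards [key'] with ω hω l hl
  by_contra hne
  obtain ⟨k, hk⟩ := exists_nat_one_div_lt (show 0 < dist l (ω (S' ω)) / 4 by
    have := dist_pos.2 hne; positivity)
  have hk0 : (0 : ℝ) < 1 / ((k : ℝ) + 1) := by positivity
  obtain ⟨i, hi⟩ := (TopologicalSpace.denseRange_denseSeq (E d)).exists_dist_lt l hk0
  obtain ⟨j, hj⟩ := (TopologicalSpace.denseRange_denseSeq (E d)).exists_dist_lt (ω (S' ω)) hk0
  have hij : ∀ x : E d, testFun i k x * testFun j k x = 0 := by
    intro x
    by_contra hx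
    have h1 := (testFun_pos_iff i k x).1
      ((testFun_nonneg i k x).lt_of_ne' (left_ne_zero_of_mul hx))
    have h2 := (testFun_pos_iff j k x).1
      ((testFun_nonneg j k x).lt_of_ne' (right_ne_zero_of_mul hx))
    have h3 := dist_triangle_right l (ω (S' ω)) x
    have h4 := dist_triangle_right l x (TopologicalSpace.denseSeq (E d) i)
    have h5 := dist_triangle_right (ω (S' ω)) x (TopologicalSpace.denseSeq (E d) j)
    linarith
  have hpos : 0 < testFun i k l * testFun j k (ω (S' ω)) :=
    mul_pos ((testFun_pos_iff i k l).2 hi) ((testFun_pos_iff j k _).2 hj)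
  have ht : Tendsto (fun n => ENNReal.ofReal
      (testFun i k (ω (S n ω)) * testFun j k (ω (S' ω)))) atTop
      (𝓝 (ENNReal.ofReal (testFun i k l * testFun j k (ω (S' ω))))) :=
    ENNReal.tendsto_ofReal ((((testFun_continuous i k).tendsto l).comp hl).mul_const _)
  have := ht.liminf_eq.symm.trans (hω i j k hij)
  rw [ENNReal.ofReal_eq_zero] at this
  linarith

/-! ### A Borel version of the exit time -/

/-- The first time the path is within distance `1 / (n + 1)` of the complement of `D`. -/
noncomputable def nearTime (D : Set (E d)) (n : ℕ) (ω : Path d) : ℝ≥0∞ :=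
  ⨅ (t : ℝ≥0) (_ : Metric.infDist (ω t) Dᶜ < 1 / ((n : ℝ) + 1)), (t : ℝ≥0∞)

/-- The limit of the times at which the path comes near the complement of `D`. It is a Borel
function of the path, and almost surely equal to the exit time, which need not be Borel. -/
noncomputable def exitLimit (D : Set (E d)) (ω : Path d) : ℝ≥0∞ := ⨆ n, nearTime D n ω

lemma nearTime_mono (D : Set (E d)) (ω : Path d) : Monotone fun n => nearTime D n ω := by
  intro m n hmn
  refine le_iInf₂ fun t ht => iInf₂_le t (ht.trans_le ?_)
  gcongr

lemma nearTime_lt_iff (D : Set (E d)) (n : ℕ) (ω : Path d) (t : ℝ≥0∞) : nearTime D n ω < t ↔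
    ∃ s : ℝ≥0, Metric.infDist (ω s) Dᶜ < 1 / ((n : ℝ) + 1) ∧ (s : ℝ≥0∞) < t := by
  simp [nearTime, iInf_lt_iff]

lemma measurableSet_nearTime_lt (D : Set (E d)) (n : ℕ) (t : ℝ≥0) :
    MeasurableSet[Path.filtration d t] {ω | nearTime D n ω < t} := by
  have hopen : IsOpen {x : E d | Metric.infDist x Dᶜ < 1 / ((n : ℝ) + 1)} :=
    isOpen_lt (Metric.continuous_infDist_pt _) continuous_const
  obtain ⟨Q, hQc, hQd⟩ := TopologicalSpace.exists_countable_dense ℝ≥0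
  have : {ω : Path d | nearTime D n ω < t} = ⋃ q ∈ Q ∩ Set.Iio t,
      {ω : Path d | Metric.infDist (ω q) Dᶜ < 1 / ((n : ℝ) + 1)} := by
    ext ω
    simp only [Set.mem_ofPred_eq, Set.mem_iUnion, nearTime_lt_iff, ENNReal.coe_lt_coe]
    constructor
    · rintro ⟨s, hs, hst⟩
      have h1 : ∀ᶠ r in 𝓝[≥] s, Metric.infDist (ω r) Dᶜ < 1 / ((n : ℝ) + 1) :=
        (ω.right_cont s).tendsto.eventually (hopen.mem_nhds hs)
      obtain ⟨u, hu, hu'⟩ := mem_nhdsGE_iff_exists_Ico_subset.1 h1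
      obtain ⟨q, hqQ, hq⟩ := hQd.exists_between (show s < min u t from lt_min hu hst)
      exact ⟨q, ⟨hqQ, hq.2.trans_le (min_le_right _ _)⟩,
          hu' ⟨hq.1.le, hq.2.trans_le (min_le_left _ _)⟩⟩
    · rintro ⟨q, ⟨-, hq⟩, h⟩
      exact ⟨q, h, hq⟩
  rw [this]
  refine MeasurableSet.biUnion (hQc.mono Set.inter_subset_left) fun q hq => ?_
  exact measurable_eval_filtration (Set.mem_Iio.1 hq.2).le hopen.measurableSet

/-- The event `{exitLimit D < t}` depends on the path up to time `t` only: `exitLimit D` is an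
optional time with values in `[0, ∞]`. -/
lemma measurableSet_exitLimit_lt (D : Set (E d)) (t : ℝ≥0) :
    MeasurableSet[Path.filtration d t] {ω | exitLimit D ω < t} := by
  obtain ⟨Q, hQc, hQd⟩ := TopologicalSpace.exists_countable_dense ℝ≥0
  have : {ω : Path d | exitLimit D ω < t} = ⋃ q ∈ Q ∩ Set.Iio t, ⋂ n,
      {ω : Path d | nearTime D n ω < q} := by
    ext ω
    simp only [Set.mem_ofPred_eq, Set.mem_iUnion, Set.mem_iInter]
    constructor
    · intro h
      have hf : exitLimit D ω ≠ ⊤ := (h.trans ENNReal.coe_lt_top).ne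
      rw [← ENNReal.coe_toNNReal hf, ENNReal.coe_lt_coe] at h
      obtain ⟨q, hqQ, hq⟩ := hQd.exists_between h
      refine ⟨q, ⟨hqQ, hq.2⟩, fun n => (le_iSup (fun n => nearTime D n ω) n).trans_lt ?_⟩
      change exitLimit D ω < q
      rw [← ENNReal.coe_toNNReal hf, ENNReal.coe_lt_coe]
      exact hq.1
    · rintro ⟨q, ⟨-, hq⟩, h⟩
      exact (iSup_le fun n => (h n).le).trans_lt (ENNReal.coe_lt_coe.2 hq)
  rw [this]
  refine MeasurableSet.biUnion (hQc.mono Set.inter_subset_left) fun q hq =>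
    MeasurableSet.iInter fun n => ?_
  exact (Path.filtration d).mono (Set.mem_Iio.1 hq.2).le _ (measurableSet_nearTime_lt D n q)

lemma measurable_exitLimit (D : Set (E d)) : Measurable (exitLimit D) := by
  refine measurable_of_Iio fun a => ?_
  have : exitLimit D ⁻¹' Set.Iio a = ⋃ q : ℚ,
      {ω | (ENNReal.ofReal q ≤ a) ∧ exitLimit D ω < (Real.toNNReal q : ℝ≥0)} := by
    ext ω
    simp only [Set.mem_preimage, Set.mem_Iio, Set.mem_iUnion, Set.mem_ofPred_eq]
    constructor
    · intro h
      obtain ⟨q, -, h1, h2⟩ := ENNReal.lt_iff_exists_rat_btwn.1 h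
      exact ⟨q, h2.le, h1⟩
    · rintro ⟨q, h1, h2⟩
      exact h2.trans_le h1
  rw [this]
  refine MeasurableSet.iUnion fun q => (MeasurableSet.const _).inter ?_
  exact (Path.filtration d).le _ _ (measurableSet_exitLimit_lt D _)

lemma isOptionalTime_min {σ : Path d → ℝ≥0∞}
    (hσ : ∀ t : ℝ≥0, MeasurableSet[Path.filtration d t] {ω | σ ω < t}) (T : ℝ≥0) :
    IsOptionalTime fun ω => (min (σ ω) T).toNNReal := by
  intro t
  have : {ω | (min (σ ω) T).toNNReal < t} = {ω | σ ω < t} ∪ {_ω | T < t} := by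
    ext ω
    have hf : min (σ ω) T ≠ ⊤ := ((min_le_right _ _).trans_lt ENNReal.coe_lt_top).ne
    simp only [Set.mem_union, Set.mem_ofPred_eq]
    rw [← ENNReal.coe_lt_coe, ENNReal.coe_toNNReal hf, min_lt_iff, ENNReal.coe_lt_coe]
  rw [this]
  exact (hσ t).union (MeasurableSet.const _)

/-- Paths along which the exit from `D` behaves well: the path starts in `D`, the exit time agrees
with its Borel version, and the path leaves `D` continuously if its left limit is not in `D`. -/
structure IsRegularPath (D : Set (E d)) (ω : Path d) : Prop where
  start : ω 0 ∈ D
  exit_eq : exitTime D ω = exitLimit D ω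
  pos : 0 < exitTime D ω
  notMem : ∀ t : ℝ≥0, exitTime D ω = t → ω t ∉ D
  eq_left : ∀ t : ℝ≥0, exitTime D ω = t → ∀ l, Tendsto ω (𝓝[<] t) (𝓝 l) → l ∉ D → l = ω t

/-- By right-continuity, the path is within distance `1 / (n + 1)` of the complement of `D` at the
time `nearTime D n` itself. -/
lemma infDist_nearTime_le {D : Set (E d)} {n : ℕ} {ω : Path d} {s : ℝ≥0}
    (hs : nearTime D n ω = s) : Metric.infDist (ω s) Dᶜ ≤ 1 / ((n : ℝ) + 1) := by
  by_contra! h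
  have h1 : ∀ᶠ r in 𝓝[≥] s, 1 / ((n : ℝ) + 1) < Metric.infDist (ω r) Dᶜ :=
    (ω.right_cont s).tendsto.eventually
      ((isOpen_lt continuous_const (Metric.continuous_infDist_pt _)).mem_nhds h)
  obtain ⟨u, hu, hu'⟩ := mem_nhdsGE_iff_exists_Ico_subset.1 h1
  have h2 : nearTime D n ω < u := by rw [hs]; exact ENNReal.coe_lt_coe.2 hu
  obtain ⟨r, hr, hru⟩ := (nearTime_lt_iff D n ω u).1 h2
  have hsr : s ≤ r := by
    rw [← ENNReal.coe_le_coe, ← hs]; exact iInf₂_le r hr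
  have h3 : 1 / ((n : ℝ) + 1) < Metric.infDist (ω r) Dᶜ :=
    hu' ⟨hsr, ENNReal.coe_lt_coe.1 hru⟩
  linarith

/-- If the times `nearTime D n` are all smaller than their limit `t`, then the left limit at `t` is
outside of `D`, and quasi-left-continuity rules out a jump at `t`; otherwise `nearTime D n = t` for
large `n`, and the distance of the path at time `t` to the complement of `D` vanishes. -/
lemma isRegularPath_of_quasiLeftContinuous {D : Set (E d)} (hD : IsOpen D) (hDc : Dᶜ.Nonempty)
    {ω : Path d} (h0 : ω 0 ∈ D)
    (hq : ∀ T : ℕ, ∀ l, Tendsto (fun n => ω (min (nearTime D n ω) (T : ℝ≥0)).toNNReal) atTop (𝓝 l) →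
      l = ω (min (exitLimit D ω) (T : ℝ≥0)).toNNReal) : IsRegularPath D ω := by
  have hcont := Metric.continuous_infDist_pt (Dᶜ)
  have hmem : ∀ x, Metric.infDist x Dᶜ ≤ 0 → x ∉ D := fun x hx =>
    (hD.isClosed_compl.mem_iff_infDist_zero hDc).2 (le_antisymm hx Metric.infDist_nonneg)
  have hmem' : ∀ x, x ∉ D → Metric.infDist x Dᶜ = 0 := fun x hx =>
    (hD.isClosed_compl.mem_iff_infDist_zero hDc).1 hx
  -- if the approximating times are strictly smaller than the limit, then the path has no jump there
  have hjump : ∀ t : ℝ≥0, exitLimit D ω = t → (∀ n, nearTime D n ω < t) → ∀ l,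
      Tendsto ω (𝓝[<] t) (𝓝 l) → l = ω t ∧ l ∉ D := by
    intro t ht hlt l hl
    obtain ⟨T, hT⟩ := exists_nat_gt t
    have hfin : ∀ n, nearTime D n ω ≠ ⊤ := fun n => ((hlt n).trans ENNReal.coe_lt_top).ne
    have e1 : ∀ n, (min (nearTime D n ω) ((T : ℝ≥0) : ℝ≥0∞)) = nearTime D n ω := fun n =>
      min_eq_left ((hlt n).le.trans (ENNReal.coe_le_coe.2 hT.le))
    have e2 : min (exitLimit D ω) ((T : ℝ≥0) : ℝ≥0∞) = t := by
      rw [ht]; exact min_eq_left (ENNReal.coe_le_coe.2 hT.le)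
    have hq' := hq T l
    simp_rw [e1, e2, ENNReal.toNNReal_coe] at hq'
    have hs : Tendsto (fun n => (nearTime D n ω).toNNReal) atTop (𝓝[<] t) := by
      refine tendsto_nhdsWithin_iff.2 ⟨?_, Eventually.of_forall fun n => ?_⟩
      · rw [← ENNReal.tendsto_coe]
        simp_rw [ENNReal.coe_toNNReal (hfin _)]
        rw [← ht]
        exact tendsto_atTop_iSup (nearTime_mono D ω)
      · rw [Set.mem_Iio, ← ENNReal.coe_lt_coe, ENNReal.coe_toNNReal (hfin n)]
        exact hlt n
    have hl' : Tendsto (fun n => ω (nearTime D n ω).toNNReal) atTop (𝓝 l) := hl.comp hs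
    refine ⟨hq' hl', hmem l ?_⟩
    refine le_of_tendsto_of_tendsto ((hcont.tendsto l).comp hl')
      (tendsto_one_div_add_atTop_nhds_zero_nat (𝕜 := ℝ)) (Eventually.of_forall fun n => ?_)
    exact infDist_nearTime_le (ENNReal.coe_toNNReal (hfin n)).symm
  have hnot : ∀ t : ℝ≥0, exitLimit D ω = t → ω t ∉ D := by
    intro t ht
    by_cases hlt : ∀ n, nearTime D n ω < t
    · obtain ⟨l, hl⟩ := ω.left_lim t
      obtain ⟨h1, h2⟩ := hjump t ht hlt l hl
      rwa [← h1]
    · push Not at hlt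
      obtain ⟨n, hn⟩ := hlt
      have heq : ∀ m ≥ n, nearTime D m ω = t := fun m hm =>
        le_antisymm (by rw [← ht]; exact le_iSup (fun n => nearTime D n ω) m)
          (hn.trans (nearTime_mono D ω hm))
      refine hmem _ (ge_of_tendsto (tendsto_one_div_add_atTop_nhds_zero_nat (𝕜 := ℝ)) ?_)
      filter_upwards [eventually_ge_atTop n] with m hm
      exact infDist_nearTime_le (heq m hm)
  have hpos : 0 < exitLimit D ω := by
    refine pos_iff_ne_zero.2 fun h => ?_
    exact hnot 0 (by rw [h]; rfl) h0
  have hle : exitLimit D ω ≤ exitTime D ω := by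
    refine iSup_le fun n => le_iInf₂ fun t ht => iInf₂_le t ?_
    rw [hmem' _ ht.2]; positivity
  have hexit : exitTime D ω = exitLimit D ω := by
    refine le_antisymm ?_ hle
    by_cases hf : exitLimit D ω = ⊤
    · rw [hf]; exact le_top
    · have h1 := hnot _ (ENNReal.coe_toNNReal hf).symm
      rw [← ENNReal.coe_toNNReal hf] at hpos ⊢
      exact iInf₂_le _ ⟨ENNReal.coe_pos.1 hpos, h1⟩
  refine ⟨h0, hexit, hexit ▸ hpos, fun t ht => hnot t (hexit ▸ ht), fun t ht l hl hlD => ?_⟩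
  rw [hexit] at ht
  refine (hjump t ht (fun n => ?_) l hl).1
  have h0t : 0 < t := by rw [ht] at hpos; exact ENNReal.coe_pos.1 hpos
  have : (𝓝[<] t).NeBot := nhdsLT_neBot_of_exists_lt ⟨0, h0t⟩
  have h1 : ∀ᶠ s in 𝓝[<] t, Metric.infDist (ω s) Dᶜ < 1 / ((n : ℝ) + 1) := by
    refine hl.eventually ((isOpen_lt hcont continuous_const).mem_nhds ?_)
    simp only [Set.mem_ofPred_eq, hmem' l hlD]
    positivity
  obtain ⟨s, hs, hst⟩ := (h1.and self_mem_nhdsWithin).exists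
  exact (nearTime_lt_iff D n ω t).2 ⟨s, hs, ENNReal.coe_lt_coe.2 hst⟩

lemma IsMartingaleSolution.ae_start {A : Coefficients d} {x : E d} {μ : Measure (Path d)}
    (hμ : IsMartingaleSolution A (Measure.dirac x) μ) : ∀ᵐ ω ∂μ, ω 0 = x := by
  have h1 := hμ.initial {x}ᶜ (measurableSet_singleton x).compl
  rw [Measure.dirac_apply' _ (measurableSet_singleton x).compl] at h1
  simpa [ae_iff] using h1

lemma IsMartingaleSolution.ae_isRegularPath {A : Coefficients d} {x : E d} {μ : Measure (Path d)}
    (hμ : IsMartingaleSolution A (Measure.dirac x) μ) {D : Set (E d)} (hD : IsOpen D)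
    (hDc : Dᶜ.Nonempty) (hx : x ∈ D) : ∀ᵐ ω ∂μ, IsRegularPath D ω := by
  have hq : ∀ T : ℕ, ∀ᵐ ω ∂μ, ∀ l, Tendsto (fun n => ω (min (nearTime D n ω) (T : ℝ≥0)).toNNReal)
      atTop (𝓝 l) → l = ω (min (exitLimit D ω) (T : ℝ≥0)).toNNReal := fun T => by
    have hfin : ∀ a : ℝ≥0∞, min a ((T : ℝ≥0) : ℝ≥0∞) ≠ ⊤ := fun a =>
      ((min_le_right _ _).trans_lt ENNReal.coe_lt_top).ne
    refine hμ.quasiLeftContinuous (S := fun n ω => (min (nearTime D n ω) (T : ℝ≥0)).toNNReal)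
      (S' := fun ω => (min (exitLimit D ω) (T : ℝ≥0)).toNNReal) (T := T)
      (fun n => isOptionalTime_min (measurableSet_nearTime_lt D n) T)
      (isOptionalTime_min (measurableSet_exitLimit_lt D) T)
      (fun n ω => ?_) (fun ω => ?_) fun ω => ?_
    · refine ENNReal.toNNReal_mono (hfin _) (min_le_min_right _ ?_)
      exact le_iSup (fun n => nearTime D n ω) n
    · rw [← ENNReal.coe_le_coe, ENNReal.coe_toNNReal (hfin _)]
      exact min_le_right _ _
    · refine (ENNReal.tendsto_toNNReal (hfin _)).comp ?_
      exact (tendsto_atTop_iSup (nearTime_mono D ω)).min tendsto_const_nhds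
  filter_upwards [hμ.ae_start, ae_all_iff.2 hq] with ω h0 h1
  exact isRegularPath_of_quasiLeftContinuous hD hDc (h0 ▸ hx) h1

/-! ### Jumps of the canonical process -/

/-- A càdlàg path has at most countably many jumps. -/
lemma Path.countable_not_continuousAt (ω : Path d) :
    {t : ℝ≥0 | ¬ ContinuousAt ω.toFun t}.Countable := by
  let J : ℕ → Set ℝ≥0 := fun k => {t | ¬ ∀ᶠ s in 𝓝[<] t, dist (ω s) (ω t) < 1 / ((k : ℝ) + 1)}
  have hJ : ∀ k, (J k).Countable := by
    intro k
    refine Set.Countable.mono ?_ (countable_setOfPred_isolated_right_within (s := J k))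
    intro t ht
    refine Set.mem_ofPred_eq.mpr ⟨ht, ?_⟩
    have h1 : ∀ᶠ s in 𝓝[≥] t, dist (ω s) (ω t) < 1 / (2 * ((k : ℝ) + 1)) :=
      (ω.right_cont t).tendsto.eventually (Metric.ball_mem_nhds _ (by positivity))
    obtain ⟨u, hu, hu'⟩ := mem_nhdsGE_iff_exists_Ico_subset.1 h1
    rw [← empty_mem_iff_bot, mem_nhdsWithin]
    refine ⟨Set.Iio u, isOpen_Iio, hu, ?_⟩
    rintro s ⟨hsu, hsJ, hts⟩
    refine hsJ ?_
    filter_upwards [Ioo_mem_nhdsLT hts] with r hr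
    have h2 : dist (ω r) (ω t) < 1 / (2 * ((k : ℝ) + 1)) := hu' ⟨hr.1.le, hr.2.trans hsu⟩
    have h3 : dist (ω s) (ω t) < 1 / (2 * ((k : ℝ) + 1)) := hu' ⟨le_of_lt hts, hsu⟩
    have h4 : 1 / (2 * ((k : ℝ) + 1)) + 1 / (2 * ((k : ℝ) + 1)) = 1 / ((k : ℝ) + 1) := by
      field_simp; norm_num
    linarith [dist_triangle_right (ω r) (ω s) (ω t)]
  refine (Set.countable_iUnion hJ).mono fun t ht => ?_
  by_contra hnot
  simp only [Set.mem_iUnion, J, Set.mem_ofPred_eq, not_exists, not_not] at hnot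
  refine ht (continuousAt_iff_continuous_left'_right'.2 ⟨?_, ?_⟩)
  · refine Metric.tendsto_nhds.2 fun ε hε => ?_
    obtain ⟨k, hk⟩ := exists_nat_one_div_lt hε
    exact (hnot k).mono fun s hs => hs.trans hk
  · exact (ω.right_cont t).mono Set.Ioi_subset_Ici_self

lemma Path.ae_continuousAt (ω : Path d) : ∀ᵐ r : ℝ, 0 < r → ContinuousAt ω.toFun r.toNNReal := by
  have h := (ω.countable_not_continuousAt.image ((↑) : ℝ≥0 → ℝ)).measure_zero volume
  rw [measure_eq_zero_iff_ae_notMem] at h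
  filter_upwards [h] with r hr h0
  by_contra hc
  exact hr ⟨r.toNNReal, hc, Real.coe_toNNReal r h0.le⟩

/-- The index of the last point of the grid `{k / (n + 1)}` strictly to the left of `t`. -/
noncomputable def leftIndex (n : ℕ) (t : ℝ≥0) : ℕ := ⌈((n : ℝ≥0) + 1) * t⌉₊ - 1

lemma leftIndex_add_one {n : ℕ} {t : ℝ≥0} (ht : 0 < t) :
    leftIndex n t + 1 = ⌈((n : ℝ≥0) + 1) * t⌉₊ := by
  have : 0 < ⌈((n : ℝ≥0) + 1) * t⌉₊ := Nat.ceil_pos.2 (by positivity)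
  rw [leftIndex]; omega

lemma leftIndex_lt {n : ℕ} {t : ℝ≥0} (ht : 0 < t) :
    (leftIndex n t : ℝ≥0) / ((n : ℝ≥0) + 1) < t := by
  rw [div_lt_iff₀ (by positivity), mul_comm]
  exact Nat.lt_ceil.1 (by rw [← leftIndex_add_one ht]; exact Nat.lt_succ_self _)

lemma le_leftIndex_add_one (n : ℕ) {t : ℝ≥0} (ht : 0 < t) :
    t ≤ ((leftIndex n t + 1 : ℕ) : ℝ≥0) / ((n : ℝ≥0) + 1) := by
  rw [le_div_iff₀ (by positivity), mul_comm, leftIndex_add_one ht]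
  exact Nat.le_ceil _

lemma leftIndex_eq {n i : ℕ} {t : ℝ≥0} (h1 : (i : ℝ≥0) / ((n : ℝ≥0) + 1) < t)
    (h2 : t ≤ ((i + 1 : ℕ) : ℝ≥0) / ((n : ℝ≥0) + 1)) : leftIndex n t = i := by
  rw [div_lt_iff₀ (by positivity), mul_comm] at h1
  rw [le_div_iff₀ (by positivity), mul_comm] at h2
  have h3 : ⌈((n : ℝ≥0) + 1) * t⌉₊ ≤ i + 1 := Nat.ceil_le.2 h2
  have h4 : i < ⌈((n : ℝ≥0) + 1) * t⌉₊ := Nat.lt_ceil.2 h1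
  rw [leftIndex]; omega

lemma leftIndex_lt_mul {n N : ℕ} {t : ℝ≥0} (ht : 0 < t) (hN : t ≤ N) :
    leftIndex n t < N * (n + 1) := by
  have h1 : ⌈((n : ℝ≥0) + 1) * t⌉₊ ≤ N * (n + 1) := by
    refine Nat.ceil_le.2 ?_
    push_cast
    rw [mul_comm]; gcongr
  rw [← leftIndex_add_one ht] at h1
  omega

lemma tendsto_leftIndex {t : ℝ≥0} (ht : 0 < t) :
    Tendsto (fun n => (leftIndex n t : ℝ≥0) / ((n : ℝ≥0) + 1)) atTop (𝓝[<] t) := by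
  refine tendsto_nhdsWithin_iff.2 ⟨?_, Eventually.of_forall fun n => leftIndex_lt ht⟩
  have h1 : Tendsto (fun n : ℕ => t - 1 / ((n : ℝ≥0) + 1)) atTop (𝓝 t) := by
    simpa using (tendsto_const_nhds (x := t)).sub tendsto_one_div_nnreal
  refine tendsto_of_tendsto_of_tendsto_of_le_of_le h1 tendsto_const_nhds (fun n => ?_)
    fun n => (leftIndex_lt ht).le
  refine tsub_le_iff_right.2 ?_
  have := le_leftIndex_add_one n ht
  rwa [Nat.cast_add, add_div, Nat.cast_one] at this

lemma tendsto_leftIndex_add_one {t : ℝ≥0} (ht : 0 < t) :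
    Tendsto (fun n => ((leftIndex n t + 1 : ℕ) : ℝ≥0) / ((n : ℝ≥0) + 1)) atTop (𝓝 t) := by
  have h1 := (tendsto_nhds_of_tendsto_nhdsWithin (tendsto_leftIndex ht)).add tendsto_one_div_nnreal
  simpa [add_div] using h1

lemma measurable_leftIndex (n : ℕ) : Measurable (leftIndex n) :=
  (measurable_from_nat (f := fun k : ℕ => k - 1)).comp
    (Nat.measurable_ceil.comp (measurable_id.const_mul _))

/-- The occupation measure of the process up to time `N`. -/
noncomputable def occupation (μ : Measure (Path d)) (N : ℕ) : Measure (E d) :=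
  (μ.prod (volume.restrict (Set.Ioc (0 : ℝ) N))).map fun p => p.1 p.2.toNNReal

instance (μ : Measure (Path d)) [IsFiniteMeasure μ] (N : ℕ) : IsFiniteMeasure (occupation μ N) := by
  unfold occupation; infer_instance

lemma measurable_eval_real : Measurable fun p : Path d × ℝ => p.1 p.2.toNNReal :=
  Path.measurable_eval_comp measurable_snd.real_toNNReal measurable_fst

lemma integral_occupation {μ : Measure (Path d)} [IsFiniteMeasure μ] (N : ℕ) {h : E d → ℝ}
    (hh : Measurable h) {C : ℝ} (hC : ∀ x, |h x| ≤ C) :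
    ∫ x, h x ∂(occupation μ N) = ∫ ω, (∫ r in (0 : ℝ)..N, h (ω r.toNNReal)) ∂μ := by
  rw [occupation, integral_map measurable_eval_real.aemeasurable hh.aestronglyMeasurable,
    integral_prod (fun p : Path d × ℝ => h (p.1 p.2.toNNReal))
      (integrable_of_bounded (hh.comp measurable_eval_real) fun p => hC _)]
  refine integral_congr_ae (ae_of_all _ fun ω => ?_)
  simp only
  rw [intervalIntegral.integral_of_le (Nat.cast_nonneg N)]

/-- The sum of `g(X_{s-}) f(X_s)` along a discretization with step `1 / (n + 1)` up to time `N`. -/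
noncomputable def jumpSum (f g : E d → ℝ) (N n : ℕ) (ω : Path d) : ℝ≥0∞ :=
  ∑ i ∈ Finset.range (N * (n + 1)), ENNReal.ofReal
    (g (ω ((i : ℝ≥0) / ((n : ℝ≥0) + 1))) * f (ω (((i + 1 : ℕ) : ℝ≥0) / ((n : ℝ≥0) + 1))))

lemma measurable_jumpSum {f g : E d → ℝ} (hf : Measurable f) (hg : Measurable g) (N n : ℕ) :
    Measurable (jumpSum f g N n) :=
  Finset.measurable_sum _ fun _ _ =>
    ((hg.comp (Path.measurable_eval _)).mul (hf.comp (Path.measurable_eval _))).ennreal_ofReal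

/-- One half of the Lévy system formula: the expected number of jumps, weighted by
`g(X_{s-}) f(X_s)` with `f g = 0`, is at most the compensator `∫ g(X_s) Af(X_s) ds`. -/
lemma IsMartingaleSolution.lintegral_jumpSum_le {A : Coefficients d} {ν : Measure (E d)}
    {μ : Measure (Path d)} (hμ : IsMartingaleSolution A ν μ) {f g : E d → ℝ} (hf : IsCb2 f)
    (hf0 : ∀ x, 0 ≤ f x) (hg : Continuous g) (hg0 : ∀ x, 0 ≤ g x) (hg1 : ∀ x, g x ≤ 1)
    (hfg : ∀ x, g x * f x = 0) (N : ℕ) :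
    ∫⁻ ω, liminf (fun n => jumpSum f g N n ω) atTop ∂μ ≤
      ENNReal.ofReal (∫ x, g x * A.op f x ∂(occupation μ N)) := by
  have := hμ.isProb
  obtain ⟨C, hC0, hC⟩ := A.op_bounded hf
  obtain ⟨Cf, hCf⟩ := hf.2
  have hgm := hg.measurable
  have hfm := hf.1.continuous.measurable
  have hom := A.measurable_op hf.1
  have hgabs : ∀ x, |g x| ≤ 1 := fun x => by rw [abs_of_nonneg (hg0 x)]; exact hg1 x
  have hprod : ∀ x y, |g x * A.op f y| ≤ C := fun x y => by
    rw [abs_mul]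
    exact (mul_le_mul (hgabs x) (hC y) (abs_nonneg _) zero_le_one).trans_eq (one_mul C)
  -- the position at the last grid point before `r`
  let L : ℕ → Path d → ℝ → E d := fun n ω r =>
    ω ((leftIndex n r.toNNReal : ℝ≥0) / ((n : ℝ≥0) + 1))
  have hLm : ∀ n, Measurable fun p : Path d × ℝ => L n p.1 p.2 := fun n =>
    Path.measurable_eval_comp (((measurable_from_nat (f := fun k : ℕ => (k : ℝ≥0))).comp
      ((measurable_leftIndex n).comp measurable_snd.real_toNNReal)).div_const _) measurable_fst
  have hFm : ∀ n, Measurable fun p : Path d × ℝ => g (L n p.1 p.2) * A.op f (p.1 p.2.toNNReal) :=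
    fun n => (hgm.comp (hLm n)).mul (hom.comp measurable_eval_real)
  have hstep : ∀ n, ∫⁻ ω, jumpSum f g N n ω ∂μ =
      ENNReal.ofReal (∫ ω, (∫ r in (0 : ℝ)..N, g (L n ω r) * A.op f (ω r.toNNReal)) ∂μ) := by
    intro n
    let a : ℕ → ℝ := fun k => (((k : ℝ≥0) / ((n : ℝ≥0) + 1) : ℝ≥0) : ℝ)
    have ha : ∀ i, a i ≤ a (i + 1) := fun i => by
      simp only [a]
      refine NNReal.coe_le_coe.2 ?_
      gcongr
      exact Nat.le_succ i
    have haN : a (N * (n + 1)) = N := by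
      simp only [a]; push_cast
      field_simp
    have hint : ∀ ω : Path d, ∀ x y : ℝ, IntervalIntegrable
        (fun r => g (L n ω r) * A.op f (ω r.toNNReal)) volume x y := fun ω x y => by
      refine (intervalIntegrable_const (c := C)).mono_fun
        ((hFm n).comp measurable_prodMk_left).aestronglyMeasurable (ae_of_all _ fun r => ?_)
      simpa using (hprod _ _).trans (le_abs_self C)
    have hpt : ∀ ω : Path d, ∫ r in (0 : ℝ)..N, g (L n ω r) * A.op f (ω r.toNNReal) =
        ∑ i ∈ Finset.range (N * (n + 1)), g (ω ((i : ℝ≥0) / ((n : ℝ≥0) + 1))) *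
          ∫ r in a i..a (i + 1), A.op f (ω r.toNNReal) := by
      intro ω
      have h := intervalIntegral.sum_integral_adjacent_intervals (a := a) (n := N * (n + 1))
        (fun k _ => hint ω (a k) (a (k + 1)))
      rw [haN, show a 0 = 0 by simp [a]] at h
      rw [← h]
      refine Finset.sum_congr rfl fun i _ => ?_
      rw [← intervalIntegral.integral_const_mul]
      refine intervalIntegral.integral_congr_ae (ae_of_all _ fun r hr => ?_)
      rw [Set.uIoc_of_le (ha i)] at hr
      have h1 : leftIndex n r.toNNReal = i := by
        refine leftIndex_eq ?_ ?_
        · rw [← NNReal.coe_lt_coe, Real.coe_toNNReal _ ((NNReal.coe_nonneg _).trans hr.1.le)]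
          exact hr.1
        · exact Real.toNNReal_le_iff_le_coe.2 hr.2
      simp only [L, h1]
    have hterm : ∀ i : ℕ, Integrable (fun ω : Path d => g (ω ((i : ℝ≥0) / ((n : ℝ≥0) + 1))) *
          ∫ r in a i..a (i + 1), A.op f (ω r.toNNReal)) μ := fun i => by
      have hm : Measurable fun ω : Path d => ∫ r in a i..a (i + 1), A.op f (ω r.toNNReal) := by
        simp_rw [intervalIntegral.integral_of_le (ha i)]
        exact (StronglyMeasurable.integral_prod_right (f := fun (ω : Path d) (r : ℝ) =>
          A.op f (ω r.toNNReal)) (hom.comp measurable_eval_real).stronglyMeasurable).measurable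
      refine integrable_of_bounded (c := 1 * (C * (a (i + 1) - a i)))
        ((hgm.comp (Path.measurable_eval _)).mul hm) fun ω => ?_
      rw [abs_mul]
      exact mul_le_mul (hgabs _) (abs_integral_path_le hC ω (ha i)) (abs_nonneg _) zero_le_one
    have hdyn : ∀ i : ℕ, ∫⁻ ω, ENNReal.ofReal (g (ω ((i : ℝ≥0) / ((n : ℝ≥0) + 1))) *
        f (ω (((i + 1 : ℕ) : ℝ≥0) / ((n : ℝ≥0) + 1)))) ∂μ =
        ENNReal.ofReal (∫ ω, g (ω ((i : ℝ≥0) / ((n : ℝ≥0) + 1))) *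
          (∫ r in a i..a (i + 1), A.op f (ω r.toNNReal)) ∂μ) := by
      intro i
      rw [← hμ.integral_mul_eq hf hg hgabs hfg (isOptionalTime_const ((i : ℝ≥0) / ((n : ℝ≥0) + 1)))
        (isOptionalTime_const (((i + 1 : ℕ) : ℝ≥0) / ((n : ℝ≥0) + 1)))
        (fun _ => NNReal.coe_le_coe.1 (ha i)) (fun _ => le_rfl)]
      refine (ofReal_integral_eq_lintegral_ofReal ?_ (ae_of_all _ fun ω => ?_)).symm
      · refine integrable_of_bounded (c := 1 * Cf) ((hgm.comp (Path.measurable_eval _)).mul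
          (hfm.comp (Path.measurable_eval _))) fun ω => ?_
        rw [abs_mul]
        exact mul_le_mul (hgabs _) (hCf _).1 (abs_nonneg _) zero_le_one
      · exact mul_nonneg (hg0 _) (hf0 _)
    have hnn : ∀ i : ℕ, 0 ≤ ∫ ω, g (ω ((i : ℝ≥0) / ((n : ℝ≥0) + 1))) *
          (∫ r in a i..a (i + 1), A.op f (ω r.toNNReal)) ∂μ := by
      intro i
      rw [← hμ.integral_mul_eq hf hg hgabs hfg (isOptionalTime_const ((i : ℝ≥0) / ((n : ℝ≥0) + 1)))
        (isOptionalTime_const (((i + 1 : ℕ) : ℝ≥0) / ((n : ℝ≥0) + 1)))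
        (fun _ => NNReal.coe_le_coe.1 (ha i)) (fun _ => le_rfl)]
      exact integral_nonneg fun ω => mul_nonneg (hg0 _) (hf0 _)
    simp_rw [hpt]
    rw [integral_finsetSum _ fun i _ => hterm i, ENNReal.ofReal_sum_of_nonneg fun i _ => hnn i]
    simp only [jumpSum]
    refine (lintegral_finsetSum _ fun i _ => ?_).trans (Finset.sum_congr rfl fun i _ => hdyn i)
    exact ((hgm.comp (Path.measurable_eval _)).mul
      (hfm.comp (Path.measurable_eval _))).ennreal_ofReal
  have hlim : Tendsto (fun n => ∫ ω, (∫ r in (0 : ℝ)..N, g (L n ω r) * A.op f (ω r.toNNReal)) ∂μ)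
      atTop (𝓝 (∫ ω, (∫ r in (0 : ℝ)..N, g (ω r.toNNReal) * A.op f (ω r.toNNReal)) ∂μ)) := by
    refine tendsto_integral_of_dominated_convergence (fun _ => C * N) (fun n => ?_)
      (integrable_const _) (fun n => ae_of_all _ fun ω => ?_) (ae_of_all _ fun ω => ?_)
    · simp_rw [intervalIntegral.integral_of_le (Nat.cast_nonneg N : (0 : ℝ) ≤ N)]
      exact (StronglyMeasurable.integral_prod_right (f := fun (ω : Path d) (r : ℝ) =>
          g (L n ω r) * A.op f (ω r.toNNReal)) (hFm n).stronglyMeasurable).aestronglyMeasurable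
    · have := intervalIntegral.norm_integral_le_of_norm_le_const (a := (0 : ℝ)) (b := N) (C := C)
        (f := fun r => g (L n ω r) * A.op f (ω r.toNNReal)) fun r _ => hprod _ _
      simpa using this
    · refine intervalIntegral.tendsto_integral_filter_of_dominated_convergence (fun _ => C)
        (Eventually.of_forall fun n => ((hFm n).comp measurable_prodMk_left).aestronglyMeasurable)
        (Eventually.of_forall fun n => ae_of_all _ fun r _ => hprod _ _)
        intervalIntegrable_const ?_
      filter_upwards [ω.ae_continuousAt] with r hr hr'
      rw [Set.uIoc_of_le (Nat.cast_nonneg N)] at hr'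
      have h1 : Tendsto (fun n => L n ω r) atTop (𝓝 (ω r.toNNReal)) :=
        (hr hr'.1).tendsto.comp (tendsto_nhds_of_tendsto_nhdsWithin
          (tendsto_leftIndex (Real.toNNReal_pos.2 hr'.1)))
      exact ((hg.tendsto _).comp h1).mul_const _
  rw [integral_occupation (h := fun x => g x * A.op f x) N (hgm.mul hom) fun x => hprod x x]
  refine (lintegral_liminf_le fun n => measurable_jumpSum hfm hgm N n).trans ?_
  simp_rw [hstep]
  exact (ENNReal.tendsto_ofReal hlim).liminf_eq.le

/-- There is almost surely no jump into `{f > 0}` from a point off the support of `f` which has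
zero jump intensity into `{f > 0}`. -/
lemma IsMartingaleSolution.ae_no_jump {A : Coefficients d} {ν : Measure (E d)}
    {μ : Measure (Path d)} (hμ : IsMartingaleSolution A ν μ) {f : E d → ℝ} (hf : IsCb2 f)
    (hf0 : ∀ x, 0 ≤ f x) (N : ℕ) :
    ∀ᵐ ω ∂μ, ∀ t : ℝ≥0, 0 < t → t ≤ N → ∀ l, Tendsto ω.toFun (𝓝[<] t) (𝓝 l) →
      l ∉ tsupport f → A.op f l = 0 → f (ω t) = 0 := by
  have := hμ.isProb
  by_cases hne : (tsupport f).Nonempty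
  swap
  · refine ae_of_all _ fun ω t _ _ l _ _ _ => ?_
    by_contra h
    exact hne ⟨_, subset_tsupport f h⟩
  obtain ⟨C, hC0, hC⟩ := A.op_bounded hf
  have hom := A.measurable_op hf.1
  have hfm := hf.1.continuous.measurable
  set U : Set (E d) := (tsupport f)ᶜ with hU
  have hUo : IsOpen U := (isClosed_tsupport f).isOpen_compl
  have hopU : ∀ x ∈ U, 0 ≤ A.op f x := fun x hx => by
    rw [A.op_of_notMem_tsupport hx]; exact integral_nonneg fun y => hf0 _
  set G : Set (E d) := U ∩ {x | A.op f x = 0} with hG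
  have hGm : MeasurableSet G := hUo.measurableSet.inter (hom (measurableSet_singleton 0))
  set ρ : Measure (E d) := ((occupation μ N).restrict U).withDensity
    fun x => ENNReal.ofReal (A.op f x) with hρ
  have hρfin : IsFiniteMeasure ρ := isFiniteMeasure_withDensity_ofReal
    (integrable_of_bounded hom hC).hasFiniteIntegral
  have hρG : ρ G = 0 := by
    rw [hρ, withDensity_apply _ hGm]
    refine (setLIntegral_congr_fun hGm fun x hx => ?_).trans lintegral_zero
    simp only [hx.2.out, ENNReal.ofReal_zero]
  have hO : ∀ m : ℕ, ∃ O, G ⊆ O ∧ O ⊆ U ∧ IsOpen O ∧ ρ O ≤ ENNReal.ofReal (1 / ((m : ℝ) + 1)) := by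
    intro m
    obtain ⟨O, h1, h2, h3⟩ := Set.exists_isOpen_lt_of_lt (μ := ρ) G
      (ENNReal.ofReal (1 / ((m : ℝ) + 1)))
      (by rw [hρG]; exact ENNReal.ofReal_pos.2 (by positivity))
    exact ⟨O ∩ U, Set.subset_inter h1 Set.inter_subset_left, Set.inter_subset_right, h2.inter hUo,
      (measure_mono Set.inter_subset_left).trans h3.le⟩
  -- `ρ` is the compensator of the jumps into `{f > 0}` from `U`; it does not charge `G`, hence `G`
  -- has open neighborhoods `O m` of small compensator
  choose O hGO hOU hOo hOρ using hO
  -- continuous functions increasing to the indicator of `O m`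
  let g : ℕ → ℕ → E d → ℝ := fun m k x => min 1 (k * Metric.infDist x (O m)ᶜ)
  have hOc : ∀ m, (O m)ᶜ.Nonempty := fun m =>
    hne.mono fun x hx hxO => hOU m hxO hx
  have hgc : ∀ m k, Continuous (g m k) := fun m k =>
    continuous_const.min (continuous_const.mul (Metric.continuous_infDist_pt _))
  have hg0 : ∀ m k x, 0 ≤ g m k x := fun m k x =>
    le_min zero_le_one (mul_nonneg (Nat.cast_nonneg k) Metric.infDist_nonneg)
  have hg1 : ∀ m k x, g m k x ≤ 1 := fun m k x => min_le_left _ _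
  have hgz : ∀ m k x, x ∉ O m → g m k x = 0 := fun m k x hx => by
    simp only [g]
    rw [Metric.infDist_zero_of_mem (Set.mem_compl hx)]; simp
  have hgf : ∀ m k x, g m k x * f x = 0 := fun m k x => by
    by_cases hx : x ∈ O m
    · rw [image_eq_zero_of_notMem_tsupport (hOU m hx), mul_zero]
    · rw [hgz m k x hx, zero_mul]
  let Z : ℕ → ℕ → Path d → ℝ≥0∞ := fun m k ω => liminf (fun n => jumpSum f (g m k) N n ω) atTop
  have hZm : ∀ m k, Measurable (Z m k) := fun m k =>
    Measurable.liminf fun n => measurable_jumpSum hfm (hgc m k).measurable N n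
  have hZmono : ∀ m, Monotone (Z m) := by
    intro m k k' hkk' ω
    refine liminf_le_liminf (Eventually.of_forall fun n => ?_)
    refine Finset.sum_le_sum fun i _ => ENNReal.ofReal_le_ofReal ?_
    refine mul_le_mul_of_nonneg_right ?_ (hf0 _)
    refine min_le_min_left _ (mul_le_mul_of_nonneg_right ?_ Metric.infDist_nonneg)
    exact_mod_cast hkk'
  have hZρ : ∀ m k, ∫⁻ ω, Z m k ω ∂μ ≤ ρ (O m) := by
    intro m k
    refine (hμ.lintegral_jumpSum_le hf hf0 (hgc m k) (hg0 m k) (hg1 m k) (hgf m k) N).trans ?_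
    have hpos : ∀ x, 0 ≤ g m k x * A.op f x := fun x => by
      by_cases hx : x ∈ O m
      · exact mul_nonneg (hg0 m k x) (hopU x (hOU m hx))
      · rw [hgz m k x hx, zero_mul]
    rw [ofReal_integral_eq_lintegral_ofReal _ (ae_of_all _ hpos)]
    · rw [hρ, withDensity_apply _ (hOo m).measurableSet, Measure.restrict_restrict
        (hOo m).measurableSet, Set.inter_eq_left.2 (hOU m),
        ← lintegral_indicator (hOo m).measurableSet]
      refine lintegral_mono fun x => ?_
      by_cases hx : x ∈ O m
      · rw [Set.indicator_of_mem hx]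
        exact ENNReal.ofReal_le_ofReal (mul_le_of_le_one_left (hopU x (hOU m hx)) (hg1 m k x))
      · simp [hgz m k x hx]
    · refine integrable_of_bounded (c := 1 * C) ((hgc m k).measurable.mul hom) fun x => ?_
      rw [abs_mul, abs_of_nonneg (hg0 m k x)]
      exact mul_le_mul (hg1 m k x) (hC x) (abs_nonneg _) zero_le_one
  have hzero : ∀ᵐ ω ∂μ, ⨅ m, ⨆ k, Z m k ω = 0 := by
    have h1 : ∫⁻ ω, ⨅ m, ⨆ k, Z m k ω ∂μ = 0 := by
      refine le_antisymm ?_ zero_le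
      have h2 : ∀ m : ℕ, ∫⁻ ω, ⨅ m, ⨆ k, Z m k ω ∂μ ≤ ENNReal.ofReal (1 / ((m : ℝ) + 1)) := by
        intro m
        calc _ ≤ ∫⁻ ω, ⨆ k, Z m k ω ∂μ := lintegral_mono fun ω => iInf_le _ m
          _ = ⨆ k, ∫⁻ ω, Z m k ω ∂μ := lintegral_iSup (hZm m) (hZmono m)
          _ ≤ ρ (O m) := iSup_le (hZρ m)
          _ ≤ _ := hOρ m
      have h3 := ENNReal.tendsto_ofReal (tendsto_one_div_add_atTop_nhds_zero_nat (𝕜 := ℝ))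
      rw [ENNReal.ofReal_zero] at h3
      exact ge_of_tendsto' h3 h2
    exact (lintegral_eq_zero_iff (Measurable.iInf fun m => Measurable.iSup (hZm m))).1 h1
  filter_upwards [hzero] with ω hω t ht0 htN l hl hlU hl0
  by_contra hft
  have hfpos : 0 < f (ω t) := (hf0 _).lt_of_ne' hft
  -- a single jump from `G` into `{f > 0}` contributes `f (ω t)` to all the jump sums
  have hlow : ∀ m, ENNReal.ofReal (f (ω t)) ≤ ⨆ k, Z m k ω := by
    intro m
    have hlO : l ∈ O m := hGO m ⟨hlU, hl0⟩
    have hdist : 0 < Metric.infDist l (O m)ᶜ :=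
      ((hOo m).isClosed_compl.notMem_iff_infDist_pos (hOc m)).1 fun h => h hlO
    obtain ⟨k, hk⟩ := exists_nat_gt (Metric.infDist l (O m)ᶜ)⁻¹
    have hgk : g m k l = 1 := by
      simp only [g]
      refine min_eq_left ?_
      rw [inv_lt_iff_one_lt_mul₀ hdist] at hk
      linarith
    refine le_trans ?_ (le_iSup (fun k => Z m k ω) k)
    have h1 : Tendsto (fun n => ω ((leftIndex n t : ℝ≥0) / ((n : ℝ≥0) + 1))) atTop (𝓝 l) :=
      hl.comp (tendsto_leftIndex ht0)
    have h2 : Tendsto (fun n => ω (((leftIndex n t + 1 : ℕ) : ℝ≥0) / ((n : ℝ≥0) + 1))) atTop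
        (𝓝 (ω t)) := ω.tendsto_right (tendsto_leftIndex_add_one ht0)
          (Eventually.of_forall fun n => le_leftIndex_add_one n ht0)
    have h3 := ENNReal.tendsto_ofReal ((((hgc m k).tendsto l).comp h1).mul
      ((hf.1.continuous.tendsto _).comp h2))
    rw [hgk, one_mul] at h3
    rw [← h3.liminf_eq]
    refine liminf_le_liminf (Eventually.of_forall fun n => ?_)
    exact Finset.single_le_sum (f := fun i : ℕ => ENNReal.ofReal
      (g m k (ω ((i : ℝ≥0) / ((n : ℝ≥0) + 1))) *
        f (ω (((i + 1 : ℕ) : ℝ≥0) / ((n : ℝ≥0) + 1))))) (fun _ _ => zero_le)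
      (Finset.mem_range.2 (leftIndex_lt_mul ht0 htN))
  have := le_iInf hlow
  rw [hω] at this
  exact (ENNReal.ofReal_pos.2 hfpos).not_ge this

/-- Almost surely, every jump of the process belongs to the support of the Lévy measure at the
position before the jump. -/
lemma IsMartingaleSolution.ae_jump_mem_support {A : Coefficients d} {ν : Measure (E d)}
    {μ : Measure (Path d)} (hμ : IsMartingaleSolution A ν μ) :
    ∀ᵐ ω ∂μ, ∀ t : ℝ≥0, 0 < t → ∀ l, Tendsto ω.toFun (𝓝[<] t) (𝓝 l) → l ≠ ω t →
      ω t - l ∈ (A.N l).support := by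
  have key := ae_all_iff.2 fun N : ℕ => ae_all_iff.2 fun i : ℕ => ae_all_iff.2 fun k : ℕ =>
    hμ.ae_no_jump (testFun_isCb2 (d := d) i k) (testFun_nonneg i k) N
  filter_upwards [key] with ω hω t ht l hl hne
  by_contra hsupp
  obtain ⟨V, hV, hV0⟩ := Measure.notMem_support_iff_exists.1 hsupp
  obtain ⟨ε, hε, hεV⟩ := Metric.mem_nhds_iff.1 hV
  obtain ⟨i, k, hpos, hik⟩ := exists_testFun_pos (ω t) (lt_min hε (dist_pos.2 hne))
  obtain ⟨N, hN⟩ := exists_nat_ge t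
  have hlt : l ∉ tsupport (testFun i k : E d → ℝ) := by
    rw [tsupport_testFun, Metric.mem_closedBall]
    intro h
    exact absurd ((hik l h).trans_le (min_le_right _ _)) (lt_irrefl _)
  have hop : A.op (testFun i k) l = 0 := by
    rw [A.op_of_notMem_tsupport hlt]
    refine integral_eq_zero_of_ae ?_
    filter_upwards [measure_eq_zero_iff_ae_notMem.1 hV0] with y hy
    by_contra hne0
    have h1 := (testFun_pos_iff i k (l + y)).1 ((testFun_nonneg i k _).lt_of_ne' hne0)
    have h2 := (hik _ h1.le).trans_le (min_le_left _ _)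
    refine hy (hεV ?_)
    rw [dist_eq_norm] at h2
    rwa [Metric.mem_ball, dist_eq_norm, show y - (ω t - l) = l + y - ω t by abel]
  exact hpos.ne' (hω N i k t ht hN l hl hlt hop)

/-- The process leaves `D` into the extended boundary of `D`. -/
lemma IsRegularPath.mem_extDomain {A : Coefficients d} {D : Set (E d)} (hD : IsOpen D)
    {ω : Path d} (hω : IsRegularPath D ω)
    (hj : ∀ t : ℝ≥0, 0 < t → ∀ l, Tendsto ω.toFun (𝓝[<] t) (𝓝 l) → l ≠ ω t →
      ω t - l ∈ (A.N l).support)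
    {t : ℝ≥0} (ht : exitTime D ω = t) : ω t ∈ A.extDomain D := by
  have ht0 : 0 < t := by have := hω.pos; rw [ht] at this; exact ENNReal.coe_pos.1 this
  have hnot := hω.notMem t ht
  obtain ⟨l, hl⟩ := ω.left_lim t
  have hNe : (𝓝[<] t).NeBot := nhdsLT_neBot_of_exists_lt ⟨0, ht0⟩
  have hcl : l ∈ closure D := by
    refine mem_closure_of_tendsto hl ?_
    filter_upwards [Ioo_mem_nhdsLT ht0] with s hs
    by_contra hsD
    have h1 : exitTime D ω ≤ s := iInf₂_le s ⟨hs.1, hsD⟩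
    rw [ht, ENNReal.coe_le_coe] at h1
    exact absurd hs.2 h1.not_gt
  refine Or.inr ?_
  by_cases hlD : l ∈ D
  · refine Or.inr ⟨⟨l, hlD, ω t - l, hj t ht0 l hl fun h => hnot (h ▸ hlD), by abel⟩, hnot⟩
  · refine Or.inl ?_
    rw [← hω.eq_left t ht l hl hlD, hD.frontier_eq]
    exact ⟨hcl, hlD⟩

/-! ### The killed process -/

/-- The properties of the process and of its exit from `D` on which the rest of the argument
relies. -/
structure RegularExit (A : Coefficients d) (P : Kernel (E d) (Path d)) (D : Set (E d)) : Prop where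
  isOpen : IsOpen D
  compl_nonempty : Dᶜ.Nonempty
  isMarkov : IsMarkovKernel P
  strongMarkov : IsStronglyMarkov P
  regular : ∀ x ∈ D, ∀ᵐ ω ∂(P x), IsRegularPath D ω
  start : ∀ x, ∀ᵐ ω ∂(P x), ω 0 = x
  exit_mem : ∀ x ∈ D, ∀ᵐ ω ∂(P x), ∀ t : ℝ≥0, exitTime D ω = t → ω t ∈ A.extDomain D

/-- Finiteness of the exit time is used only to exclude that `D` is the whole space. -/
lemma IsStrongMarkovSolution.regularExit {A : Coefficients d} {P : Kernel (E d) (Path d)}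
    (hP : IsStrongMarkovSolution A P) {D : Set (E d)} (hD : IsOpen D) (hne : D.Nonempty)
    (hET : ExitFinite P D) : RegularExit A P D := by
  have hM : IsMarkovKernel P := ⟨fun x => (hP.solution x).isProb⟩
  have hDc : Dᶜ.Nonempty := by
    obtain ⟨x, hx⟩ := hne
    obtain ⟨ω, hω⟩ := (hET x hx).exists
    simp only [exitTime, iInf_lt_iff] at hω
    obtain ⟨t, ht, -⟩ := hω
    exact ⟨ω t, ht.2⟩
  have hreg : ∀ x ∈ D, ∀ᵐ ω ∂(P x), IsRegularPath D ω := fun x hx =>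
    (hP.solution x).ae_isRegularPath hD hDc hx
  refine ⟨hD, hDc, hM, hP.strongMarkov, hreg, fun x => (hP.solution x).ae_start, fun x hx => ?_⟩
  filter_upwards [hreg x hx, (hP.solution x).ae_jump_mem_support] with ω h1 h2 t ht
  exact h1.mem_extDomain hD h2 ht

lemma measurable_ext {D : Set (E d)} (hD : MeasurableSet D) {f : D → ℝ} (hf : Measurable f) :
    Measurable (ext f) :=
  (MeasurableEmbedding.subtype_coe hD).measurable_extend (g' := (0 : E d → ℝ)) hf measurable_const

lemma ext_of_mem {D : Set (E d)} (f : D → ℝ) {x : E d} (hx : x ∈ D) : ext f x = f ⟨x, hx⟩ :=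
  Subtype.val_injective.extend_apply f (0 : E d → ℝ) ⟨x, hx⟩

lemma ext_coe {D : Set (E d)} (f : D → ℝ) (x : D) : ext f x = f x :=
  Subtype.val_injective.extend_apply f (0 : E d → ℝ) x

lemma ext_of_notMem {D : Set (E d)} (f : D → ℝ) {x : E d} (hx : x ∉ D) : ext f x = 0 :=
  Function.extend_apply' f (0 : E d → ℝ) x fun ⟨y, hy⟩ => hx (hy ▸ y.2)

lemma abs_ext_le {D : Set (E d)} {f : D → ℝ} {C : ℝ} (hC0 : 0 ≤ C) (hC : ∀ x, |f x| ≤ C)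
    (x : E d) : |ext f x| ≤ C := by
  by_cases hx : x ∈ D
  · rw [ext_of_mem f hx]; exact hC _
  · rw [ext_of_notMem f hx]; simpa using hC0

/-- The event that the path has not left `D` by time `t`, in its Borel version. -/
def alive (D : Set (E d)) (t : ℝ≥0) : Set (Path d) := {ω | (t : ℝ≥0∞) < exitLimit D ω}

lemma mem_alive {D : Set (E d)} {t : ℝ≥0} {ω : Path d} :
    ω ∈ alive D t ↔ (t : ℝ≥0∞) < exitLimit D ω := Iff.rfl

lemma measurableSet_alive (D : Set (E d)) (t : ℝ≥0) :
    MeasurableSet (alive D t) :=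
  measurableSet_lt measurable_const (measurable_exitLimit D)

/-- The transition function `(t, x) ↦ P_x(X_t ∈ ·, t < τ_D)` of the process killed upon leaving
`D`, with the exit time replaced by its Borel version. -/
noncomputable def killed (P : Kernel (E d) (Path d)) [IsMarkovKernel P] {D : Set (E d)}
    (hD : IsOpen D) : Kernel (ℝ≥0 × D) D where
  toFun p := (((P p.2).restrict (alive D p.1)).map
    fun ω => ω p.1).comap Subtype.val
  measurable' := by
    have he := MeasurableEmbedding.subtype_coe hD.measurableSet
    refine Measure.measurable_of_measurable_coe _ fun B hB => ?_
    have hB' := he.measurableSet_image.2 hB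
    have h1 : ∀ p : ℝ≥0 × D, (((P p.2).restrict (alive D p.1)).map
        fun ω => ω p.1).comap Subtype.val B =
        (P.comap (fun p : ℝ≥0 × D => (p.2 : E d)) (by fun_prop)) p
          (Prod.mk p ⁻¹' {q : (ℝ≥0 × D) × Path d | q.2 q.1.1 ∈ Subtype.val '' B ∧
            (q.1.1 : ℝ≥0∞) < exitLimit D q.2}) := by
      intro p
      rw [he.comap_apply, Measure.map_apply (Path.measurable_eval _) hB',
        Measure.restrict_apply (Path.measurable_eval _ hB'), Kernel.comap_apply]
      rfl
    simp_rw [h1]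
    refine Kernel.measurable_kernel_prodMk_left ?_
    refine MeasurableSet.inter ?_ ?_
    · exact (Path.measurable_eval_comp measurable_fst.fst measurable_snd) hB'
    · exact measurableSet_lt measurable_fst.fst.coe_nnreal_ennreal
        ((measurable_exitLimit D).comp measurable_snd)

section
variable {A : Coefficients d} {P : Kernel (E d) (Path d)} [IsMarkovKernel P] {D : Set (E d)}

lemma killed_apply (hD : IsOpen D) (t : ℝ≥0) (x : D) : killed P hD (t, x) =
    (((P x).restrict (alive D t)).map fun ω => ω t).comap Subtype.val := rfl

lemma map_killed (h : RegularExit A P D) (t : ℝ≥0) (x : D) :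
    (killed P h.isOpen (t, x)).map Subtype.val =
      ((P x).restrict (alive D t)).map fun ω => ω t := by
  rw [killed_apply, (MeasurableEmbedding.subtype_coe h.isOpen.measurableSet).map_comap,
    Subtype.range_coe, Measure.restrict_eq_self_of_ae_mem]
  refine (ae_map_iff (p := fun y => y ∈ D) (Path.measurable_eval t).aemeasurable
    h.isOpen.measurableSet).2 ((ae_restrict_iff' (measurableSet_alive D t)).2 ?_)
  filter_upwards [h.regular x x.2] with ω hω ht
  by_contra hnot
  rcases eq_or_ne t 0 with rfl | h0
  · exact hnot hω.start
  · have h1 : exitTime D ω ≤ t := iInf₂_le t ⟨pos_iff_ne_zero.2 h0, hnot⟩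
    rw [hω.exit_eq] at h1
    exact absurd (mem_alive.1 ht) h1.not_gt

instance (hD : IsOpen D) (p : ℝ≥0 × D) : IsFiniteMeasure (killed P hD p) :=
  ⟨by
    change (killed P hD (p.1, p.2)) Set.univ < ⊤
    rw [killed_apply, (MeasurableEmbedding.subtype_coe hD.measurableSet).comap_apply]
    exact measure_lt_top _ _⟩

lemma killed_le_one (h : RegularExit A P D) (p : ℝ≥0 × D) : killed P h.isOpen p Set.univ ≤ 1 := by
  have h1 : (killed P h.isOpen p).map Subtype.val Set.univ =
      ((P p.2).restrict (alive D p.1)).map (fun ω => ω p.1) Set.univ := by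
    rw [← map_killed h p.1 p.2]
  rw [Measure.map_apply measurable_subtype_coe MeasurableSet.univ, Set.preimage_univ,
    Measure.map_apply (Path.measurable_eval _) MeasurableSet.univ] at h1
  rw [h1]
  exact (Measure.restrict_apply_le _ _).trans prob_le_one

lemma isFiniteKernel_killed (h : RegularExit A P D) : IsFiniteKernel (killed P h.isOpen) :=
  ⟨⟨1, ENNReal.one_lt_top, killed_le_one h⟩⟩

lemma lintegral_killed (h : RegularExit A P D) (t : ℝ≥0) (x : D) {F : E d → ℝ≥0∞}
    (hF : Measurable F) : ∫⁻ y, F y ∂(killed P h.isOpen (t, x)) =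
      ∫⁻ ω in alive D t, F (ω t) ∂(P x) := by
  rw [← lintegral_map hF measurable_subtype_coe, map_killed h,
    lintegral_map hF (Path.measurable_eval t)]

omit [IsMarkovKernel P] in
lemma lt_exitTime_ae_eq (h : RegularExit A P D) (t : ℝ≥0) {x : E d} (hx : x ∈ D) :
    {ω | (t : ℝ≥0∞) < exitTime D ω} =ᵐ[P x] alive D t := by
  refine Filter.eventuallyEq_set.2 ?_
  filter_upwards [h.regular x hx] with ω hω
  rw [mem_alive, ← hω.exit_eq]

/-- The semigroup is given by the transition function of the killed process. -/
lemma semigroup_eq (h : RegularExit A P D) (t : ℝ≥0) {f : D → ℝ} (hf : Measurable f) (x : D) :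
    semigroup P D t f x = ∫ y, f y ∂(killed P h.isOpen (t, x)) := by
  have hm := measurable_ext h.isOpen.measurableSet hf
  rw [semigroup, setIntegral_congr_set (lt_exitTime_ae_eq h t x.2)]
  simp_rw [← ext_coe f]
  rw [← integral_map (φ := fun y : D => (y : E d)) measurable_subtype_coe.aemeasurable
    hm.aestronglyMeasurable, map_killed h, integral_map (Path.measurable_eval t).aemeasurable
    hm.aestronglyMeasurable]

/-! ### The Markov property of the killed process -/

lemma IsRegularPath.mem_of_lt {ω : Path d} (hω : IsRegularPath D ω) {t : ℝ≥0}
    (ht : (t : ℝ≥0∞) < exitTime D ω) : ω t ∈ D := by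
  by_contra hnot
  rcases eq_or_ne t 0 with rfl | h0
  · exact hnot hω.start
  · have h1 : exitTime D ω ≤ t := iInf₂_le t ⟨pos_iff_ne_zero.2 h0, hnot⟩
    exact absurd ht h1.not_gt

/-- Before the exit from `D`, the Borel version of the exit time is additive under the shift. -/
lemma IsRegularPath.exitLimit_shift {ω : Path d} (hω : IsRegularPath D ω) {t : ℝ≥0}
    (ht : (t : ℝ≥0∞) < exitTime D ω) :
    t + exitLimit D (Path.shift t ω) = exitLimit D ω := by
  refine le_antisymm ?_ ?_
  · by_cases hf : exitLimit D ω = ⊤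
    · rw [hf]; exact le_top
    have hs := (ENNReal.coe_toNNReal hf).symm
    set s := (exitLimit D ω).toNNReal
    have hs' : exitTime D ω = s := hω.exit_eq.trans hs
    have hts : t < s := by rw [hs'] at ht; exact ENNReal.coe_lt_coe.1 ht
    have h1 : exitLimit D (Path.shift t ω) ≤ (s - t : ℝ≥0) := by
      refine iSup_le fun n => iInf₂_le (s - t) ?_
      have h2 : Path.shift t ω (s - t) = ω s := by
        change ω (t + (s - t)) = ω s
        rw [add_tsub_cancel_of_le hts.le]
      rw [h2, Metric.infDist_zero_of_mem (Set.mem_compl (hω.notMem s hs'))]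
      positivity
    rw [hs]
    calc _ ≤ (t : ℝ≥0∞) + (s - t : ℝ≥0) := by gcongr
      _ = s := by rw [← ENNReal.coe_add, add_tsub_cancel_of_le hts.le]
  · refine iSup_le fun n => ?_
    calc nearTime D n ω ≤ t + nearTime D n (Path.shift t ω) := by
          rw [nearTime, nearTime, ENNReal.add_iInf]
          refine le_iInf fun r => ?_
          by_cases hr : Metric.infDist (Path.shift t ω r) Dᶜ < 1 / ((n : ℝ) + 1)
          · simp only [hr, iInf_pos]
            exact iInf₂_le (t + r) hr
          · simp only [hr]; simp
      _ ≤ _ := by gcongr; exact le_iSup (fun n => nearTime D n (Path.shift t ω)) n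

omit [IsMarkovKernel P] in
/-- The Markov property at a deterministic time. -/
lemma markov_const (h : RegularExit A P D) (x : E d) (t : ℝ≥0) {B C : Set (Path d)}
    (hB : MeasurableSet[Path.filtration d t] B) (hC : MeasurableSet C) :
    P x (B ∩ {ω | Path.shift t ω ∈ C}) = ∫⁻ ω in B, P (ω t) C ∂(P x) := by
  have hτ := isStoppingTime_const (Path.filtration d) t
  have hB' : MeasurableSet[hτ.measurableSpace] B := by
    rw [IsStoppingTime.measurableSpace_const]; exact hB
  have e1 : B ∩ {_ω : Path d | (t : WithTop ℝ≥0) ≠ ⊤} = B := by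
    ext ω; exact ⟨And.left, fun h => ⟨h, WithTop.coe_ne_top⟩⟩
  have e2 : B ∩ {ω : Path d | Path.shift t ω ∈ C} =
      B ∩ {ω : Path d | (t : WithTop ℝ≥0) ≠ ⊤ ∧ Path.shift t ω ∈ C} := by
    ext ω; exact ⟨fun h => ⟨h.1, WithTop.coe_ne_top, h.2⟩, fun h => ⟨h.1, h.2.2⟩⟩
  have e3 := h.strongMarkov x _ hτ B hB' C hC
  rw [e1] at e3
  rw [e2]
  exact e3

/-- The Chapman–Kolmogorov equation for the killed process. -/
lemma killed_add (h : RegularExit A P D) (t s : ℝ≥0) (x : D) {B : Set D} (hB : MeasurableSet B) :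
    killed P h.isOpen (t + s, x) B =
      ∫⁻ y, killed P h.isOpen (s, y) B ∂(killed P h.isOpen (t, x)) := by
  have he := MeasurableEmbedding.subtype_coe h.isOpen.measurableSet
  have hB' := he.measurableSet_image.2 hB
  have happ : ∀ (r : ℝ≥0) (y : D), killed P h.isOpen (r, y) B =
      P y ({ω | ω r ∈ Subtype.val '' B} ∩ alive D r) := by
    intro r y
    rw [killed_apply, he.comap_apply, Measure.map_apply (Path.measurable_eval _) hB',
        Measure.restrict_apply (Path.measurable_eval _ hB')]
    rfl
  have hCm : MeasurableSet ({ω : Path d | ω s ∈ Subtype.val '' B} ∩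
      alive D s) :=
    (Path.measurable_eval s hB').inter (measurableSet_alive D s)
  simp_rw [happ s]
  rw [lintegral_killed h t x (F := fun y => P y ({ω | ω s ∈ Subtype.val '' B} ∩
    alive D s)) (P.measurable_coe hCm)]
  -- `{t < τ_D}` agrees up to a null set with an event of `F_t`
  have hB0 : MeasurableSet[Path.filtration d t] ({ω | exitLimit D ω < t}ᶜ ∩ {ω | ω t ∈ D}) :=
    (measurableSet_exitLimit_lt D t).compl.inter
      (measurable_eval_filtration le_rfl h.isOpen.measurableSet)
  have hB0' : ∀ᵐ ω ∂(P x), ω ∈ {ω | exitLimit D ω < t}ᶜ ∩ {ω : Path d | ω t ∈ D} ↔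
      ω ∈ alive D t := by
    filter_upwards [h.regular x x.2] with ω hω
    simp only [mem_alive, Set.mem_inter_iff, Set.mem_compl_iff, Set.mem_ofPred_eq, not_lt]
    constructor
    · rintro ⟨h1, h2⟩
      refine h1.lt_of_ne fun h3 => hω.notMem t ?_ h2
      rw [hω.exit_eq, h3]
    · intro h1
      exact ⟨h1.le, hω.mem_of_lt (hω.exit_eq ▸ h1)⟩
  rw [happ, ← setLIntegral_congr (Filter.eventuallyEq_set.2 hB0'), ← markov_const h x t hB0 hCm]
  refine measure_congr (Filter.eventuallyEq_set.2 ?_)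
  filter_upwards [h.regular x x.2, hB0'] with ω hω hiff
  rw [Set.mem_inter_iff ω ({ω | exitLimit D ω < t}ᶜ ∩ {ω : Path d | ω t ∈ D}), hiff]
  have hsh : Path.shift t ω s = ω (t + s) := rfl
  simp only [Set.mem_inter_iff, Set.mem_ofPred_eq, hsh, mem_alive]
  constructor
  · rintro ⟨h1, h2⟩
    have h3 : (t : ℝ≥0∞) < exitLimit D ω := lt_of_le_of_lt (by push_cast; exact le_self_add) h2
    refine ⟨h3, h1, ?_⟩
    rw [← hω.exitLimit_shift (hω.exit_eq ▸ h3), ENNReal.coe_add] at h2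
    exact (ENNReal.add_lt_add_iff_left ENNReal.coe_ne_top).1 h2
  · rintro ⟨h1, h2, h3⟩
    refine ⟨h2, ?_⟩
    rw [← hω.exitLimit_shift (hω.exit_eq ▸ h1), ENNReal.coe_add]
    exact (ENNReal.add_lt_add_iff_left ENNReal.coe_ne_top).2 h3

lemma lintegral_killed_add (h : RegularExit A P D) (t s : ℝ≥0) (x : D) {F : D → ℝ≥0∞}
    (hF : Measurable F) : ∫⁻ y, F y ∂(killed P h.isOpen (t + s, x)) =
      ∫⁻ y, ∫⁻ z, F z ∂(killed P h.isOpen (s, y)) ∂(killed P h.isOpen (t, x)) := by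
  have hm : Measurable fun y : D => killed P h.isOpen (s, y) :=
    (killed P h.isOpen).measurable.comp measurable_prodMk_left
  have : killed P h.isOpen (t + s, x) =
      (killed P h.isOpen (t, x)).bind fun y => killed P h.isOpen (s, y) := by
    ext B hB
    rw [Measure.bind_apply hB hm.aemeasurable]
    exact killed_add h t s x hB
  rw [this, Measure.lintegral_bind hm.aemeasurable hF.aemeasurable]

/-! ### Subsolutions and the killed process -/

lemma discount_nonneg (c : D → ℝ) (t : ℝ≥0) (ω : Path d) : 0 ≤ discount c t ω := (Real.exp_pos _).le

lemma coe_exitMin (t : ℝ≥0) (ω : Path d) :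
    ((exitMin D t ω : ℝ≥0) : ℝ≥0∞) = min (exitTime D ω) t :=
  ENNReal.coe_toNNReal ((min_le_right _ _).trans_lt ENNReal.coe_lt_top).ne

lemma exitMin_of_lt {t : ℝ≥0} {ω : Path d} (h : (t : ℝ≥0∞) < exitTime D ω) :
    exitMin D t ω = t := by
  rw [← ENNReal.coe_inj, coe_exitMin, min_eq_right h.le]

lemma exitTime_eq_exitMin {t : ℝ≥0} {ω : Path d} (h : exitTime D ω ≤ t) :
    exitTime D ω = exitMin D t ω := by
  rw [coe_exitMin, min_eq_left h]

/-- Extending a non-negative function `v` with `e^{-nt} P^D_t v ≤ v` by zero and changing the sign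
produces a weak subsolution for the constant potential `n`. -/
lemma isWeakSubsolution_neg_ext (h : RegularExit A P D) {v : D → ℝ} (hv : Measurable v)
    (hv0 : ∀ x, 0 ≤ v x) {C : ℝ} (hC : ∀ x, v x ≤ C) {n : ℝ}
    (hsup : ∀ (t : ℝ≥0) (x : D), Real.exp (-n * t) * ∫ y, v y ∂(killed P h.isOpen (t, x)) ≤ v x) :
    IsWeakSubsolution P D (fun _ : D => n) fun x => -ext v x := by
  have hm := measurable_ext h.isOpen.measurableSet hv
  refine ⟨hm.neg, ⟨|C|, fun x => ?_⟩, fun x hx t => ?_⟩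
  · rw [abs_neg]
    refine abs_ext_le (abs_nonneg C) (fun y => ?_) x
    rw [abs_of_nonneg (hv0 y)]
    exact (hC y).trans (le_abs_self C)
  · have h1 : ∫ ω, discount (fun _ : D => n) (exitMin D t ω) ω * -ext v (ω (exitMin D t ω)) ∂(P x)
        = ∫ ω, (alive D t).indicator
          (fun ω => -(Real.exp (-n * t) * ext v (ω t))) ω ∂(P x) := by
      refine integral_congr_ae ?_
      filter_upwards [h.regular x hx] with ω hω
      by_cases ht : (t : ℝ≥0∞) < exitTime D ω
      · rw [Set.indicator_of_mem (mem_alive.2 (hω.exit_eq ▸ ht)), exitMin_of_lt ht]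
        have h2 : discount (fun _ : D => n) t ω = Real.exp (-n * t) := by
          rw [discount]
          congr 1
          have h3 : ∫ r in (0 : ℝ)..t, ext (fun _ : D => n) (ω r.toNNReal)
              = ∫ _r in (0 : ℝ)..t, n := by
            refine intervalIntegral.integral_congr_ae (ae_of_all _ fun r hr => ?_)
            rw [Set.uIoc_of_le (NNReal.coe_nonneg t)] at hr
            refine ext_of_mem _ (hω.mem_of_lt (lt_of_le_of_lt ?_ ht))
            exact ENNReal.coe_le_coe.2 (Real.toNNReal_le_iff_le_coe.2 hr.2)
          rw [h3]; simp; ring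
        rw [h2]; ring
      · have h2 := exitTime_eq_exitMin (not_lt.1 ht)
        rw [Set.indicator_of_notMem fun h3 : ω ∈ alive D t => ht (hω.exit_eq ▸ mem_alive.1 h3),
          ext_of_notMem v (hω.notMem _ h2)]
        simp
    rw [h1, integral_indicator (measurableSet_alive D t), integral_neg,
      integral_const_mul, ext_of_mem v hx, neg_le_neg_iff]
    refine le_trans (le_of_eq ?_) (hsup t ⟨x, hx⟩)
    congr 1
    rw [← semigroup_eq h t hv, semigroup, setIntegral_congr_set (lt_exitTime_ae_eq h t hx)]

/-- If `u` is a weak subsolution for a potential bounded by `C` and `u ≤ M` on `D ∪ ∂_S D` with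
`M ≥ 0`, then `v = M - u` satisfies `e^{-Ct} P^D_t v ≤ v`. -/
lemma IsWeakSubsolution.exp_mul_le (h : RegularExit A P D) {c : D → ℝ} (hc : IsAdmissible c)
    {C : ℝ} (hC : ∀ x, c x ≤ C) {u : E d → ℝ} (hu : IsWeakSubsolution P D c u) {M : ℝ}
    (hM0 : 0 ≤ M) (hM : ∀ x ∈ A.extDomain D, u x ≤ M) (t : ℝ≥0) (x : D) :
    Real.exp (-C * t) * ∫ y, (M - u y) ∂(killed P h.isOpen (t, x)) ≤ M - u x := by
  obtain ⟨Cu, hCu⟩ := hu.bounded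
  have hC0 : 0 ≤ C := (hc.nonneg x).trans (hC x)
  have hcm := measurable_ext h.isOpen.measurableSet hc.measurable
  have hc0 : ∀ y, 0 ≤ ext c y := fun y => by
    by_cases hy : y ∈ D
    · rw [ext_of_mem c hy]; exact hc.nonneg _
    · rw [ext_of_notMem c hy]
  have hcC : ∀ y, |ext c y| ≤ C := abs_ext_le hC0 fun y => by
    rw [abs_of_nonneg (hc.nonneg y)]; exact hC y
  have hd1 : ∀ (s : ℝ≥0) (ω : Path d), discount c s ω ≤ 1 := fun s ω => by
    refine Real.exp_le_one_iff.2 (neg_nonpos.2 ?_)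
    exact intervalIntegral.integral_nonneg (NNReal.coe_nonneg s) fun r _ => hc0 _
  have hd2 : ∀ ω : Path d, Real.exp (-C * t) ≤ discount c t ω := fun ω => by
    refine Real.exp_le_exp.2 ?_
    rw [neg_mul, neg_le_neg_iff]
    refine (le_abs_self _).trans ((abs_integral_path_le hcC ω (NNReal.coe_nonneg t)).trans ?_)
    simp
  -- a measurable version of the discounted value at the exit
  let σ : Path d → ℝ≥0 := fun ω => (min (exitLimit D ω) t).toNNReal
  have hσm : Measurable σ := ((measurable_exitLimit D).min measurable_const).ennreal_toNNReal
  have hσ : ∀ ω, IsRegularPath D ω → exitMin D t ω = σ ω := fun ω hω => by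
    simp only [exitMin, σ, hω.exit_eq]
  have hYint : Integrable (fun ω => discount c (σ ω) ω * u (ω (σ ω))) (P x) := by
    refine integrable_of_bounded (c := 1 * Cu) ?_ fun ω => ?_
    · refine Measurable.mul ?_ (hu.measurable.comp (Path.measurable_eval_comp hσm measurable_id))
      exact (((measurable_additive hcm).comp (hσm.prodMk measurable_id)).neg).exp
    · rw [abs_mul, abs_of_nonneg (discount_nonneg _ _ _)]
      exact mul_le_mul (hd1 _ _) (hCu _) (abs_nonneg _) zero_le_one
  have hint2 : Integrable (fun ω => (alive D t).indicator
      (fun ω => Real.exp (-C * t) * (M - u (ω t))) ω) (P x) := by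
    refine Integrable.indicator ?_ (measurableSet_alive D t)
    refine (integrable_of_bounded (c := M + Cu) (measurable_const.sub (hu.measurable.comp
      (Path.measurable_eval t))) fun ω => ?_).const_mul _
    refine (abs_sub _ _).trans (add_le_add (abs_of_nonneg hM0).le (hCu _))
  have h1 : u x ≤ ∫ ω, (M - (alive D t).indicator
      (fun ω => Real.exp (-C * t) * (M - u (ω t))) ω) ∂(P x) := by
    refine (hu.le x x.2 t).trans ?_
    have h2 : ∫ ω, discount c (exitMin D t ω) ω * u (ω (exitMin D t ω)) ∂(P x) =
        ∫ ω, discount c (σ ω) ω * u (ω (σ ω)) ∂(P x) := by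
      refine integral_congr_ae ?_
      filter_upwards [h.regular x x.2] with ω hω
      simp only [hσ ω hω]
    rw [h2]
    refine integral_mono_ae hYint ((integrable_const M).sub hint2) ?_
    filter_upwards [h.regular x x.2, h.exit_mem x x.2] with ω hω hexit
    rw [← hσ ω hω]
    by_cases ht : (t : ℝ≥0∞) < exitTime D ω
    · rw [Set.indicator_of_mem (mem_alive.2 (hω.exit_eq ▸ ht)), exitMin_of_lt ht]
      have h3 := hM (ω t) (Or.inl (hω.mem_of_lt ht))
      nlinarith [mul_nonneg (sub_nonneg.2 (hd2 ω)) (sub_nonneg.2 h3),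
        mul_nonneg (sub_nonneg.2 (hd1 t ω)) hM0]
    · have h2 := exitTime_eq_exitMin (not_lt.1 ht)
      rw [Set.indicator_of_notMem fun h3 : ω ∈ alive D t => ht (hω.exit_eq ▸ mem_alive.1 h3),
        sub_zero]
      have h3 := hM _ (hexit _ h2)
      nlinarith [mul_nonneg (sub_nonneg.2 (hd1 (exitMin D t ω) ω)) hM0,
        mul_nonneg (discount_nonneg c (exitMin D t ω) ω) (sub_nonneg.2 h3)]
  rw [integral_sub (integrable_const M) hint2, integral_indicator (measurableSet_alive D t),
    integral_const_mul] at h1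
  have h4 : ∫ y, (M - u y) ∂(killed P h.isOpen (t, x)) =
      ∫ ω in alive D t, (M - u (ω t)) ∂(P x) := by
    have hm : Measurable fun y => M - u y := measurable_const.sub hu.measurable
    rw [← integral_map (φ := fun y : D => (y : E d)) (f := fun y => M - u y)
      measurable_subtype_coe.aemeasurable hm.aestronglyMeasurable, map_killed h,
      integral_map (Path.measurable_eval t).aemeasurable hm.aestronglyMeasurable]
  rw [h4]
  simp at h1
  simp
  linarith

end

/-! ### Potentials of a sub-Markovian transition function -/

section
variable {S : Type*} [MeasurableSpace S] (κ : Kernel (ℝ≥0 × S) S)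

/-- The `β`-potential `∫_0^∞ e^{-βt} κ_t F dt` of a non-negative function. -/
noncomputable def potential (β : ℝ) (F : S → ℝ≥0∞) (x : S) : ℝ≥0∞ :=
  ∫⁻ t in Set.Ioi (0 : ℝ), ENNReal.ofReal (Real.exp (-β * t)) * ∫⁻ y, F y ∂κ (t.toNNReal, x)

variable {κ}

lemma measurable_lintegral_kernel {F : S → ℝ≥0∞} (hF : Measurable F) :
    Measurable fun p : S × ℝ => ∫⁻ y, F y ∂κ (p.2.toNNReal, p.1) :=
  hF.lintegral_kernel.comp (measurable_snd.real_toNNReal.prodMk measurable_fst)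

lemma measurable_potential (β : ℝ) {F : S → ℝ≥0∞} (hF : Measurable F) :
    Measurable (potential κ β F) := by
  refine Measurable.lintegral_prod_right' (f := fun p : S × ℝ =>
    ENNReal.ofReal (Real.exp (-β * p.2)) * ∫⁻ y, F y ∂κ (p.2.toNNReal, p.1)) ?_
  exact (Measurable.ennreal_ofReal (by fun_prop)).mul (measurable_lintegral_kernel hF)

lemma measurable_integral_kernel {f : S → ℝ} (hf : Measurable f) (x : S) :
    Measurable fun t : ℝ => ∫ y, f y ∂κ (t.toNNReal, x) :=
  (hf.stronglyMeasurable.integral_kernel (κ := κ)).measurable.comp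
    (measurable_real_toNNReal.prodMk measurable_const)

variable [IsFiniteKernel κ]

lemma abs_integral_kernel_le (h1 : ∀ p, κ p Set.univ ≤ 1) {f : S → ℝ} {M : ℝ} (hM : ∀ x, |f x| ≤ M)
    (p : ℝ≥0 × S) : |∫ y, f y ∂κ p| ≤ M := by
  have hM0 : 0 ≤ M := (abs_nonneg _).trans (hM p.2)
  refine (norm_integral_le_of_norm_le_const (f := f) (C := M) (μ := κ p)
    (ae_of_all _ fun y => by simpa using hM y)).trans ?_
  refine mul_le_of_le_one_right hM0 ?_
  exact ENNReal.toReal_le_of_le_ofReal zero_le_one (by simpa using h1 p)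

lemma integrableOn_exp_mul {β : ℝ} (hβ : 0 < β) {q : ℝ → ℝ} (hq : Measurable q) {M : ℝ}
    (hM : ∀ t, |q t| ≤ M) :
    IntegrableOn (fun t => Real.exp (-β * t) * q t) (Set.Ioi 0) :=
  (integrableOn_exp_mul_Ioi (neg_lt_zero.2 hβ) 0).mul_bdd (c := M) hq.aestronglyMeasurable
    (ae_of_all _ fun t => by simpa using hM t)

/-- For bounded non-negative functions the potential is the integral of the transition function. -/
lemma ofReal_potential (h1 : ∀ p, κ p Set.univ ≤ 1) {β : ℝ} (hβ : 0 < β) {f : S → ℝ}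
    (hf : Measurable f) (hf0 : ∀ x, 0 ≤ f x) {M : ℝ} (hM : ∀ x, f x ≤ M) (x : S) :
    ENNReal.ofReal (∫ t in Set.Ioi (0 : ℝ), Real.exp (-β * t) * ∫ y, f y ∂κ (t.toNNReal, x)) =
      potential κ β (fun y => ENNReal.ofReal (f y)) x := by
  have hM' : ∀ x, |f x| ≤ M := fun x => by rw [abs_of_nonneg (hf0 x)]; exact hM x
  rw [ofReal_integral_eq_lintegral_ofReal, potential]
  · refine lintegral_congr fun t => ?_
    rw [ENNReal.ofReal_mul (Real.exp_pos _).le,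
      ofReal_integral_eq_lintegral_ofReal (integrable_of_bounded hf hM') (ae_of_all _ hf0)]
  · exact integrableOn_exp_mul hβ (measurable_integral_kernel hf x)
      fun t => abs_integral_kernel_le h1 hM' _
  · exact ae_of_all _ fun t => mul_nonneg (Real.exp_pos _).le (integral_nonneg hf0)

/-- Potentials are supermedian. -/
lemma exp_mul_lintegral_potential_le
    (hadd : ∀ (t s : ℝ≥0) (x : S) {F : S → ℝ≥0∞}, Measurable F →
      ∫⁻ y, F y ∂κ (t + s, x) = ∫⁻ y, ∫⁻ z, F z ∂κ (s, y) ∂κ (t, x))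
    (β : ℝ) {F : S → ℝ≥0∞} (hF : Measurable F) (t : ℝ≥0) (x : S) :
    ENNReal.ofReal (Real.exp (-β * t)) * ∫⁻ y, potential κ β F y ∂κ (t, x) ≤ potential κ β F x := by
  let H : ℝ → ℝ≥0∞ := fun s => ENNReal.ofReal (Real.exp (-β * s)) * ∫⁻ z, F z ∂κ (s.toNNReal, x)
  have h1 : ENNReal.ofReal (Real.exp (-β * t)) * ∫⁻ y, potential κ β F y ∂κ (t, x) =
      ∫⁻ s in Set.Ioi (0 : ℝ), H (s + t) := by
    simp only [potential]
    rw [lintegral_lintegral_swap, ← lintegral_const_mul]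
    · refine setLIntegral_congr_fun measurableSet_Ioi fun s hs => ?_
      have hs' : (0 : ℝ) ≤ s := (Set.mem_Ioi.1 hs).le
      simp only [H]
      rw [lintegral_const_mul, ← mul_assoc, ← ENNReal.ofReal_mul (Real.exp_pos _).le,
        ← Real.exp_add, ← hadd t s.toNNReal x hF]
      · have e1 : -β * t + -β * s = -β * (s + t) := by ring
        have e2 : t + s.toNNReal = (s + t).toNNReal := by
          rw [Real.toNNReal_add hs' (NNReal.coe_nonneg t), Real.toNNReal_coe, add_comm]
        rw [e1, e2]
      · exact hF.lintegral_kernel.comp measurable_prodMk_left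
    · refine Measurable.lintegral_prod_left' (f := fun p : S × ℝ =>
        ENNReal.ofReal (Real.exp (-β * p.2)) * ∫⁻ y, F y ∂κ (p.2.toNNReal, p.1)) ?_
      exact (Measurable.ennreal_ofReal (by fun_prop)).mul (measurable_lintegral_kernel hF)
    · refine Measurable.aemeasurable (f := fun p : S × ℝ =>
        ENNReal.ofReal (Real.exp (-β * p.2)) * ∫⁻ y, F y ∂κ (p.2.toNNReal, p.1)) ?_
      exact (Measurable.ennreal_ofReal (by fun_prop)).mul (measurable_lintegral_kernel hF)
  rw [h1, potential, ← lintegral_indicator measurableSet_Ioi,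
    ← lintegral_indicator measurableSet_Ioi,
    ← lintegral_add_right_eq_self (μ := volume) ((Set.Ioi (0 : ℝ)).indicator H) (t : ℝ)]
  refine lintegral_mono fun s => ?_
  by_cases hs : s ∈ Set.Ioi (0 : ℝ)
  · have hs' : s + t ∈ Set.Ioi (0 : ℝ) := add_pos_of_pos_of_nonneg hs (NNReal.coe_nonneg t)
    rw [Set.indicator_of_mem hs, Set.indicator_of_mem hs']
  · rw [Set.indicator_of_notMem hs]; exact zero_le

omit [IsFiniteKernel κ] in
lemma potential_pos_of_pos {β β' : ℝ} {F : S → ℝ≥0∞} (hF : Measurable F) {x : S}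
    (h : 0 < potential κ β F x) : 0 < potential κ β' F x := by
  have hm : ∀ β : ℝ, Measurable fun t : ℝ =>
      ENNReal.ofReal (Real.exp (-β * t)) * ∫⁻ y, F y ∂κ (t.toNNReal, x) := fun β =>
    (Measurable.ennreal_ofReal (by fun_prop)).mul
      ((measurable_lintegral_kernel hF).comp measurable_prodMk_left)
  refine pos_iff_ne_zero.2 fun h0 => h.ne' ?_
  rw [potential, lintegral_eq_zero_iff (hm _)] at h0 ⊢
  filter_upwards [h0] with t ht
  refine mul_eq_zero_of_right _ ((mul_eq_zero.1 ht).resolve_left ?_)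
  exact (ENNReal.ofReal_pos.2 (Real.exp_pos _)).ne'

/-! ### The Doob transform as a Markov kernel -/

variable (κ)

/-- The kernel `α ∫_0^∞ e^{-αt} e^{lam t} φ(x)⁻¹ κ_t(x, dy) φ(y) dt`, the normalized resolvent of
the Doob transform of `κ` by the eigenfunction `φ`. -/
noncomputable def doobKernel (φ : S → ℝ) (lam α : ℝ) : Kernel S S :=
  (((Kernel.const S (volume.restrict (Set.Ioi (0 : ℝ)))) ⊗ₖ
    (κ.comap (fun p : S × ℝ => (p.2.toNNReal, p.1))
      (measurable_snd.real_toNNReal.prodMk measurable_fst))).withDensity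
    fun x p => ENNReal.ofReal (α * Real.exp (-α * p.1) * Real.exp (lam * p.1) / φ x * φ p.2)).snd

variable {κ}
variable {φ : S → ℝ} (hφ : Measurable φ) (hφ0 : ∀ x, 0 < φ x) {lam α : ℝ} (hα : 0 < α)

include hφ in
lemma measurable_doobDensity (lam α : ℝ) : Measurable (Function.uncurry fun (x : S) (p : ℝ × S) =>
    ENNReal.ofReal (α * Real.exp (-α * p.1) * Real.exp (lam * p.1) / φ x * φ p.2)) := by
  unfold Function.uncurry
  fun_prop

include hφ in
lemma lintegral_doobKernel {F : S → ℝ≥0∞} (hF : Measurable F) (x : S) :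
    ∫⁻ y, F y ∂(doobKernel κ φ lam α x) = ∫⁻ t in Set.Ioi (0 : ℝ), ∫⁻ y,
      ENNReal.ofReal (α * Real.exp (-α * t) * Real.exp (lam * t) / φ x * φ y) * F y
        ∂κ (t.toNNReal, x) := by
  have hd := measurable_doobDensity hφ lam α
  have hd' : Measurable fun p : ℝ × S =>
      ENNReal.ofReal (α * Real.exp (-α * p.1) * Real.exp (lam * p.1) / φ x * φ p.2) :=
    hd.comp (measurable_prodMk_left (x := x))
  have hF2 : Measurable fun p : ℝ × S => F p.2 := hF.comp measurable_snd
  rw [doobKernel, Kernel.snd_apply, lintegral_map hF measurable_snd, Kernel.withDensity_apply _ hd]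
  refine (lintegral_withDensity_eq_lintegral_mul _ hd' hF2).trans ?_
  rw [Kernel.lintegral_compProd _ _ _ (hd'.mul hF2)]
  rfl

include hφ hφ0 hα in
/-- The total mass of the Doob kernel is `α ∫_0^∞ e^{-αt} dt = 1`, by the eigenfunction identity. -/
lemma isMarkovKernel_doobKernel {M : ℝ} (hM : ∀ x, φ x ≤ M)
    (heig : ∀ (t : ℝ≥0) (x : S), Real.exp (-lam * t) * φ x = ∫ y, φ y ∂κ (t, x)) :
    IsMarkovKernel (doobKernel κ φ lam α) := by
  refine ⟨fun x => ⟨?_⟩⟩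
  have h1 : ∀ t ∈ Set.Ioi (0 : ℝ), ∫⁻ y,
      ENNReal.ofReal (α * Real.exp (-α * t) * Real.exp (lam * t) / φ x * φ y) * 1
        ∂κ (t.toNNReal, x) = ENNReal.ofReal (α * Real.exp (-α * t)) := by
    intro t ht
    have ht0 : (0 : ℝ) < t := ht
    have hc : 0 ≤ α * Real.exp (-α * t) * Real.exp (lam * t) / φ x :=
      div_nonneg (by positivity) (hφ0 x).le
    simp_rw [mul_one]
    rw [← ofReal_integral_eq_lintegral_ofReal, integral_const_mul, ← heig,
      Real.coe_toNNReal _ ht0.le]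
    · congr 1
      have := (hφ0 x).ne'
      have h2 : Real.exp (lam * t) * Real.exp (-lam * t) = 1 := by
        rw [← Real.exp_add]; simp
      calc α * Real.exp (-α * t) * Real.exp (lam * t) / φ x * (Real.exp (-lam * t) * φ x)
          = α * Real.exp (-α * t) * (Real.exp (lam * t) * Real.exp (-lam * t)) *
            (φ x / φ x) := by ring
        _ = α * Real.exp (-α * t) := by rw [h2, div_self this, mul_one, mul_one]
    · refine (integrable_of_bounded (c := M) hφ fun y => ?_).const_mul _
      rw [abs_of_pos (hφ0 y)]; exact hM y
    · exact ae_of_all _ fun y => mul_nonneg hc (hφ0 y).le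
  rw [← lintegral_one, lintegral_doobKernel hφ measurable_const,
    setLIntegral_congr_fun measurableSet_Ioi h1, ← ofReal_integral_eq_lintegral_ofReal]
  · rw [integral_const_mul, integral_exp_mul_Ioi (neg_lt_zero.2 hα)]
    simp [hα.ne']
  · exact (integrableOn_exp_mul_Ioi (neg_lt_zero.2 hα) 0).const_mul α
  · exact ae_of_all _ fun t => by positivity

include hφ hφ0 hα in
/-- Integration against the Doob kernel is the normalized resolvent of the Doob transform. -/
lemma integral_doobKernel {M : ℝ} (hM : ∀ x, φ x ≤ M)
    (heig : ∀ (t : ℝ≥0) (x : S), Real.exp (-lam * t) * φ x = ∫ y, φ y ∂κ (t, x))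
    {f : S → ℝ} (hf : Measurable f) {C : ℝ} (hC : ∀ x, |f x| ≤ C) (x : S) :
    ∫ y, f y ∂(doobKernel κ φ lam α x) = α * ∫ t in Set.Ioi (0 : ℝ),
      Real.exp (-α * t) * (Real.exp (lam * t) * (∫ y, f y * φ y ∂κ (t.toNNReal, x)) / φ x) := by
  have hd := measurable_doobDensity hφ lam α
  have hd' : Measurable fun p : ℝ × S =>
      ENNReal.ofReal (α * Real.exp (-α * p.1) * Real.exp (lam * p.1) / φ x * φ p.2) :=
    hd.comp (measurable_prodMk_left (x := x))
  have hnn : ∀ p : ℝ × S, 0 ≤ α * Real.exp (-α * p.1) * Real.exp (lam * p.1) / φ x * φ p.2 :=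
    fun p => mul_nonneg (div_nonneg (by positivity) (hφ0 x).le) (hφ0 _).le
  have hmk := isMarkovKernel_doobKernel hφ hφ0 hα hM heig
  have hint : Integrable f (doobKernel κ φ lam α x) := integrable_of_bounded hf hC
  rw [doobKernel, Kernel.snd_apply, Kernel.withDensity_apply _ hd] at hint ⊢
  rw [integrable_map_measure hf.aestronglyMeasurable measurable_snd.aemeasurable,
    integrable_withDensity_iff_integrable_smul' hd' (ae_of_all _ fun _ => ENNReal.ofReal_lt_top)]
    at hint
  rw [integral_map measurable_snd.aemeasurable hf.aestronglyMeasurable,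
    integral_withDensity_eq_integral_toReal_smul hd' (ae_of_all _ fun _ => ENNReal.ofReal_lt_top)]
  have hint' : Integrable (fun p : ℝ × S =>
      (ENNReal.ofReal (α * Real.exp (-α * p.1) * Real.exp (lam * p.1) / φ x * φ p.2)).toReal •
        f p.2) _ := hint
  rw [integral_compProd hint', Kernel.const_apply, ← integral_const_mul]
  refine integral_congr_ae (ae_of_all _ fun t => ?_)
  simp only [Kernel.comap_apply, smul_eq_mul]
  simp_rw [ENNReal.toReal_ofReal (hnn (t, _))]
  calc ∫ y, α * Real.exp (-α * t) * Real.exp (lam * t) / φ x * φ y * f y ∂κ (t.toNNReal, x)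
      = ∫ y, α * Real.exp (-α * t) * Real.exp (lam * t) / φ x * (f y * φ y)
          ∂κ (t.toNNReal, x) := by congr 1; ext y; ring
    _ = α * Real.exp (-α * t) * Real.exp (lam * t) / φ x *
          ∫ y, f y * φ y ∂κ (t.toNNReal, x) := integral_const_mul _ _
    _ = _ := by ring

include hφ hφ0 hα in
/-- The Doob kernel dominates the potential of the original transition function. -/
lemma potential_le_doobKernel (hlam : 0 ≤ lam) {B : Set S} (hB : MeasurableSet B) (x : S) :
    ENNReal.ofReal (α / φ x) * potential κ α (fun y => ENNReal.ofReal (B.indicator φ y)) x ≤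
      doobKernel κ φ lam α x B := by
  have hBm : Measurable (B.indicator (1 : S → ℝ≥0∞)) := measurable_one.indicator hB
  rw [← lintegral_indicator_one hB, lintegral_doobKernel hφ hBm, potential, ← lintegral_const_mul]
  · refine setLIntegral_mono' measurableSet_Ioi fun t ht => ?_
    have ht0 : (0 : ℝ) < t := ht
    rw [← lintegral_const_mul, ← lintegral_const_mul]
    · refine lintegral_mono fun y => ?_
      by_cases hy : y ∈ B
      · rw [Set.indicator_of_mem hy, Set.indicator_of_mem hy, Pi.one_apply, mul_one,
          ← ENNReal.ofReal_mul (Real.exp_pos _).le,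
          ← ENNReal.ofReal_mul (div_nonneg hα.le (hφ0 x).le)]
        refine ENNReal.ofReal_le_ofReal ?_
        have h1 : 1 ≤ Real.exp (lam * t) := Real.one_le_exp (by positivity)
        have h2 := hφ0 x
        have h3 := hφ0 y
        calc α / φ x * (Real.exp (-α * t) * φ y)
            = α * Real.exp (-α * t) * 1 / φ x * φ y := by ring
          _ ≤ _ := by gcongr
      · simp [Set.indicator_of_notMem hy]
    · exact Measurable.const_mul (hφ.indicator hB).ennreal_ofReal _
    · exact (hφ.indicator hB).ennreal_ofReal
  · exact (Measurable.ennreal_ofReal (by fun_prop)).mul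
      ((measurable_lintegral_kernel (hφ.indicator hB).ennreal_ofReal).comp measurable_prodMk_left)

end

section
variable {S : Type*} [MeasurableSpace S] (κ : Kernel (ℝ≥0 × S) S)

/-- The `β`-potential `∫_0^∞ e^{-βt} κ_t f dt` of a bounded function. -/
noncomputable def boundedPotential (β : ℝ) (f : S → ℝ) (x : S) : ℝ :=
  ∫ t in Set.Ioi (0 : ℝ), Real.exp (-β * t) * ∫ y, f y ∂κ (t.toNNReal, x)

variable {κ} [IsFiniteKernel κ] (h1 : ∀ p, κ p Set.univ ≤ 1) {f : S → ℝ} (hf : Measurable f)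
  (hf0 : ∀ x, 0 ≤ f x) {M : ℝ} (hM : ∀ x, f x ≤ M)

omit [IsFiniteKernel κ] in
include hf0 in
lemma boundedPotential_nonneg (β : ℝ) (x : S) : 0 ≤ boundedPotential κ β f x :=
  integral_nonneg fun _ => mul_nonneg (Real.exp_pos _).le (integral_nonneg hf0)

include h1 hf hf0 hM in
lemma measurable_boundedPotential {β : ℝ} (hβ : 0 < β) :
    Measurable (boundedPotential κ β f) := by
  have e : boundedPotential κ β f =
      fun x => (potential κ β (fun y => ENNReal.ofReal (f y)) x).toReal := by
    ext x
    rw [← ofReal_potential h1 hβ hf hf0 hM]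
    exact (ENNReal.toReal_ofReal (boundedPotential_nonneg hf0 β x)).symm
  rw [e]
  exact (measurable_potential β hf.ennreal_ofReal).ennreal_toReal

include h1 hf hf0 hM in
lemma boundedPotential_le {β : ℝ} (hβ : 0 < β) (x : S) : boundedPotential κ β f x ≤ M / β := by
  have hM' : ∀ x, |f x| ≤ M := fun x => by rw [abs_of_nonneg (hf0 x)]; exact hM x
  calc boundedPotential κ β f x
      ≤ ∫ t in Set.Ioi (0 : ℝ), Real.exp (-β * t) * M := by
        refine integral_mono
          (integrableOn_exp_mul hβ (measurable_integral_kernel hf x)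
            fun t => abs_integral_kernel_le h1 hM' _)
          ((integrableOn_exp_mul_Ioi (neg_lt_zero.2 hβ) 0).mul_const M) fun t => ?_
        exact mul_le_mul_of_nonneg_left ((le_abs_self _).trans (abs_integral_kernel_le h1 hM' _))
          (Real.exp_pos _).le
    _ = M / β := by
        rw [integral_mul_const, integral_exp_mul_Ioi (neg_lt_zero.2 hβ)]
        simp [div_eq_inv_mul]

include h1 hf hf0 hM in
/-- A `β`-potential is a supersolution for every constant potential `n ≥ β`. -/
lemma exp_mul_integral_boundedPotential_le
    (hadd : ∀ (t s : ℝ≥0) (x : S) {F : S → ℝ≥0∞}, Measurable F →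
      ∫⁻ y, F y ∂κ (t + s, x) = ∫⁻ y, ∫⁻ z, F z ∂κ (s, y) ∂κ (t, x))
    {β n : ℝ} (hβ : 0 < β) (hn : β ≤ n) (t : ℝ≥0) (x : S) :
    Real.exp (-n * t) * ∫ y, boundedPotential κ β f y ∂κ (t, x) ≤ boundedPotential κ β f x := by
  have h0 := boundedPotential_nonneg (κ := κ) hf0 β
  have hb : ∀ y, |boundedPotential κ β f y| ≤ M / β := fun y => by
    rw [abs_of_nonneg (h0 y)]; exact boundedPotential_le h1 hf hf0 hM hβ y
  have hm := measurable_boundedPotential h1 hf hf0 hM hβ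
  have hi0 : 0 ≤ ∫ y, boundedPotential κ β f y ∂κ (t, x) := integral_nonneg h0
  have h2 := exp_mul_lintegral_potential_le hadd β hf.ennreal_ofReal t x
  have e : ∀ y, potential κ β (fun z => ENNReal.ofReal (f z)) y =
      ENNReal.ofReal (boundedPotential κ β f y) := fun y =>
    (ofReal_potential h1 hβ hf hf0 hM y).symm
  simp_rw [e] at h2
  rw [← ofReal_integral_eq_lintegral_ofReal (integrable_of_bounded hm hb) (ae_of_all _ h0),
    ← ENNReal.ofReal_mul (Real.exp_pos _).le, ENNReal.ofReal_le_ofReal_iff (h0 x)] at h2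
  refine le_trans ?_ h2
  gcongr

include h1 in
/-- Rescaled potentials `n ∫_0^∞ e^{-nt} κ_t f dt` converge to `f` where the transition function is
right-continuous at time zero. -/
lemma tendsto_mul_boundedPotential {f : S → ℝ} (hf : Measurable f) {M : ℝ} (hM : ∀ x, |f x| ≤ M)
    {x : S}
    (hx : Tendsto (fun t : ℝ => ∫ y, f y ∂κ (t.toNNReal, x)) (𝓝[>] 0) (𝓝 (f x))) :
    Tendsto (fun n : ℕ => (n : ℝ) * boundedPotential κ n f x) atTop (𝓝 (f x)) := by
  have hsub : ∀ n : ℕ, 0 < n → (n : ℝ) * boundedPotential κ n f x =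
      ∫ s in Set.Ioi (0 : ℝ), Real.exp (-1 * s) * ∫ y, f y ∂κ ((s * (n : ℝ)⁻¹).toNNReal, x) := by
    intro n hn
    have hn' : (0 : ℝ) < n := Nat.cast_pos.2 hn
    have := integral_comp_mul_right_Ioi
      (fun t : ℝ => Real.exp (-n * t) * ∫ y, f y ∂κ (t.toNNReal, x)) 0 (inv_pos.2 hn')
    rw [inv_inv, zero_mul, smul_eq_mul] at this
    rw [boundedPotential, ← this]
    refine integral_congr_ae (ae_of_all _ fun s => ?_)
    have e : -(n : ℝ) * (s * (n : ℝ)⁻¹) = -1 * s := by field_simp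
    simp only [e]
  have hlim : Tendsto (fun n : ℕ => ∫ s in Set.Ioi (0 : ℝ),
      Real.exp (-1 * s) * ∫ y, f y ∂κ ((s * (n : ℝ)⁻¹).toNNReal, x)) atTop
      (𝓝 (∫ s in Set.Ioi (0 : ℝ), Real.exp (-1 * s) * f x)) := by
    have hint := integrableOn_exp_mul_Ioi (a := -1) (by norm_num) 0
    refine tendsto_integral_of_dominated_convergence (fun s => Real.exp (-1 * s) * M)
      (fun n => ?_) (hint.mul_const M) (fun n => ae_of_all _ fun s => ?_) ?_
    · exact ((Measurable.mul (by fun_prop) ((measurable_integral_kernel hf x).comp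
        (measurable_id.mul_const _)))).aestronglyMeasurable
    · rw [norm_mul, Real.norm_of_nonneg (Real.exp_pos _).le]
      exact mul_le_mul_of_nonneg_left (abs_integral_kernel_le h1 hM _) (Real.exp_pos _).le
    · refine (ae_restrict_iff' measurableSet_Ioi).2 (ae_of_all _ fun s hs => ?_)
      refine Tendsto.const_mul _ (hx.comp ?_)
      refine tendsto_nhdsWithin_iff.2 ⟨?_, ?_⟩
      · simpa using (tendsto_inv_atTop_nhds_zero_nat (𝕜 := ℝ)).const_mul s
      · filter_upwards [eventually_gt_atTop 0] with n hn
        have hn' : (0 : ℝ) < n := Nat.cast_pos.2 hn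
        exact mul_pos hs (inv_pos.2 hn')
  have hval : ∫ s in Set.Ioi (0 : ℝ), Real.exp (-1 * s) * f x = f x := by
    rw [integral_mul_const, integral_exp_mul_Ioi (by norm_num)]; simp
  rw [hval] at hlim
  refine hlim.congr' ?_
  filter_upwards [eventually_gt_atTop 0] with n hn
  exact (hsub n hn).symm

end

section
variable {A : Coefficients d} {P : Kernel (E d) (Path d)} [IsMarkovKernel P]
  {D : Set (E d)} {m : Measure D} {φ : D → ℝ} {lam : ℝ}

/-! ### The killed process and its eigenfunction -/

/-- The killed transition function is right-continuous at time zero on functions that are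
continuous at the starting point. -/
lemma tendsto_killed (h : RegularExit A P D) {f : D → ℝ} (hf : Measurable f) {C : ℝ}
    (hC : ∀ x, |f x| ≤ C) {x : D} (hx : ContinuousAt f x) :
    Tendsto (fun t : ℝ => ∫ y, f y ∂(killed P h.isOpen (t.toNNReal, x))) (𝓝[>] 0)
      (𝓝 (f x)) := by
  have hm := measurable_ext h.isOpen.measurableSet hf
  have hC0 : 0 ≤ C := (abs_nonneg _).trans (hC x)
  have e : ∀ t : ℝ, ∫ y, f y ∂(killed P h.isOpen (t.toNNReal, x)) =
      ∫ ω, (alive D t.toNNReal).indicator (fun ω => ext f (ω t.toNNReal)) ω ∂(P x) := by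
    intro t
    rw [← semigroup_eq h _ hf, semigroup, setIntegral_congr_set (lt_exitTime_ae_eq h _ x.2),
      integral_indicator (measurableSet_alive D _)]
  simp_rw [e]
  have hlim : ∫ _ω, f x ∂(P x) = f x := by simp
  rw [← hlim]
  have hcont : ContinuousAt (ext f) (x : E d) := by
    refine h.isOpen.isOpenEmbedding_subtypeVal.continuousAt_iff.1 ?_
    have e2 : ext f ∘ Subtype.val = f := by ext y; exact ext_coe f y
    rw [e2]; exact hx
  refine tendsto_integral_filter_of_dominated_convergence (fun _ => C)
    (Eventually.of_forall fun t => ?_) (Eventually.of_forall fun t => ae_of_all _ fun ω => ?_)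
    (integrable_const _) ?_
  · exact ((hm.comp (Path.measurable_eval _)).indicator
      (measurableSet_alive D _)).aestronglyMeasurable
  · refine (norm_indicator_le_norm_self _ _).trans ?_
    exact abs_ext_le hC0 hC _
  · filter_upwards [h.regular x x.2, h.start x] with ω hω h0
    have hto : Tendsto (fun t : ℝ => t.toNNReal) (𝓝[>] 0) (𝓝[≥] (0 : ℝ≥0)) := by
      refine tendsto_nhdsWithin_iff.2 ⟨?_, Eventually.of_forall fun t => Set.mem_Ici.2 zero_le⟩
      have : Tendsto Real.toNNReal (𝓝 0) (𝓝 (Real.toNNReal 0)) := continuous_real_toNNReal.tendsto 0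
      rw [Real.toNNReal_zero] at this
      exact this.mono_left nhdsWithin_le_nhds
    have h1 : Tendsto (fun t : ℝ => ext f (ω t.toNNReal)) (𝓝[>] 0) (𝓝 (f x)) := by
      have h2 : Tendsto (fun t : ℝ => ω t.toNNReal) (𝓝[>] 0) (𝓝 (x : E d)) := by
        rw [← h0]
        exact Tendsto.comp (ω.right_cont 0) hto
      rw [← ext_coe f x]
      exact hcont.tendsto.comp h2
    refine h1.congr' ?_
    have h3 : ∀ᶠ t : ℝ in 𝓝[>] 0, ((t.toNNReal : ℝ≥0) : ℝ≥0∞) < exitLimit D ω := by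
      have hpos : 0 < exitLimit D ω := by rw [← hω.exit_eq]; exact hω.pos
      have h4 : Tendsto (fun t : ℝ => ((t.toNNReal : ℝ≥0) : ℝ≥0∞)) (𝓝[>] 0) (𝓝 0) := by
        have := hto.mono_right (nhdsWithin_le_nhds)
        exact (ENNReal.continuous_coe.tendsto 0).comp this
      exact h4.eventually_lt_const hpos
    filter_upwards [h3] with t ht
    rw [Set.indicator_of_mem (mem_alive.2 ht)]

lemma IsBoundedEigenpair.killed_eq (h : RegularExit A P D) (hE : IsBoundedEigenpair P D m φ lam)
    (t : ℝ≥0) (x : D) :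
    Real.exp (-lam * t) * φ x = ∫ y, φ y ∂(killed P h.isOpen (t, x)) := by
  rw [hE.eigen, semigroup_eq h t hE.measurable]

omit [IsMarkovKernel P] in
/-- Irreducibility makes the eigenfunction strictly positive. -/
lemma IsBoundedEigenpair.pos (hIR : Irreducible P D m) (hE : IsBoundedEigenpair P D m φ lam)
    (x : D) : 0 < φ x := by
  refine (hE.nonneg x).lt_of_ne fun h0 => ?_
  have h1 := hIR φ hE.measurable hE.nonneg hE.bounded hE.nontrivial x
  have h2 : ∀ t, semigroup P D t φ x = 0 := fun t => by rw [← hE.eigen, ← h0, mul_zero]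
  simp [resolvent, h2] at h1

lemma Irreducible.potential_pos (h : RegularExit A P D) (hIR : Irreducible P D m) {f : D → ℝ}
    (hf : Measurable f) (hf0 : ∀ x, 0 ≤ f x) {C : ℝ} (hC : ∀ x, f x ≤ C)
    (hpos : 0 < ∫⁻ x, ENNReal.ofReal (f x) ∂m) (β : ℝ) (x : D) :
    0 < potential (killed P h.isOpen) β (fun y => ENNReal.ofReal (f y)) x := by
  have := isFiniteKernel_killed h
  refine potential_pos_of_pos (β := 1) hf.ennreal_ofReal ?_
  rw [← ofReal_potential (killed_le_one h) one_pos hf hf0 hC, ENNReal.ofReal_pos]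
  have := hIR f hf hf0 ⟨C, hC⟩ hpos x
  simp_rw [resolvent, semigroup_eq h _ hf] at this
  exact this

omit [IsMarkovKernel P] in
lemma IsBoundedEigenpair.lintegral_indicator_pos (hIR : Irreducible P D m)
    (hE : IsBoundedEigenpair P D m φ lam) {B : Set D} (hB : MeasurableSet B) (hmB : m B ≠ 0) :
    0 < ∫⁻ x, ENNReal.ofReal (B.indicator φ x) ∂m := by
  rw [lintegral_pos_iff_support (hE.measurable.indicator hB).ennreal_ofReal]
  refine (pos_iff_ne_zero.2 hmB).trans_le (measure_mono fun x hx => ?_)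
  rw [Function.mem_support, Set.indicator_of_mem hx]
  exact (ENNReal.ofReal_pos.2 (hE.pos hIR x)).ne'

lemma IsBoundedEigenpair.isMarkovKernel (h : RegularExit A P D) (hIR : Irreducible P D m)
    (hE : IsBoundedEigenpair P D m φ lam) {α : ℝ} (hα : 0 < α) :
    IsMarkovKernel (doobKernel (killed P h.isOpen) φ lam α) := by
  have := isFiniteKernel_killed h
  obtain ⟨M, hM⟩ := hE.bounded
  exact isMarkovKernel_doobKernel hE.measurable (hE.pos hIR) hα hM (hE.killed_eq h)

lemma IsBoundedEigenpair.doobKernel_pos (h : RegularExit A P D) (hIR : Irreducible P D m)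
    (hE : IsBoundedEigenpair P D m φ lam) {α : ℝ} (hα : 0 < α) {B : Set D}
    (hB : MeasurableSet B) (hmB : m B ≠ 0) (x : D) :
    0 < doobKernel (killed P h.isOpen) φ lam α x B := by
  have := isFiniteKernel_killed h
  obtain ⟨M, hM⟩ := hE.bounded
  refine lt_of_lt_of_le ?_ (potential_le_doobKernel hE.measurable (hE.pos hIR) hα
    hE.eigenvalue_nonneg hB x)
  refine ENNReal.mul_pos (ENNReal.ofReal_pos.2 (div_pos hα (hE.pos hIR x))).ne' ?_
  refine (hIR.potential_pos h (hE.measurable.indicator hB)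
    (fun y => Set.indicator_nonneg (fun z _ => hE.nonneg z) y)
    (fun y => (Set.indicator_le_self' (fun _ _ => hE.nonneg _) y).trans (hM y))
    (hE.lintegral_indicator_pos hIR hB hmB) α x).ne'

/-- The normalized resolvent of the `φ`-process is integration against the Doob kernel. -/
lemma IsBoundedEigenpair.mul_doobResolvent_eq (h : RegularExit A P D) (hIR : Irreducible P D m)
    (hE : IsBoundedEigenpair P D m φ lam) {α : ℝ} (hα : 0 < α) {f : D → ℝ} (hf : Measurable f)
    {C : ℝ} (hC : ∀ x, |f x| ≤ C) (x : D) :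
    α * doobResolvent P D φ lam α f x =
      ∫ y, f y ∂(doobKernel (killed P h.isOpen) φ lam α x) := by
  have := isFiniteKernel_killed h
  obtain ⟨M, hM⟩ := hE.bounded
  rw [integral_doobKernel hE.measurable (hE.pos hIR) hα hM (hE.killed_eq h) hf hC, doobResolvent]
  congr 1
  refine setIntegral_congr_fun measurableSet_Ioi fun t ht => ?_
  simp only [doobSemigroup]
  rw [semigroup_eq h _ (f := fun y => f y * φ y) (hf.mul hE.measurable),
    Real.coe_toNNReal _ (Set.mem_Ioi.1 ht).le]

end

/-! ### Iterates of a transition operator -/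

section
variable {S : Type*} [MeasurableSpace S] {T : (S → ℝ) → S → ℝ} {K : Kernel S S}

/-- The transition operator of `K`, restricted to bounded measurable functions, keeps its bounds
under iteration. -/
lemma iterate_mem_Icc [IsMarkovKernel K]
    (hT : ∀ f : S → ℝ, Measurable f → ∀ C, (∀ x, |f x| ≤ C) → ∀ x, T f x = ∫ y, f y ∂(K x))
    {f : S → ℝ} (hf : Measurable f) {a b : ℝ} (hab : ∀ x, f x ∈ Set.Icc a b) (n : ℕ) :
    Measurable (T^[n] f) ∧ ∀ x, T^[n] f x ∈ Set.Icc a b := by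
  induction n with
  | zero => exact ⟨hf, hab⟩
  | succ n ih =>
    obtain ⟨hm, hb⟩ := ih
    have hC : ∀ x, |T^[n] f x| ≤ max |a| |b| := fun x => abs_le_max_abs_abs (hb x).1 (hb x).2
    have e : T (T^[n] f) = fun x => ∫ y, T^[n] f y ∂(K x) := funext (hT _ hm _ hC)
    rw [Function.iterate_succ_apply', e]
    refine ⟨hm.stronglyMeasurable.integral_kernel.measurable, fun x => ?_⟩
    have hi : Integrable (T^[n] f) (K x) := integrable_of_bounded hm hC
    constructor
    · simpa using integral_mono (integrable_const a) hi fun y => (hb y).1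
    · simpa using integral_mono hi (integrable_const b) fun y => (hb y).2

end

section
variable {A : Coefficients d} {P : Kernel (E d) (Path d)} [IsMarkovKernel P]
  {D : Set (E d)} {m : Measure D} {φ : D → ℝ} {lam : ℝ}

/-! ### Uniform ergodicity implies the Hopf lemma -/

/-- The lower bound `w φ ≤ v` for a supersolution `v` improves to `γ⁻¹ (K_γ w) φ ≤ v` with
`γ = 1 + C + lam`. -/
lemma IsBoundedEigenpair.lower_bound_step (h : RegularExit A P D) (hIR : Irreducible P D m)
    (hE : IsBoundedEigenpair P D m φ lam) {C : ℝ} (hC0 : 0 ≤ C) {v : D → ℝ} (hv : Measurable v)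
    {V : ℝ} (hV : ∀ x, |v x| ≤ V)
    (hsup : ∀ (t : ℝ≥0) (x : D), Real.exp (-C * t) * ∫ y, v y ∂(killed P h.isOpen (t, x)) ≤ v x)
    {w : D → ℝ} (hw : Measurable w) {W : ℝ} (hW : ∀ x, |w x| ≤ W) (hwv : ∀ x, w x * φ x ≤ v x)
    (x : D) :
    (1 + C + lam)⁻¹ * (∫ y, w y ∂(doobKernel (killed P h.isOpen) φ lam (1 + C + lam) x)) * φ x ≤
      v x := by
  have := isFiniteKernel_killed h
  have hlam := hE.eigenvalue_nonneg
  have hγ : 0 < 1 + C + lam := by linarith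
  have hφx := hE.pos hIR x
  obtain ⟨M, hM⟩ := hE.bounded
  have hwφ : ∀ y, |w y * φ y| ≤ W * M := fun y => by
    rw [abs_mul, abs_of_pos (hE.pos hIR y)]
    exact mul_le_mul (hW y) (hM y) (hE.nonneg y) ((abs_nonneg _).trans (hW y))
  rw [integral_doobKernel hE.measurable (hE.pos hIR) hγ hM (hE.killed_eq h) hw hW, ← mul_assoc,
    inv_mul_cancel₀ hγ.ne', one_mul, ← integral_mul_const]
  have e : ∀ t : ℝ, Real.exp (-(1 + C + lam) * t) * (Real.exp (lam * t) *
      (∫ y, w y * φ y ∂(killed P h.isOpen (t.toNNReal, x))) / φ x) * φ x =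
      Real.exp (-(1 + C) * t) * ∫ y, w y * φ y ∂(killed P h.isOpen (t.toNNReal, x)) := by
    intro t
    have e1 : Real.exp (-(1 + C) * t) = Real.exp (-(1 + C + lam) * t) * Real.exp (lam * t) := by
      rw [← Real.exp_add]; ring_nf
    rw [e1]
    field_simp
  simp_rw [e]
  calc ∫ t in Set.Ioi (0 : ℝ), Real.exp (-(1 + C) * t) *
        ∫ y, w y * φ y ∂(killed P h.isOpen (t.toNNReal, x))
      ≤ ∫ t in Set.Ioi (0 : ℝ), Real.exp (-1 * t) * v x := by
        refine setIntegral_mono_on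
          (integrableOn_exp_mul (by linarith) (measurable_integral_kernel (hw.mul hE.measurable) x)
            fun t => abs_integral_kernel_le (killed_le_one h) hwφ _)
          ((integrableOn_exp_mul_Ioi (by norm_num) 0).mul_const _) measurableSet_Ioi
          fun t ht => ?_
        have h1 : ∫ y, w y * φ y ∂(killed P h.isOpen (t.toNNReal, x)) ≤
            ∫ y, v y ∂(killed P h.isOpen (t.toNNReal, x)) :=
          integral_mono (integrable_of_bounded (hw.mul hE.measurable) hwφ)
            (integrable_of_bounded hv hV) hwv
        have h2 := hsup t.toNNReal x
        rw [Real.coe_toNNReal _ (Set.mem_Ioi.1 ht).le] at h2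
        have e2 : Real.exp (-(1 + C) * t) = Real.exp (-1 * t) * Real.exp (-C * t) := by
          rw [← Real.exp_add]; ring_nf
        rw [e2, mul_assoc]
        exact mul_le_mul_of_nonneg_left
          ((mul_le_mul_of_nonneg_left h1 (Real.exp_pos _).le).trans h2) (Real.exp_pos _).le
    _ = v x := by
        rw [integral_mul_const, integral_exp_mul_Ioi (by norm_num)]; simp

/-- Uniform ergodicity transports the lower bound on a set of positive measure, where `v` dominates
a multiple of `φ`, to all of `D`. -/
theorem hopfLemma_of_uniformlyErgodic (h : RegularExit A P D) (hIR : Irreducible P D m)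
    (hE : IsBoundedEigenpair P D m φ lam)
    (hU : UniformlyErgodicResolvent (doobResolvent P D φ lam)) {c : D → ℝ} (hc : IsAdmissible c) :
    HopfLemma A P D m φ c := by
  intro u hu hM0 hnc
  have := isFiniteKernel_killed h
  set M := sSup (u '' A.extDomain D) with hMdef
  obtain ⟨Cu, hCu⟩ := hu.bounded
  have hM : ∀ x ∈ A.extDomain D, u x ≤ M := fun x hx =>
    le_csSup ⟨Cu, by rintro _ ⟨y, -, rfl⟩; exact (le_abs_self _).trans (hCu y)⟩ ⟨x, hx, rfl⟩
  obtain ⟨C, hC⟩ : ∃ C, 0 ≤ C ∧ ∀ x, c x ≤ C := by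
    obtain ⟨C, hC⟩ := hc.bounded
    exact ⟨max C 0, le_max_right _ _, fun x => (hC x).trans (le_max_left _ _)⟩
  set v : D → ℝ := fun x => M - u x with hvdef
  have hvm : Measurable v := measurable_const.sub (hu.measurable.comp measurable_subtype_coe)
  have hv0 : ∀ x, 0 ≤ v x := fun x => sub_nonneg.2 (hM x (Or.inl x.2))
  have hV : ∀ x, |v x| ≤ |M| + Cu := fun x =>
    (abs_sub _ _).trans (add_le_add_right (hCu x) _)
  have hsup : ∀ (t : ℝ≥0) (x : D),
      Real.exp (-C * t) * ∫ y, v y ∂(killed P h.isOpen (t, x)) ≤ v x :=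
    fun t x => hu.exp_mul_le h hc hC.2 hM0 hM t x
  set γ := 1 + C + lam with hγdef
  have hγ : 0 < γ := by have := hE.eigenvalue_nonneg; linarith [hC.1]
  -- a multiple of `φ` is below `v` on a set of positive measure, since `v` is not a.e. zero
  obtain ⟨ε, hε, hB⟩ : ∃ ε > 0, m {x | ε * φ x ≤ v x} ≠ 0 := by
    by_contra! hcon
    refine hnc ⟨M, ?_⟩
    have h1 : ∀ k : ℕ, ∀ᵐ x ∂m, v x < ((k : ℝ) + 1)⁻¹ * φ x := fun k => by
      have := hcon ((k : ℝ) + 1)⁻¹ (by positivity)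
      rw [measure_eq_zero_iff_ae_notMem] at this
      filter_upwards [this] with x hx
      exact not_le.1 hx
    filter_upwards [ae_all_iff.2 h1] with x hx
    have h2 : Tendsto (fun k : ℕ => ((k : ℝ) + 1)⁻¹ * φ x) atTop (𝓝 (0 * φ x)) := by
      refine Tendsto.mul_const _ ?_
      simpa [one_div] using tendsto_one_div_add_atTop_nhds_zero_nat (𝕜 := ℝ)
    rw [zero_mul] at h2
    have h3 : v x ≤ 0 := ge_of_tendsto' h2 fun k => (hx k).le
    have h4 := hv0 x
    simp only [hvdef] at h3 h4
    linarith
  set B := {x | ε * φ x ≤ v x} with hBdef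
  have hBm : MeasurableSet B := measurableSet_le (hE.measurable.const_mul ε) hvm
  have hKm := hE.isMarkovKernel h hIR hγ
  set K := doobKernel (killed P h.isOpen) φ lam γ with hKdef
  set T : (D → ℝ) → D → ℝ := fun f x => γ * doobResolvent P D φ lam γ f x with hTdef
  have hT : ∀ f : D → ℝ, Measurable f → ∀ C, (∀ x, |f x| ≤ C) → ∀ x, T f x = ∫ y, f y ∂(K x) :=
    fun f hf C hC x => hE.mul_doobResolvent_eq h hIR hγ hf hC x
  have h1m : Measurable (B.indicator (1 : D → ℝ)) := measurable_one.indicator hBm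
  have h1b : ∀ x, B.indicator (1 : D → ℝ) x ∈ Set.Icc (0 : ℝ) 1 := fun x => by
    by_cases hx : x ∈ B <;> simp [hx]
  have hit := iterate_mem_Icc hT h1m h1b
  have h01 : ∀ {r : ℝ}, r ∈ Set.Icc (0 : ℝ) 1 → |r| ≤ 1 := fun hr => by
    rw [abs_of_nonneg hr.1]; exact hr.2
  obtain ⟨Q, hQp, hinv, C', -, ρ, hρ0, hρ1, herg⟩ := hU γ hγ
  -- the lower bound propagated through the iterates
  have hlow : ∀ (n : ℕ) (x : D), ε * (γ⁻¹) ^ n * T^[n] (B.indicator 1) x * φ x ≤ v x := by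
    intro n
    induction n with
    | zero =>
      intro x
      by_cases hx : x ∈ B
      · have hx' : ε * φ x ≤ v x := hx
        simpa [Set.indicator_of_mem hx] using hx'
      · simpa [hx] using hv0 x
    | succ n ih =>
      intro x
      obtain ⟨hm1, hb1⟩ := hit n
      have hs := hE.lower_bound_step h hIR hC.1 hvm hV hsup
        (w := fun x => ε * (γ⁻¹) ^ n * T^[n] (B.indicator 1) x) (hm1.const_mul _)
        (W := |ε * (γ⁻¹) ^ n|) (fun y => by
          rw [abs_mul]; exact mul_le_of_le_one_right (abs_nonneg _) (h01 (hb1 y))) ih x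
      rw [integral_const_mul] at hs
      rw [Function.iterate_succ_apply', hT _ hm1 1 fun y => h01 (hb1 y)]
      refine le_trans (le_of_eq ?_) hs
      rw [pow_succ]
      ring
  -- the invariant measure charges `B`
  have hQB : 0 < Q.real B := by
    obtain ⟨hi1, hi2⟩ := hinv B hBm
    rw [← hi2]
    have hpos : ∀ x, 0 < T (B.indicator 1) x := fun x => by
      rw [hT _ h1m 1 (fun y => h01 (h1b y)), integral_indicator_one hBm, measureReal_def]
      exact ENNReal.toReal_pos (hE.doobKernel_pos h hIR hγ hBm hB x).ne' (measure_ne_top _ _)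
    refine (integral_pos_iff_support_of_nonneg (fun x => (hpos x).le) hi1).2 ?_
    have e : Function.support (fun x => T (B.indicator 1) x) = Set.univ :=
      Set.eq_univ_of_forall fun x => (hpos x).ne'
    refine lt_of_lt_of_eq one_pos ?_
    rw [← measure_univ (μ := Q), ← e]
  obtain ⟨n, hn⟩ : ∃ n : ℕ, C' * ρ ^ n < Q.real B / 2 := by
    have : Tendsto (fun n : ℕ => C' * ρ ^ n) atTop (𝓝 (C' * 0)) :=
      (tendsto_pow_atTop_nhds_zero_of_lt_one hρ0.le hρ1).const_mul C'
    rw [mul_zero] at this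
    exact (this.eventually_lt_const (half_pos hQB)).exists
  refine ⟨ε * (γ⁻¹) ^ n * (Q.real B / 2), by positivity, fun x => ?_⟩
  refine le_trans ?_ (hlow n x)
  have h2 := herg n x _ h1m fun y => h01 (h1b y)
  rw [integral_indicator_one hBm] at h2
  have h3 := (abs_le.1 h2).1
  have hφ0 := hE.nonneg x
  have h4 : Q.real B / 2 ≤ T^[n] (B.indicator 1) x := by linarith
  gcongr

/-! ### The Hopf lemma implies a minorization of the resolvent kernel -/

omit [IsMarkovKernel P] in
/-- Functions on `D` extended by zero, with the sign changed, have supremum zero on `D_S`, because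
`D_S` contains a boundary point of `D`. -/
lemma sSup_neg_ext (hD : IsOpen D) (hne : D.Nonempty) (hDc : Dᶜ.Nonempty) {v : D → ℝ}
    (hv0 : ∀ x, 0 ≤ v x) : sSup ((fun x => -ext v x) '' A.extDomain D) = 0 := by
  obtain ⟨b, hb⟩ : (frontier D).Nonempty := by
    rw [Set.nonempty_iff_ne_empty, Ne, ← isClopen_iff_frontier_eq_empty, isClopen_iff]
    rintro (h1 | h1)
    · exact hne.ne_empty h1
    · rw [h1, Set.compl_univ] at hDc; exact Set.not_nonempty_empty hDc
  have hbD : b ∉ D := fun hbD => by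
    rw [hD.frontier_eq] at hb; exact hb.2 hbD
  refine IsGreatest.csSup_eq ⟨⟨b, Or.inr (Or.inl hb), ?_⟩, ?_⟩
  · simp [ext_of_notMem v hbD]
  · rintro _ ⟨x, -, rfl⟩
    by_cases hx : x ∈ D
    · simpa [ext_of_mem v hx] using hv0 _
    · simp [ext_of_notMem v hx]

/-- A measure that is not concentrated at a point charges some ball and the complement of the
concentric closed ball. -/
lemma exists_ball_pos {X : Type*} [MetricSpace X] [SecondCountableTopology X] [MeasurableSpace X]
    [Nonempty X] {m : Measure X} (hm : ∀ x₀ : X, m {x₀}ᶜ ≠ 0) :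
    ∃ (z : X) (r : ℝ), m (Metric.ball z r) ≠ 0 ∧ m (Metric.closedBall z r)ᶜ ≠ 0 := by
  obtain ⟨x₀⟩ := ‹Nonempty X›
  have huniv : m Set.univ ≠ 0 := fun h0 => hm x₀ (measure_mono_null (Set.subset_univ _) h0)
  obtain ⟨z, -, hz⟩ := exists_mem_forall_mem_nhdsWithin_pos_measure huniv
  rw [nhdsWithin_univ] at hz
  have hU : {z}ᶜ ⊆ ⋃ k : ℕ, (Metric.closedBall z (1 / ((k : ℝ) + 1)))ᶜ := fun y hy => by
    have hd : 0 < dist y z := dist_pos.2 hy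
    obtain ⟨k, hk⟩ := exists_nat_one_div_lt hd
    exact Set.mem_iUnion.2 ⟨k, fun hmem => absurd (Metric.mem_closedBall.1 hmem) hk.not_ge⟩
  obtain ⟨k, hk⟩ : ∃ k : ℕ, m (Metric.closedBall z (1 / ((k : ℝ) + 1)))ᶜ ≠ 0 := by
    by_contra! hcon
    exact hm z (measure_mono_null hU (measure_iUnion_null hcon))
  exact ⟨z, 1 / ((k : ℝ) + 1), (hz _ (Metric.ball_mem_nhds z (by positivity))).ne', hk⟩

/-- The Hopf lemma, applied to minima of a potential and of rescaled potentials of a ball,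
bounds the potential from below by a multiple of `φ`. -/
lemma exists_mul_le_boundedPotential (h : RegularExit A P D) (hne : D.Nonempty)
    (hm : ∀ x₀ : D, m {x₀}ᶜ ≠ 0)
    (hH : ∀ c : D → ℝ, IsAdmissible c → HopfLemma A P D m φ c)
    {f : D → ℝ} (hf : Measurable f) (hf0 : ∀ x, 0 ≤ f x) {M : ℝ} (hM : ∀ x, f x ≤ M)
    {α : ℝ} (hα : 0 < α) (hpos : ∀ x, 0 < boundedPotential (killed P h.isOpen) α f x) :
    ∃ a > 0, ∀ x, a * φ x ≤ boundedPotential (killed P h.isOpen) α f x := by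
  have := isFiniteKernel_killed h
  have hle1 := killed_le_one h
  have hadd := fun (t s : ℝ≥0) (x : D) {F : D → ℝ≥0∞} (hF : Measurable F) =>
    lintegral_killed_add h t s x hF
  have : Nonempty D := hne.to_subtype
  obtain ⟨z, r, hz1, hz2⟩ := exists_ball_pos hm
  set κ := killed P h.isOpen with hκ
  set W := Metric.ball z r with hW
  have hWm : MeasurableSet W := Metric.isOpen_ball.measurableSet
  have hwm : Measurable (W.indicator (1 : D → ℝ)) := measurable_one.indicator hWm
  have hw0 : ∀ x, 0 ≤ W.indicator (1 : D → ℝ) x := Set.indicator_nonneg fun _ _ => zero_le_one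
  have hw1 : ∀ x, W.indicator (1 : D → ℝ) x ≤ 1 :=
    Set.indicator_le_self' (fun _ _ => zero_le_one)
  set g := boundedPotential κ α f with hg
  have hgm : Measurable g := measurable_boundedPotential hle1 hf hf0 hM hα
  set G : ℕ → D → ℝ := fun n x => n * boundedPotential κ n (W.indicator 1) x with hG
  set v : ℕ → D → ℝ := fun n x => min (g x) (G n x) with hv
  have hG0 : ∀ n x, 0 ≤ G n x := fun n x =>
    mul_nonneg n.cast_nonneg (boundedPotential_nonneg hw0 _ _)
  have hv0 : ∀ n x, 0 ≤ v n x := fun n x => le_min (hpos x).le (hG0 n x)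
  have hgb : ∀ x, g x ≤ M / α := boundedPotential_le hle1 hf hf0 hM hα
  have hga : ∀ x, |g x| ≤ M / α := fun x => by rw [abs_of_pos (hpos x)]; exact hgb x
  have hGm : ∀ n : ℕ, 0 < n → Measurable (G n) := fun n hn =>
    (measurable_boundedPotential hle1 hwm hw0 hw1 (Nat.cast_pos.2 hn)).const_mul _
  have hGa : ∀ n : ℕ, 0 < n → ∀ x, |G n x| ≤ 1 := fun n hn x => by
    have hn' : (0 : ℝ) < n := Nat.cast_pos.2 hn
    rw [abs_of_nonneg (hG0 n x)]
    calc G n x ≤ n * (1 / n) := by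
          simp only [hG]
          gcongr
          exact boundedPotential_le hle1 hwm hw0 hw1 hn' x
      _ = 1 := by field_simp
  have hvm : ∀ n : ℕ, 0 < n → Measurable (v n) := fun n hn => hgm.min (hGm n hn)
  have hsup : ∀ n : ℕ, 0 < n → α ≤ n → ∀ (t : ℝ≥0) (x : D),
      Real.exp (-n * t) * ∫ y, v n y ∂κ (t, x) ≤ v n x := by
    intro n hn hαn t x
    have hn' : (0 : ℝ) < n := Nat.cast_pos.2 hn
    have hva : ∀ y, |v n y| ≤ M / α := fun y => by
      rw [abs_of_nonneg (hv0 n y)]; exact (min_le_left _ _).trans (hgb y)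
    have hvi : Integrable (v n) (κ (t, x)) := integrable_of_bounded (hvm n hn) hva
    refine le_min ?_ ?_
    · refine le_trans ?_ (exp_mul_integral_boundedPotential_le hle1 hf hf0 hM hadd hα hαn t x)
      exact mul_le_mul_of_nonneg_left (integral_mono hvi (integrable_of_bounded hgm hga)
        fun y => min_le_left _ _) (Real.exp_pos _).le
    · calc Real.exp (-n * t) * ∫ y, v n y ∂κ (t, x)
          ≤ Real.exp (-n * t) * ∫ y, G n y ∂κ (t, x) :=
            mul_le_mul_of_nonneg_left (integral_mono hvi
              (integrable_of_bounded (hGm n hn) (hGa n hn)) fun y => min_le_right _ _)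
              (Real.exp_pos _).le
        _ = n * (Real.exp (-n * t) *
              ∫ y, boundedPotential κ n (W.indicator 1) y ∂κ (t, x)) := by
            simp only [hG]
            rw [integral_const_mul]
            ring
        _ ≤ G n x := mul_le_mul_of_nonneg_left
            (exp_mul_integral_boundedPotential_le hle1 hwm hw0 hw1 hadd hn' le_rfl t x) hn'.le
  -- off the sphere, the functions `v n` converge to the minimum of `g` and the indicator of `W`
  have hlim : ∀ x, ContinuousAt (W.indicator (1 : D → ℝ)) x →
      Tendsto (fun n => v n x) atTop (𝓝 (min (g x) (W.indicator 1 x))) := by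
    intro x hx
    have hwa : ∀ y, |W.indicator (1 : D → ℝ) y| ≤ 1 := fun y => by
      rw [abs_of_nonneg (hw0 y)]; exact hw1 y
    exact tendsto_const_nhds.min
      (tendsto_mul_boundedPotential hle1 hwm hwa (tendsto_killed h hwm hwa hx))
  obtain ⟨n, hn0, hnα, hnc⟩ : ∃ n : ℕ, 0 < n ∧ α ≤ n ∧ ¬ ∃ k : ℝ, ∀ᵐ x ∂m, v n x = k := by
    by_contra! hcon
    choose! k hk using hcon
    have hall : ∀ᵐ x ∂m, ∀ n : ℕ, 0 < n → α ≤ n → v n x = k n := by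
      refine ae_all_iff.2 fun n => ?_
      by_cases hn : 0 < n ∧ α ≤ n
      · filter_upwards [hk n hn.1 hn.2] with x hx _ _ using hx
      · exact ae_of_all _ fun x h1 h2 => absurd ⟨h1, h2⟩ hn
    have hev : ∀ᶠ n : ℕ in atTop, 0 < n ∧ α ≤ n :=
      (eventually_gt_atTop 0).and
        (tendsto_natCast_atTop_atTop.eventually_ge_atTop α)
    have hex : ∀ s : Set D, m s ≠ 0 → ∃ x ∈ s, ∀ n : ℕ, 0 < n → α ≤ n → v n x = k n := by
      intro s hs
      by_contra! hno
      refine hs (measure_mono_null (fun x hx => ?_) (ae_iff.1 hall))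
      obtain ⟨n, h1, h2, h3⟩ := hno x hx
      exact fun hcontra => h3 (hcontra n h1 h2)
    obtain ⟨x, hxW, hx⟩ := hex W hz1
    obtain ⟨y, hyW, hy⟩ := hex _ hz2
    have hcx : W.indicator (1 : D → ℝ) =ᶠ[𝓝 x] fun _ => 1 := by
      filter_upwards [Metric.isOpen_ball.mem_nhds hxW] with p hp
      exact Set.indicator_of_mem hp _
    have hcy : W.indicator (1 : D → ℝ) =ᶠ[𝓝 y] fun _ => 0 := by
      filter_upwards [Metric.isClosed_closedBall.isOpen_compl.mem_nhds hyW] with p hp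
      exact Set.indicator_of_notMem (fun hpW => hp (Metric.ball_subset_closedBall hpW)) _
    have hlx := hlim x (continuousAt_const.congr hcx.symm)
    have hly := hlim y (continuousAt_const.congr hcy.symm)
    rw [hcx.self_of_nhds] at hlx
    rw [hcy.self_of_nhds] at hly
    have hxy : (fun n => v n x) =ᶠ[atTop] fun n => v n y := by
      filter_upwards [hev] with n hn
      rw [hx n hn.1 hn.2, hy n hn.1 hn.2]
    have h5 := tendsto_nhds_unique (hlx.congr' hxy) hly
    rw [min_eq_right (hpos y).le] at h5
    exact absurd h5 (lt_min (hpos x) one_pos).ne'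
  have hsub := isWeakSubsolution_neg_ext h (hvm n hn0) (hv0 n)
    (fun x => (min_le_left _ _).trans (hgb x)) (hsup n hn0 hnα)
  have hS := sSup_neg_ext (A := A) h.isOpen hne h.compl_nonempty (hv0 n)
  obtain ⟨a, ha, hax⟩ := hH _ ⟨measurable_const, fun _ => n.cast_nonneg, ⟨n, fun _ => le_rfl⟩⟩ _
    hsub hS.ge (by
      rintro ⟨k, hk⟩
      refine hnc ⟨-k, ?_⟩
      filter_upwards [hk] with x hx
      rw [ext_coe] at hx
      linarith)
  refine ⟨a, ha, fun x => (hax x).trans ?_⟩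
  rw [hS, ext_coe, zero_sub, neg_neg]
  exact min_le_left _ _

/-- Under the Hopf lemma, each set of positive measure is reached in one step of the resolvent
chain with a probability bounded away from zero. -/
theorem exists_le_doobKernel (h : RegularExit A P D) (hne : D.Nonempty)
    (hm : ∀ x₀ : D, m {x₀}ᶜ ≠ 0) (hIR : Irreducible P D m)
    (hE : IsBoundedEigenpair P D m φ lam)
    (hH : ∀ c : D → ℝ, IsAdmissible c → HopfLemma A P D m φ c)
    {α : ℝ} (hα : 0 < α) {B : Set D} (hB : MeasurableSet B) (hmB : m B ≠ 0) :
    ∃ a > 0, ∀ x, a ≤ (doobKernel (killed P h.isOpen) φ lam α x).real B := by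
  have := isFiniteKernel_killed h
  have := hE.isMarkovKernel h hIR hα
  have hle1 := killed_le_one h
  obtain ⟨M, hM⟩ := hE.bounded
  have hf : Measurable (B.indicator φ) := hE.measurable.indicator hB
  have hf0 : ∀ x, 0 ≤ B.indicator φ x := Set.indicator_nonneg fun _ _ => hE.nonneg _
  have hfM : ∀ x, B.indicator φ x ≤ M := fun x =>
    (Set.indicator_le_self' (fun _ _ => hE.nonneg _) x).trans (hM x)
  have hint := hE.lintegral_indicator_pos hIR hB hmB
  have hpot : ∀ x, ENNReal.ofReal (boundedPotential (killed P h.isOpen) α (B.indicator φ) x) =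
      potential (killed P h.isOpen) α (fun y => ENNReal.ofReal (B.indicator φ y)) x :=
    fun x => ofReal_potential hle1 hα hf hf0 hfM x
  have hpos : ∀ x, 0 < boundedPotential (killed P h.isOpen) α (B.indicator φ) x := fun x => by
    rw [← ENNReal.ofReal_pos, hpot]
    exact hIR.potential_pos h hf hf0 hfM hint α x
  obtain ⟨a, ha, hax⟩ := exists_mul_le_boundedPotential h hne hm hH hf hf0 hfM hα hpos
  refine ⟨α * a, mul_pos hα ha, fun x => ?_⟩
  have hφx := hE.pos hIR x
  rw [measureReal_def, ← ENNReal.ofReal_le_iff_le_toReal (measure_ne_top _ _)]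
  refine le_trans ?_ (potential_le_doobKernel hE.measurable (hE.pos hIR) hα
    hE.eigenvalue_nonneg hB x)
  rw [← hpot, ← ENNReal.ofReal_mul (div_pos hα hφx).le]
  refine ENNReal.ofReal_le_ofReal ?_
  calc α * a = α / φ x * (a * φ x) := by field_simp
    _ ≤ _ := mul_le_mul_of_nonneg_left (hax x) (div_pos hα hφx).le

end

section
variable {S : Type*} [MeasurableSpace S] {K : Kernel S S} [IsMarkovKernel K] {m : Measure S}

/-! ### Contraction of oscillations by a Markov kernel -/

/-- If every set of positive measure is hit with a probability bounded away from zero, then this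
holds uniformly over the sets of full measure. -/
lemma exists_le_of_measure_compl_eq_zero (hm : m ≠ 0)
    (hK : ∀ B, MeasurableSet B → m B ≠ 0 → ∃ a > 0, ∀ x, a ≤ (K x).real B) :
    ∃ ε > 0, ∀ B, MeasurableSet B → m Bᶜ = 0 → ∀ x, ε ≤ (K x).real B := by
  by_contra! hcon
  choose B hBm hB0 x hx using fun n : ℕ => hcon (1 / ((n : ℝ) + 1)) (by positivity)
  have hI : m (⋂ n, B n)ᶜ = 0 := by
    rw [Set.compl_iInter]; exact measure_iUnion_null hB0
  have hne : m (⋂ n, B n) ≠ 0 := fun h0 => hm <| by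
    rw [← Measure.measure_univ_eq_zero, ← Set.union_compl_self (⋂ n, B n)]
    exact measure_union_null h0 hI
  obtain ⟨a, ha, hax⟩ := hK _ (MeasurableSet.iInter hBm) hne
  obtain ⟨n, hn⟩ := exists_nat_one_div_lt ha
  have h1 : (K (x n)).real (⋂ n, B n) ≤ (K (x n)).real (B n) :=
    measureReal_mono (Set.iInter_subset _ n)
  linarith [hax (x n), hx n]

/-- The absolutely continuous part of `K` with respect to `m` has a jointly measurable density,
whose integral is bounded away from zero. -/
lemma exists_density [MeasurableSpace.CountablyGenerated S] [IsFiniteMeasure m] (hm : m ≠ 0)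
    (hK : ∀ B, MeasurableSet B → m B ≠ 0 → ∃ a > 0, ∀ x, a ≤ (K x).real B) :
    ∃ ε > 0, ∃ k : S → S → ℝ, Measurable (Function.uncurry k) ∧ (∀ x y, 0 ≤ k x y) ∧
      (∀ x, Integrable (k x) m) ∧ (∀ x, ε ≤ ∫ y, k x y ∂m) ∧
      ∀ x, m.withDensity (fun y => ENNReal.ofReal (k x y)) ≤ K x := by
  obtain ⟨ε, hε, hεB⟩ := exists_le_of_measure_compl_eq_zero hm hK
  have hmeas := Kernel.measurable_rnDeriv K (Kernel.const S m)
  have hle : ∀ x, m.withDensity (Kernel.rnDeriv K (Kernel.const S m) x) ≤ K x := by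
    intro x
    have h1 := congrArg (fun η : Kernel S S => η x)
      (Kernel.rnDeriv_add_singularPart K (Kernel.const S m))
    simp only [FunLike.coe_add, Pi.add_apply] at h1
    rw [Kernel.withDensity_apply _ hmeas, Kernel.const_apply] at h1
    conv_rhs => rw [← h1]
    exact Measure.le_add_right le_rfl
  have hlint : ∀ x, ∫⁻ y, Kernel.rnDeriv K (Kernel.const S m) x y ∂m ≤ 1 := fun x => by
    rw [← setLIntegral_univ, ← withDensity_apply _ MeasurableSet.univ]
    exact (hle x Set.univ).trans prob_le_one
  have hfin : ∀ x, ∀ᵐ y ∂m, Kernel.rnDeriv K (Kernel.const S m) x y < ∞ := fun x =>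
    ae_lt_top (hmeas.comp measurable_prodMk_left) ((hlint x).trans_lt ENNReal.one_lt_top).ne
  have hae : ∀ x, (fun y => ENNReal.ofReal (Kernel.rnDeriv K (Kernel.const S m) x y).toReal) =ᵐ[m]
      Kernel.rnDeriv K (Kernel.const S m) x := fun x => by
    filter_upwards [hfin x] with y hy
    exact ENNReal.ofReal_toReal hy.ne
  refine ⟨ε, hε, fun x y => (Kernel.rnDeriv K (Kernel.const S m) x y).toReal,
    hmeas.ennreal_toReal, fun _ _ => ENNReal.toReal_nonneg, fun x => ?_, fun x => ?_, fun x => ?_⟩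
  · exact integrable_toReal_of_lintegral_ne_top (hmeas.comp measurable_prodMk_left).aemeasurable
      ((hlint x).trans_lt ENNReal.one_lt_top).ne
  · have hmx : AEMeasurable (Kernel.rnDeriv K (Kernel.const S m) x) m :=
      (hmeas.comp measurable_prodMk_left).aemeasurable
    rw [integral_toReal hmx (hfin x),
      ← ENNReal.ofReal_le_iff_le_toReal ((hlint x).trans_lt ENNReal.one_lt_top).ne]
    -- outside of the singular set, which is `m`-null, `K x` has the given density
    set Z := Kernel.mutuallySingularSetSlice K (Kernel.const S m) x with hZ
    have hZm : MeasurableSet Z := Kernel.measurableSet_mutuallySingularSetSlice _ _ _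
    have hZ0 : m Z = 0 := by
      have := Kernel.measure_mutuallySingularSetSlice K (Kernel.const S m) x
      rwa [Kernel.const_apply] at this
    have h1 := Kernel.withDensity_rnDeriv_of_subset_compl_mutuallySingularSetSlice
      (κ := K) (η := Kernel.const S m) (a := x) hZm.compl subset_rfl
    rw [Kernel.withDensity_apply _ hmeas, Kernel.const_apply, withDensity_apply _ hZm.compl] at h1
    have h2 := hεB Zᶜ hZm.compl (by rwa [compl_compl]) x
    rw [measureReal_def, ← ENNReal.ofReal_le_iff_le_toReal (measure_ne_top _ _), ← h1] at h2
    exact h2.trans (setLIntegral_le_lintegral _ _)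
  · rw [withDensity_congr_ae (hae x)]
    exact hle x

/-- Since `L¹(m)` is separable, a measurable family of integrable densities is nearly constant on a
set of positive measure. -/
lemma exists_set_integral_abs_sub_le [MeasurableSpace.CountablyGenerated S] [IsFiniteMeasure m]
    (hm : m ≠ 0) {k : S → S → ℝ} (hk : Measurable (Function.uncurry k))
    (hki : ∀ x, Integrable (k x) m) {η : ℝ} (hη : 0 < η) :
    ∃ G, MeasurableSet G ∧ m G ≠ 0 ∧ ∀ x ∈ G, ∀ x' ∈ G, ∫ y, |k x y - k x' y| ∂m ≤ η := by
  have : Fact ((1 : ℝ≥0∞) ≠ ∞) := ⟨ENNReal.one_ne_top⟩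
  let g : ℕ → Lp ℝ 1 m := TopologicalSpace.denseSeq (Lp ℝ 1 m)
  let G : ℕ → Set S := fun n => {x | ∫ y, |k x y - g n y| ∂m ≤ η / 2}
  have hGm : ∀ n, MeasurableSet (G n) := fun n => by
    refine measurableSet_le (StronglyMeasurable.measurable ?_) measurable_const
    refine StronglyMeasurable.integral_prod_right (f := fun x y => |k x y - g n y|) ?_
    have h1 : Measurable (g n) := (Lp.stronglyMeasurable (g n)).measurable
    exact ((hk.sub (h1.comp measurable_snd)).abs).stronglyMeasurable
  have hcover : (⋃ n, G n) = Set.univ := Set.eq_univ_of_forall fun x => by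
    obtain ⟨n, hn⟩ := (TopologicalSpace.denseRange_denseSeq (Lp ℝ 1 m)).exists_dist_lt
      ((hki x).toL1 (k x)) (half_pos hη)
    refine Set.mem_iUnion.2 ⟨n, ?_⟩
    rw [L1.dist_eq_integral_dist] at hn
    refine le_trans (le_of_eq (integral_congr_ae ?_)) hn.le
    filter_upwards [(hki x).coeFn_toL1] with y hy
    rw [hy, Real.dist_eq]
  obtain ⟨n, hn⟩ : ∃ n, m (G n) ≠ 0 := by
    by_contra! hcon
    refine hm (Measure.measure_univ_eq_zero.1 ?_)
    rw [← hcover]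
    exact measure_iUnion_null hcon
  refine ⟨G n, hGm n, hn, fun x hx x' hx' => ?_⟩
  have hgi : Integrable (g n) m := L1.integrable_coeFn (g n)
  have hx1 : ∫ y, |k x y - g n y| ∂m ≤ η / 2 := hx
  have hx2 : ∫ y, |k x' y - g n y| ∂m ≤ η / 2 := hx'
  calc ∫ y, |k x y - k x' y| ∂m
      ≤ ∫ y, (|k x y - g n y| + |k x' y - g n y|) ∂m := by
        refine integral_mono ((hki x).sub (hki x')).abs
          (((hki x).sub hgi).abs.add ((hki x').sub hgi).abs) fun y => ?_
        simp only
        rw [abs_sub_comm (k x' y)]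
        exact abs_sub_le _ _ _
    _ = ∫ y, |k x y - g n y| ∂m + ∫ y, |k x' y - g n y| ∂m :=
        integral_add ((hki x).sub hgi).abs ((hki x').sub hgi).abs
    _ ≤ η := by linarith

/-- If two probability measures dominate measures with nearly equal densities, then the integrals of
a function differ by strictly less than its oscillation. -/
lemma integral_sub_integral_le_of_density {μ ν : Measure S} [IsProbabilityMeasure μ]
    [IsProbabilityMeasure ν] {p q : S → ℝ} (hp : Measurable p) (hq : Measurable q)
    (hp0 : ∀ y, 0 ≤ p y) (hq0 : ∀ y, 0 ≤ q y) (hpi : Integrable p m) (hqi : Integrable q m)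
    (hpμ : m.withDensity (fun y => ENNReal.ofReal (p y)) ≤ μ)
    (hqν : m.withDensity (fun y => ENNReal.ofReal (q y)) ≤ ν) {ε : ℝ}
    (hε : ε ≤ ∫ y, p y ∂m) (hpq : ∫ y, |p y - q y| ∂m ≤ ε / 2)
    {f : S → ℝ} (hf : Measurable f) {c o : ℝ} (hfc : ∀ y, c ≤ f y) (hfo : ∀ y, f y ≤ c + o) :
    ∫ y, f y ∂μ - ∫ y, f y ∂ν ≤ (1 - ε / 2) * o := by
  have hne : Nonempty S := by
    by_contra hS
    rw [not_nonempty_iff] at hS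
    have h1 := measure_univ (μ := μ)
    rw [Set.eq_empty_of_isEmpty Set.univ, measure_empty] at h1
    exact zero_ne_one h1
  have ho : 0 ≤ o := by
    obtain ⟨y⟩ := hne
    linarith [hfc y, hfo y]
  have hfb : ∀ y, |f y - c| ≤ o := fun y => by
    rw [abs_of_nonneg (sub_nonneg.2 (hfc y))]; linarith [hfo y]
  have hfb' : ∀ y, |f y| ≤ |c| + o := fun y => by
    have := abs_add_le c (f y - c)
    rw [add_sub_cancel] at this
    linarith [hfb y]
  have hfμ : Integrable f μ := integrable_of_bounded hf hfb'
  have hfν : Integrable f ν := integrable_of_bounded hf hfb'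
  have hdens : ∀ {r : S → ℝ}, Measurable r → (∀ y, 0 ≤ r y) → ∀ g : S → ℝ,
      ∫ y, g y ∂(m.withDensity fun y => ENNReal.ofReal (r y)) = ∫ y, r y * g y ∂m := by
    intro r hr hr0 g
    rw [integral_withDensity_eq_integral_toReal_smul hr.ennreal_ofReal
      (ae_of_all _ fun _ => ENNReal.ofReal_lt_top)]
    simp_rw [ENNReal.toReal_ofReal (hr0 _), smul_eq_mul]
  have hgm : Measurable fun y => f y - c := hf.sub_const c
  have hmulb : ∀ {r : S → ℝ}, Integrable r m → Integrable (fun y => r y * (f y - c)) m :=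
    fun hr => hr.mul_bdd (c := o) hgm.aestronglyMeasurable
      (ae_of_all _ fun y => by simpa using hfb y)
  have h1 : ∫ y, q y * (f y - c) ∂m ≤ ∫ y, f y ∂ν - c := by
    have h2 := integral_mono_measure hqν (ae_of_all _ fun y => sub_nonneg.2 (hfc y))
      (hfν.sub (integrable_const c))
    rw [hdens hq hq0 (fun y => f y - c)] at h2
    refine h2.trans_eq ?_
    rw [integral_sub hfν (integrable_const c)]
    simp
  have h2 : ∫ y, p y * (o - (f y - c)) ∂m ≤ o - (∫ y, f y ∂μ - c) := by
    have h3 := integral_mono_measure hpμ (f := fun y => o - (f y - c))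
      (ae_of_all _ fun y => by simp only [Pi.zero_apply]; linarith [hfo y])
      ((integrable_const o).sub (hfμ.sub (integrable_const c)))
    rw [hdens hp hp0 (fun y => o - (f y - c))] at h3
    refine h3.trans_eq ?_
    have hs : Integrable (fun y => f y - c) μ := hfμ.sub (integrable_const c)
    rw [integral_sub (integrable_const o) hs, integral_sub hfμ (integrable_const c)]
    simp
  have h3 : ∫ y, p y * (o - (f y - c)) ∂m = o * ∫ y, p y ∂m - ∫ y, p y * (f y - c) ∂m := by
    rw [← integral_const_mul, ← integral_sub (hpi.const_mul o) (hmulb hpi)]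
    congr 1
    ext y
    ring
  have h4 : ∫ y, p y * (f y - c) ∂m - ∫ y, q y * (f y - c) ∂m ≤ o * (ε / 2) := by
    rw [← integral_sub (hmulb hpi) (hmulb hqi)]
    calc ∫ y, (p y * (f y - c) - q y * (f y - c)) ∂m ≤ ∫ y, o * |p y - q y| ∂m := by
          refine integral_mono ((hmulb hpi).sub (hmulb hqi)) ((hpi.sub hqi).abs.const_mul o)
            fun y => ?_
          simp only
          rw [← sub_mul, mul_comm o]
          refine (le_abs_self _).trans ?_
          rw [abs_mul]
          exact mul_le_mul_of_nonneg_left (hfb y) (abs_nonneg _)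
      _ = o * ∫ y, |p y - q y| ∂m := integral_const_mul _ _
      _ ≤ _ := mul_le_mul_of_nonneg_left hpq ho
  have h5 : o * ε ≤ o * ∫ y, p y ∂m := mul_le_mul_of_nonneg_left hε ho
  nlinarith

/-- Averaging does not increase the oscillation. -/
lemma integral_sub_integral_le {f : S → ℝ} (hf : Measurable f) {C : ℝ} (hC : ∀ x, |f x| ≤ C)
    {o : ℝ} (ho : ∀ x y, f x - f y ≤ o) (x y : S) :
    ∫ z, f z ∂(K x) - ∫ z, f z ∂(K y) ≤ o := by
  have hi : ∀ x, Integrable f (K x) := fun x => integrable_of_bounded hf hC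
  have h1 : ∀ w, ∫ z, f z ∂(K x) ≤ f w + o := fun w => by
    have := integral_mono (hi x) (integrable_const (f w + o)) fun z => by linarith [ho z w]
    simpa using this
  have h2 := integral_mono (integrable_const (∫ z, f z ∂(K x) - o)) (hi y) fun w => by
    linarith [h1 w]
  have h3 : ∫ z, f z ∂(K x) - o ≤ ∫ z, f z ∂(K y) := by simpa using h2
  linarith

/-- If the oscillation is reduced on a set that is hit with probability at least `a`, then averaging
reduces the oscillation. -/
lemma integral_sub_integral_le_of_set {g : S → ℝ} (hg : Measurable g) {C : ℝ}
    (hC : ∀ x, |g x| ≤ C) {o κ a : ℝ} (ho0 : 0 ≤ o) (hκ : 0 ≤ κ) (ha : 0 ≤ a)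
    (ho : ∀ x y, g x - g y ≤ o) {G : Set S} (hG : MeasurableSet G)
    (hoG : ∀ x ∈ G, ∀ y ∈ G, g x - g y ≤ (1 - κ) * o) (hGa : ∀ x, a ≤ (K x).real G) (x y : S) :
    ∫ z, g z ∂(K x) - ∫ z, g z ∂(K y) ≤ (1 - a ^ 2 * κ) * o := by
  have hi : ∀ x, Integrable g (K x) := fun x => integrable_of_bounded hg hC
  have h1m : Measurable (G.indicator (1 : S → ℝ)) := measurable_one.indicator hG
  have hii : ∀ x, Integrable (G.indicator (1 : S → ℝ)) (K x) := fun x =>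
    (integrable_const (1 : ℝ)).indicator hG
  have h0 : ∀ z w, g z - g w ≤ o - κ * o * (G.indicator 1 z * G.indicator 1 w) := fun z w => by
    by_cases hz : z ∈ G
    · by_cases hw : w ∈ G
      · simp only [Set.indicator_of_mem hz, Set.indicator_of_mem hw, Pi.one_apply]
        linarith [hoG z hz w hw]
      · simpa [Set.indicator_of_notMem hw] using ho z w
    · simpa [Set.indicator_of_notMem hz] using ho z w
  have h1 : ∀ w, ∫ z, g z ∂(K x) ≤ g w + o - κ * o * (K x).real G * G.indicator 1 w := fun w => by
    have hs : Integrable (fun z => κ * o * G.indicator (1 : S → ℝ) w *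
        G.indicator (1 : S → ℝ) z) (K x) := (hii x).const_mul _
    have h2 : ∫ z, g z ∂(K x) ≤ ∫ z, (g w + o - κ * o * G.indicator (1 : S → ℝ) w *
        G.indicator (1 : S → ℝ) z) ∂(K x) :=
      integral_mono (hi x) ((integrable_const _).sub hs) fun z => by
        simp only
        linarith [h0 z w]
    rw [integral_sub (integrable_const _) hs, integral_const_mul, integral_indicator_one hG] at h2
    simp only [integral_const, probReal_univ, one_smul] at h2
    linarith
  have hs : Integrable (fun w => κ * o * (K x).real G * G.indicator (1 : S → ℝ) w) (K y) :=
    (hii y).const_mul _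
  have h2 : ∫ w, (∫ z, g z ∂(K x) - o + κ * o * (K x).real G * G.indicator (1 : S → ℝ) w) ∂(K y) ≤
      ∫ w, g w ∂(K y) :=
    integral_mono ((integrable_const _).add hs) (hi y) fun w => by
      simp only
      linarith [h1 w]
  rw [integral_add (integrable_const _) hs, integral_const_mul, integral_indicator_one hG] at h2
  simp only [integral_const, probReal_univ, one_smul] at h2
  have h4 : a ^ 2 ≤ (K x).real G * (K y).real G := by
    rw [sq]; exact mul_le_mul (hGa x) (hGa y) ha (ha.trans (hGa x))
  have h5 : κ * o * a ^ 2 ≤ κ * o * ((K x).real G * (K y).real G) :=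
    mul_le_mul_of_nonneg_left h4 (mul_nonneg hκ ho0)
  linarith

/-- If every set of positive measure is hit in one step with a probability bounded away from zero,
then two steps of the chain contract oscillations by a fixed factor. -/
theorem exists_contraction [MeasurableSpace.CountablyGenerated S] [IsFiniteMeasure m] (hm : m ≠ 0)
    (hK : ∀ B, MeasurableSet B → m B ≠ 0 → ∃ a > 0, ∀ x, a ≤ (K x).real B) :
    ∃ ρ : ℝ, 0 < ρ ∧ ρ < 1 ∧ ∀ f : S → ℝ, Measurable f → ∀ C, (∀ x, |f x| ≤ C) →
      ∀ o, 0 ≤ o → (∀ x y, f x - f y ≤ o) → ∀ x y,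
        ∫ z, (∫ w, f w ∂(K z)) ∂(K x) - ∫ z, (∫ w, f w ∂(K z)) ∂(K y) ≤ ρ * o := by
  obtain ⟨ε, hε, k, hkm, hk0, hki, hkε, hkK⟩ := exists_density hm hK
  obtain ⟨G, hGm, hG0, hG⟩ := exists_set_integral_abs_sub_le hm hkm hki (half_pos hε)
  obtain ⟨a, ha, hGa⟩ := hK G hGm hG0
  refine ⟨max (1 - a ^ 2 * (ε / 2)) (1 / 2), by positivity,
    max_lt (by linarith [mul_pos (pow_pos ha 2) (half_pos hε)]) (by norm_num), ?_⟩
  intro f hf C hC o ho0 ho x y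
  have hkm' : ∀ x, Measurable (k x) := fun x => hkm.comp measurable_prodMk_left
  have hgm : Measurable fun z => ∫ w, f w ∂(K z) :=
    hf.stronglyMeasurable.integral_kernel.measurable
  have hgC : ∀ z, |∫ w, f w ∂(K z)| ≤ C := fun z => by
    have := norm_integral_le_of_norm_le_const (f := f) (C := C) (μ := K z)
      (ae_of_all _ fun y => by simpa using hC y)
    simpa using this
  have hbdd : BddBelow (Set.range f) := ⟨-C, by
    rintro _ ⟨z, rfl⟩; exact (abs_le.1 (hC z)).1⟩
  have hne : Nonempty S := ⟨x⟩
  refine (integral_sub_integral_le_of_set hgm hgC ho0 (half_pos hε).le ha.le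
    (integral_sub_integral_le hf hC ho) hGm (fun z hz w hw => ?_) hGa x y).trans
    (mul_le_mul_of_nonneg_right (le_max_left _ _) ho0)
  refine integral_sub_integral_le_of_density (hkm' z) (hkm' w) (hk0 z) (hk0 w) (hki z) (hki w)
    (hkK z) (hkK w) (hkε z) (hG z hz w hw) hf (c := sInf (Set.range f))
    (fun y => csInf_le hbdd ⟨y, rfl⟩) fun y => ?_
  have : f y - o ≤ sInf (Set.range f) := le_csInf (Set.range_nonempty f) (by
    rintro _ ⟨v, rfl⟩; linarith [ho y v])
  linarith

end

/-! ### Uniform limits of probability measures -/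

section
variable {S : Type*} [MeasurableSpace S]

/-- A set function that is the uniform limit of probability measures is a probability measure. -/
lemma exists_isProbabilityMeasure_of_uniform (μ : ℕ → Measure S) [∀ n, IsProbabilityMeasure (μ n)]
    (L : Set S → ℝ) {δ : ℕ → ℝ} (hδ : Tendsto δ atTop (𝓝 0))
    (h : ∀ n B, MeasurableSet B → |(μ n).real B - L B| ≤ δ n) :
    ∃ Q : Measure S, IsProbabilityMeasure Q ∧ ∀ B, MeasurableSet B → Q.real B = L B := by
  have hlim : ∀ B, MeasurableSet B → Tendsto (fun n => (μ n).real B) atTop (𝓝 (L B)) := by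
    intro B hB
    rw [tendsto_iff_dist_tendsto_zero]
    exact squeeze_zero (fun n => dist_nonneg) (fun n => h n B hB) hδ
  have hL0 : ∀ B, MeasurableSet B → 0 ≤ L B := fun B hB =>
    ge_of_tendsto' (hlim B hB) fun n => measureReal_nonneg
  have hempty : L ∅ = 0 :=
    tendsto_nhds_unique (hlim ∅ MeasurableSet.empty) (by simp)
  have huniv : L Set.univ = 1 :=
    tendsto_nhds_unique (hlim _ MeasurableSet.univ) (by simp)
  have hsum : ∀ f : ℕ → Set S, (∀ i, MeasurableSet (f i)) → Pairwise (Function.onFun Disjoint f) →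
      HasSum (fun i => L (f i)) (L (⋃ i, f i)) := by
    intro f hf hd
    rw [hasSum_iff_tendsto_nat_of_nonneg fun i => hL0 _ (hf i)]
    have hU : ∀ N : ℕ, MeasurableSet (⋃ i ∈ Finset.range N, f i) := fun N =>
      Finset.measurableSet_biUnion _ fun i _ => hf i
    have hfin : ∀ n N, (μ n).real (⋃ i ∈ Finset.range N, f i) =
        ∑ i ∈ Finset.range N, (μ n).real (f i) := fun n N =>
      measureReal_biUnion_finset (fun i _ j _ hij => hd hij) fun i _ => hf i
    have hfinL : ∀ N, L (⋃ i ∈ Finset.range N, f i) = ∑ i ∈ Finset.range N, L (f i) := fun N => by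
      refine tendsto_nhds_unique (hlim _ (hU N)) ?_
      simp_rw [hfin]
      exact tendsto_finsetSum _ fun i _ => hlim _ (hf i)
    have hunif : TendstoUniformly (fun n N => ∑ i ∈ Finset.range N, (μ n).real (f i))
        (fun N => ∑ i ∈ Finset.range N, L (f i)) atTop := by
      rw [Metric.tendstoUniformly_iff]
      intro ε hε
      filter_upwards [hδ.eventually_lt_const hε] with n hn N
      rw [dist_comm, Real.dist_eq, ← hfin, ← hfinL]
      exact (h n _ (hU N)).trans_lt hn
    refine hunif.tendsto_of_eventually_tendsto (Eventually.of_forall fun n => ?_)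
      (hlim _ (MeasurableSet.iUnion hf))
    have h1 := hasSum_integral_iUnion (μ := μ n) (f := fun _ => (1 : ℝ)) hf hd
      (integrable_const 1).integrableOn
    simp only [setIntegral_const, smul_eq_mul, mul_one] at h1
    exact h1.tendsto_sum_nat
  let Q : Measure S := Measure.ofMeasurable (fun B _ => ENNReal.ofReal (L B)) (by simp [hempty]) (by
    intro f hf hd
    have h1 := hsum f hf hd
    rw [← h1.tsum_eq, ENNReal.ofReal_tsum_of_nonneg (fun i => hL0 _ (hf i)) h1.summable])
  have hQ : ∀ B, MeasurableSet B → Q B = ENNReal.ofReal (L B) := fun B hB =>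
    Measure.ofMeasurable_apply B hB
  refine ⟨Q, ⟨by rw [hQ _ MeasurableSet.univ, huniv, ENNReal.ofReal_one]⟩, fun B hB => ?_⟩
  rw [measureReal_def, hQ B hB, ENNReal.toReal_ofReal (hL0 B hB)]

/-- Two probability measures that are close on all sets are close on all bounded functions. -/
lemma abs_integral_sub_integral_le_of_measureReal {μ ν : Measure S} [IsProbabilityMeasure μ]
    [IsProbabilityMeasure ν] {δ : ℝ} (h : ∀ B, MeasurableSet B → |μ.real B - ν.real B| ≤ δ)
    {f : S → ℝ} (hf : Measurable f) (hf1 : ∀ y, |f y| ≤ 1) :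
    |∫ y, f y ∂μ - ∫ y, f y ∂ν| ≤ 2 * δ := by
  have hgm : Measurable fun y => (f y + 1) / 2 := (hf.add_const 1).div_const 2
  have hg0 : ∀ y, 0 ≤ (f y + 1) / 2 := fun y => by linarith [(abs_le.1 (hf1 y)).1]
  have hg1 : ∀ y, (f y + 1) / 2 ≤ 1 := fun y => by linarith [(abs_le.1 (hf1 y)).2]
  have hcake : ∀ (η : Measure S) [IsProbabilityMeasure η],
      IntegrableOn (fun t => η.real {y | t ≤ (f y + 1) / 2}) (Set.Ioc (0 : ℝ) 1) ∧
      ∫ y, f y ∂η = 2 * (∫ t in Set.Ioc (0 : ℝ) 1, η.real {y | t ≤ (f y + 1) / 2}) - 1 := by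
    intro η _
    have hfi : Integrable f η := integrable_of_bounded hf hf1
    have hgi : Integrable (fun y => (f y + 1) / 2) η :=
      (hfi.add (integrable_const 1)).div_const 2
    constructor
    · have hanti : Antitone fun t : ℝ => η.real {y | t ≤ (f y + 1) / 2} := fun s t hst =>
        measureReal_mono fun y hy => hst.trans hy
      exact (hanti.antitoneOn _).integrableOn_of_measure_ne_top (isLeast_Icc zero_le_one)
        (isGreatest_Icc zero_le_one) (by simp) measurableSet_Icc |>.mono_set Set.Ioc_subset_Icc_self
    · have h1 := hgi.integral_eq_integral_Ioc_meas_le (ae_of_all _ hg0) (ae_of_all _ hg1)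
      rw [← h1, integral_div, integral_add hfi (integrable_const 1)]
      simp
      ring
  obtain ⟨hi1, h1⟩ := hcake μ
  obtain ⟨hi2, h2⟩ := hcake ν
  have e : ∫ y, f y ∂μ - ∫ y, f y ∂ν = 2 * ∫ t in Set.Ioc (0 : ℝ) 1,
      (μ.real {y | t ≤ (f y + 1) / 2} - ν.real {y | t ≤ (f y + 1) / 2}) := by
    rw [h1, h2, integral_sub hi1 hi2]
    ring
  rw [e, abs_mul, abs_two]
  refine mul_le_mul_of_nonneg_left ?_ zero_le_two
  have h3 := norm_setIntegral_le_of_norm_le_const (μ := volume) (s := Set.Ioc (0 : ℝ) 1)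
    (f := fun t => μ.real {y | t ≤ (f y + 1) / 2} - ν.real {y | t ≤ (f y + 1) / 2}) (C := δ)
    (by simp) fun t _ => h _ (measurableSet_le measurable_const hgm)
  simpa using h3

/-! ### Uniform ergodicity from the hitting bounds -/

/-- The iterates of a Markov kernel. -/
noncomputable def iterateKernel (K : Kernel S S) : ℕ → Kernel S S
  | 0 => Kernel.id
  | n + 1 => K ∘ₖ iterateKernel K n

lemma isMarkovKernel_iterateKernel (K : Kernel S S) [IsMarkovKernel K] (n : ℕ) :
    IsMarkovKernel (iterateKernel K n) := by
  induction n with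
  | zero => rw [iterateKernel]; infer_instance
  | succ n ih => rw [iterateKernel]; infer_instance

variable {K : Kernel S S} [IsMarkovKernel K] {T : (S → ℝ) → S → ℝ}

/-- The iterates of the transition operator on bounded measurable functions are integrals against
the iterated kernels. -/
lemma iterate_eq_integral
    (hT : ∀ f : S → ℝ, Measurable f → ∀ C, (∀ x, |f x| ≤ C) → ∀ x, T f x = ∫ y, f y ∂(K x))
    (n : ℕ) {f : S → ℝ} (hf : Measurable f) {C : ℝ} (hC : ∀ x, |f x| ≤ C) (x : S) :
    T^[n] f x = ∫ y, f y ∂(iterateKernel K n x) := by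
  induction n generalizing f with
  | zero => simp [iterateKernel, Kernel.id_apply, integral_dirac' f x hf.stronglyMeasurable]
  | succ n ih =>
    have := isMarkovKernel_iterateKernel K n
    have h1 := iterate_mem_Icc hT hf (a := -C) (b := C) (fun y => abs_le.1 (hC y)) 1
    simp only [Function.iterate_one] at h1
    rw [Function.iterate_succ_apply, ih h1.1 fun y => abs_le.2 (h1.2 y), iterateKernel,
      Kernel.integral_comp (integrable_of_bounded hf hC)]
    exact integral_congr_ae (ae_of_all _ fun y => hT f hf C hC y)

/-- A Markov chain that hits each set of positive measure in one step with a probability bounded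
away from zero is uniformly ergodic. -/
theorem uniformlyErgodicChain_of_hitting [MeasurableSpace.CountablyGenerated S] {m : Measure S}
    [SigmaFinite m] (hm : m ≠ 0)
    (hK : ∀ B, MeasurableSet B → m B ≠ 0 → ∃ a > 0, ∀ x, a ≤ (K x).real B)
    (hT : ∀ f : S → ℝ, Measurable f → ∀ C, (∀ x, |f x| ≤ C) → ∀ x, T f x = ∫ y, f y ∂(K x)) :
    UniformlyErgodicChain T := by
  obtain ⟨m', hm'f, hmm', hm'm⟩ := exists_isFiniteMeasure_absolutelyContinuous m
  have hm'0 : m' ≠ 0 := fun h0 => hm (by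
    rw [h0] at hmm'; exact Measure.absolutelyContinuous_zero_iff.1 hmm')
  obtain ⟨ρ, hρ0, hρ1, hρ⟩ := exists_contraction (K := K) hm'0
    fun B hB hmB => hK B hB fun h0 => hmB (hm'm h0)
  obtain ⟨x₀⟩ : Nonempty S := by
    by_contra hS
    rw [not_nonempty_iff] at hS
    exact hm (Measure.eq_zero_of_isEmpty m)
  have hit := fun {f : S → ℝ} (hf : Measurable f) (hf1 : ∀ y, |f y| ≤ 1) =>
    iterate_mem_Icc hT hf (a := -1) (b := 1) fun y => abs_le.1 (hf1 y)
  -- the oscillation decays geometrically along even times, and does not increase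
  have heven : ∀ f : S → ℝ, Measurable f → (∀ y, |f y| ≤ 1) → ∀ j : ℕ, ∀ x y,
      T^[2 * j] f x - T^[2 * j] f y ≤ 2 * ρ ^ j := by
    intro f hf hf1 j
    induction j with
    | zero =>
      intro x y
      simp only [mul_zero, Function.iterate_zero, id_eq, pow_zero, mul_one]
      linarith [(abs_le.1 (hf1 x)).2, (abs_le.1 (hf1 y)).1]
    | succ j ih =>
      intro x y
      obtain ⟨hm1, hb1⟩ := hit hf hf1 (2 * j)
      obtain ⟨hm2, hb2⟩ := hit hf hf1 (2 * j + 1)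
      have e : ∀ x, T^[2 * (j + 1)] f x = ∫ z, (∫ w, T^[2 * j] f w ∂(K z)) ∂(K x) := fun x => by
        rw [show 2 * (j + 1) = 2 * j + 1 + 1 by ring, Function.iterate_succ_apply',
          hT _ hm2 1 fun y => abs_le.2 (hb2 y)]
        refine integral_congr_ae (ae_of_all _ fun z => ?_)
        simp only
        rw [Function.iterate_succ_apply', hT _ hm1 1 fun y => abs_le.2 (hb1 y)]
      rw [e, e]
      refine (hρ _ hm1 1 (fun y => abs_le.2 (hb1 y)) _ (by positivity) ih x y).trans
        (le_of_eq (by ring))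
  set r := Real.sqrt ρ with hr
  have hr0 : 0 < r := Real.sqrt_pos.2 hρ0
  have hr1 : r < 1 := by rw [hr, Real.sqrt_lt' one_pos, one_pow]; exact hρ1
  have hrsq : r ^ 2 = ρ := Real.sq_sqrt hρ0.le
  set C := 2 / r with hCdef
  have hC0 : 0 < C := by positivity
  have hosc : ∀ f : S → ℝ, Measurable f → (∀ y, |f y| ≤ 1) → ∀ (n : ℕ) (x y : S),
      T^[n] f x - T^[n] f y ≤ C * r ^ n := by
    intro f hf hf1 n x y
    rcases Nat.even_or_odd' n with ⟨j, rfl | rfl⟩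
    · refine (heven f hf hf1 j x y).trans ?_
      rw [pow_mul, hrsq]
      refine mul_le_mul_of_nonneg_right ?_ (by positivity)
      rw [hCdef, le_div_iff₀ hr0]
      linarith
    · obtain ⟨hm1, hb1⟩ := hit hf hf1 (2 * j)
      have hb1' : ∀ y, |T^[2 * j] f y| ≤ 1 := fun y => abs_le.2 (hb1 y)
      rw [Function.iterate_succ_apply', hT _ hm1 1 hb1', hT _ hm1 1 hb1']
      refine (integral_sub_integral_le hm1 hb1' (heven f hf hf1 j) x y).trans (le_of_eq ?_)
      rw [pow_succ, pow_mul, hrsq, hCdef]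
      field_simp
  have hdiff : ∀ f : S → ℝ, Measurable f → (∀ y, |f y| ≤ 1) → ∀ (n k : ℕ) (x y : S),
      |T^[k + n] f y - T^[n] f x| ≤ C * r ^ n := by
    intro f hf hf1 n k x y
    obtain ⟨hm1, hb1⟩ := hit hf hf1 n
    have h1 := (iterate_mem_Icc hT hm1 (a := T^[n] f x - C * r ^ n) (b := T^[n] f x + C * r ^ n)
      (fun z => ⟨by linarith [hosc f hf hf1 n x z], by linarith [hosc f hf hf1 n z x]⟩) k).2 y
    rw [Function.iterate_add_apply, abs_le]
    exact ⟨by linarith [h1.1], by linarith [h1.2]⟩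
  have hconv : ∀ f : S → ℝ, Measurable f → (∀ y, |f y| ≤ 1) →
      ∃ l, Tendsto (fun n => T^[n] f x₀) atTop (𝓝 l) := by
    intro f hf hf1
    refine cauchySeq_tendsto_of_complete (cauchySeq_of_le_geometric r C hr1 fun n => ?_)
    rw [dist_comm, Real.dist_eq, add_comm n 1]
    exact hdiff f hf hf1 n 1 x₀ x₀
  have hind : ∀ B : Set S, MeasurableSet B → Measurable (B.indicator (1 : S → ℝ)) :=
    fun B hB => measurable_one.indicator hB
  have hind1 : ∀ (B : Set S) (y : S), |B.indicator (1 : S → ℝ) y| ≤ 1 := fun B y => by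
    by_cases hy : y ∈ B <;> simp [hy]
  choose! l hl using hconv
  have hlx : ∀ f : S → ℝ, Measurable f → (∀ y, |f y| ≤ 1) → ∀ (n : ℕ) (x : S),
      |T^[n] f x - l f| ≤ C * r ^ n := by
    intro f hf hf1 n x
    rw [abs_sub_comm]
    refine le_of_tendsto' (((hl f hf hf1).comp (tendsto_add_atTop_nat n)).sub_const _).abs
      fun k => ?_
    exact hdiff f hf hf1 n k x x₀
  have hδ : Tendsto (fun n : ℕ => C * r ^ n) atTop (𝓝 0) := by
    simpa using (tendsto_pow_atTop_nhds_zero_of_lt_one hr0.le hr1).const_mul C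
  have hreal : ∀ (n : ℕ) (x : S) (B : Set S), MeasurableSet B →
      (iterateKernel K n x).real B = T^[n] (B.indicator 1) x := fun n x B hB => by
    rw [iterate_eq_integral hT n (hind B hB) (hind1 B), integral_indicator_one hB]
  have hMk := isMarkovKernel_iterateKernel K
  obtain ⟨Q, hQp, hQ⟩ := exists_isProbabilityMeasure_of_uniform (fun n => iterateKernel K n x₀)
    (fun B => l (B.indicator 1)) hδ fun n B hB => by
      rw [hreal n x₀ B hB]; exact hlx _ (hind B hB) (hind1 B) n x₀
  have hTV : ∀ f : S → ℝ, Measurable f → (∀ y, |f y| ≤ 1) → ∀ (n : ℕ) (x : S),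
      |T^[n] f x - ∫ y, f y ∂Q| ≤ 2 * (C * r ^ n) := by
    intro f hf hf1 n x
    rw [iterate_eq_integral hT n hf hf1]
    refine abs_integral_sub_integral_le_of_measureReal (fun B hB => ?_) hf hf1
    rw [hreal n x B hB, hQ B hB]
    exact hlx _ (hind B hB) (hind1 B) n x
  have hlim : ∀ f : S → ℝ, Measurable f → (∀ y, |f y| ≤ 1) →
      Tendsto (fun n => T^[n] f x₀) atTop (𝓝 (∫ y, f y ∂Q)) := by
    intro f hf hf1
    rw [tendsto_iff_dist_tendsto_zero]
    refine squeeze_zero (fun n => dist_nonneg) (fun n => hTV f hf hf1 n x₀) ?_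
    simpa using hδ.const_mul 2
  refine ⟨Q, hQp, fun B hB => ?_, 2 * C, by positivity, r, hr0, hr1, fun n x f hf hf1 => ?_⟩
  · obtain ⟨hm1, hb1⟩ := hit (hind B hB) (hind1 B) 1
    simp only [Function.iterate_one] at hm1 hb1
    have hb1' : ∀ y, |T (B.indicator 1) y| ≤ 1 := fun y => abs_le.2 (hb1 y)
    refine ⟨integrable_of_bounded hm1 hb1', ?_⟩
    rw [← integral_indicator_one hB]
    refine tendsto_nhds_unique (hlim _ hm1 hb1') ?_
    exact (hlim _ (hind B hB) (hind1 B)).comp (tendsto_add_atTop_nat 1)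
  · rw [mul_assoc]; exact hTV f hf hf1 n x

end

end Hopf

theorem theorem4p5 {d : ℕ} (A : Hopf.Coefficients d)
    (P : ProbabilityTheory.Kernel (Hopf.E d) (Hopf.Path d))
    (hP : Hopf.IsStrongMarkovSolution A P)
    (D : Set (Hopf.E d)) (hD_open : IsOpen D) (hD_conn : IsConnected D)
    (hET : Hopf.ExitFinite P D)
    (m : MeasureTheory.Measure D) [MeasureTheory.SigmaFinite m]
    (hm : ∀ x₀ : D, m {x₀}ᶜ ≠ 0)
    (hIR : Hopf.Irreducible P D m)
    (φ : D → ℝ) (lam : ℝ) (hEig : Hopf.IsBoundedEigenpair P D m φ lam) :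
    (∀ c : D → ℝ, Hopf.IsAdmissible c → Hopf.HopfLemma A P D m φ c) ↔
      Hopf.UniformlyErgodicResolvent (Hopf.doobResolvent P D φ lam) := by
  have h := hP.regularExit hD_open hD_conn.nonempty hET
  have := h.isMarkov
  refine ⟨fun hH α hα => ?_, fun hU c hc => Hopf.hopfLemma_of_uniformlyErgodic h hIR hEig hU hc⟩
  have := hEig.isMarkovKernel h hIR hα
  obtain ⟨x₀, hx₀⟩ := hD_conn.nonempty
  have hm0 : m ≠ 0 := fun h0 => hm ⟨x₀, hx₀⟩ (by rw [h0]; rfl)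
  exact Hopf.uniformlyErgodicChain_of_hitting
    (K := Hopf.doobKernel (Hopf.killed P h.isOpen) φ lam α) hm0
    (fun B hB hmB => Hopf.exists_le_doobKernel h hD_conn.nonempty hm hIR hEig hH hα hB hmB)
    fun f hf C hC x => hEig.mul_doobResolvent_eq h hIR hα hf hC x
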